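/- **Setting.** Let $G$ be a finite Abelian group, written additively, $n=|G|$, and let $Z=[Z_1,\dots,Z_k]$ be a multiset of $k$ elements of $G$. A path $\rho$ from $0$ in the undirected (respectively directed) Cayley multigraph of $G$ generated by $Z$ is a finite sequence of steps, each of which adds $\pm Z_i$ (respectively $+Z_i$) for some $i$; let $x_i(\rho)$ be the number of steps of $\rho$ that use $Z_i$ or its inverse. For $p\in[1,\infty]$ put $$\mathrm{dist}_{k,p}(0,v)=\inf\{\|x(\rho)\|_p:\rho\text{ a path from }0\text{ to }v\},\qquad \mathcal B_{k,p}(R)=\{v\in G:\mathrm{dist}_{k,p}(0,v)\le R\},$$ $$\mathcal D_{k,p}(\beta)=\min\{R\ge0:|\mathcal B_{k,p}(R)|\ge\beta n\}\qquad(\beta\in(0,1)),$$ where an infimum or minimum over the empty set is $\infty$; a superscript $+$ denotes the directed case, and $(+)$ either case. The dimension $d(G)$ is the least $d$ for which $G\cong\bigoplus_{j=1}^d\mathbb Z_{m_j}$ for some $m_1,\dots,m_d$, and the minimal side-length $m_*(G)$ is the maximum of $\min_j m_j$ over all decompositions $G\cong\bigoplus_j\mathbb Z_{m_j}$. Set $C_p=2\,\Gamma(1/p+1)(pe)^{1/p}$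 for $p<\infty$, $C_\infty=2$, $C_p^+=C_p/2$, and (with $1/\infty=0$) $$\mathcal M^{(+)}_{k,p}=k^{1/p}n^{1/k}/C_p^{(+)} .$$ Thus $\mathcal M_{k,1}=kn^{1/k}/(2e)$ and $\mathcal M^+_{k,p}=2\mathcal M_{k,p}$. **Hypothesis 1** for integer sequences $(k_N,n_N)$ and $p$: $n_N\to\infty$, $k_N\to\infty$, and one of: $p=1$ and $\lim k_N/\log n_N$ exists in $[0,\infty)$; $p=\infty$ and $k_N/\log n_N\to0$; $p\in(1,\infty)$ and $k_N\le\log n_N/\log\log n_N$ for all $N$. **Hypothesis 2** for integer sequences $(k_N,n_N,d_N,m_N)$ and $p$: $k_N^{1/p}n_N^{1/k_N}/m_N\to0$, and one of: $k_N/\log n_N\to0$ and $\limsup d_N/k_N<1$; $\lim k_N/\log n_N\in(0,\infty)$, $p=1$ and $d_N\le\tfrac12\log n_N/\log\log n_N$ for all $N$. **Theorem.** Let $p\in[1,\infty]$ and let $(k_N,n_N)$ and $p$ satisfy Hypothesis 1. Write $k=k_N$, $n=n_N$. Below, "whp over $Z$" means with probability tending to $1$ as $N\to\infty$, when $Z_1,\dots,Z_k$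 are independent and uniform on $G_N$. (i) Suppose $k/\log n\to0$. There is a constant $K_p>0$, depending only on $p$, such that $\xi:=K_p\max\{(\log k)^2,\,k/n^{1/(2k)}\}/k$, which tends to $0$, has the following property. If $(G_N)$ are Abelian groups with $|G_N|=n_N$ such that $(k_N,n_N,d(G_N),m_*(G_N))$ and $p$ satisfy Hypothesis 2, then for every $\beta\in(0,1)$, in the undirected and in the directed case, $$\big|\mathcal D^{(+)}_{k,p}(\beta)-\mathcal M^{(+)}_{k,p}\big|\big/\mathcal M^{(+)}_{k,p}\le\xi\qquad\text{whp over }Z .$$ (ii) Suppose $p=1$ and $k/\log n\to\lambda\in(0,\infty)$. There are constants $\alpha,\alpha^+\in(0,\infty)$, depending only on $\lambda$, and a sequence $\xi=\xi_N\to0$, depending only on the sequences $(k_N,n_N)$, such that, if $(G_N)$ is as in (i), then for every $\beta\in(0,1)$, in both cases, $$\big|\mathcal D^{(+)}_{k,1}(\beta)-\alpha^{(+)}k\big|\big/(\alpha^{(+)}k)\le\xi\qquad\text{whp over }Z .$$ (iii) In each of the two regimes, with the same $\xi$ and with $\mathcal M^{(+)}=\mathcal M^{(+)}_{k,p}$ in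 (i) and $\mathcal M^{(+)}=\alpha^{(+)}k$ in (ii), the lower bound holds deterministically and without Hypothesis 2: for every $\beta\in(0,1)$ there is $N_0$ such that for all $N\ge N_0$, all Abelian groups $G$ of size $n_N$ and all multisets $Z$ of $k_N$ elements of $G$, $$\mathcal D^{(+)}_{k,p}(\beta)\ge\mathcal M^{(+)}\,(1-\xi).$$ -/

import Mathlib

open Filter Topology
open scoped ENNReal NNReal

noncomputable section

namespace TypicalDistance

/-! ## Dimension and minimal side-length of a finite Abelian group -/

/-- `⊕_{j=1}^{d} ℤ/(a j)` is a decomposition of the Abelian group `G`. -/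
def IsDecomposition (G : Type*) [AddCommGroup G] {d : ℕ} (a : Fin d → ℕ) : Prop :=
  Nonempty (G ≃+ ((j : Fin d) → ZMod (a j)))

/-- The dimension `d(G)`: the minimal length of a decomposition of `G` into cyclic groups. -/
def dimension (G : Type*) [AddCommGroup G] : ℕ :=
  sInf {d : ℕ | ∃ a : Fin d → ℕ, IsDecomposition G a}

/-- The minimal side-length `m_*(G)`: the maximum, over all decompositions of `G` into cyclic
groups, of the least side-length of the decomposition. -/
def minSideLength (G : Type*) [AddCommGroup G] : ℕ :=
  sSup {m : ℕ | ∃ (d : ℕ) (a : Fin d → ℕ), IsDecomposition G a ∧ IsLeast (Set.range a) m}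

/-! ## Paths, distances and balls in Cayley graphs -/

/-- The two flavours of Cayley graph: `G_k` (undirected) and `G_k⁺` (directed). -/
inductive Orientation where
  | undirected
  | directed

section Cayley

variable {G : Type*} [AddCommGroup G] {k : ℕ}

/-- A path started at `0` in the Cayley multigraph with generators `Z 0, …, Z (k-1)` is recorded by
its successive steps: the step `(i, 1)` adds the generator `Z i`, and the step `(i, -1)` (which is
available only in the undirected graph) subtracts it. `IsPathTo o Z ρ v` says that `ρ` is a path
from `0` to `v`. -/
def IsPathTo (o : Orientation) (Z : Fin k → G) (ρ : List (Fin k × ℤˣ)) (v : G) : Prop :=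
  (o = Orientation.directed → ∀ s ∈ ρ, s.2 = 1) ∧
    (ρ.map fun s => (s.2 : ℤ) • Z s.1).sum = v

/-- `x_i(ρ)`: the number of times that generator `i` or its inverse is used by the path `ρ`. -/
def usage (ρ : List (Fin k × ℤˣ)) (i : Fin k) : ℕ :=
  (ρ.map Prod.fst).count i

/-- The `p`-norm of a vector of `k` natural numbers. -/
def lpNorm (p : ℝ≥0∞) (x : Fin k → ℕ) : ℝ :=
  ‖WithLp.toLp p (fun i => (x i : ℝ))‖

/-- The `L_p` graph distance from `0` to `v`; it is `∞` if there is no path from `0` to `v`. -/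
def lpDist (o : Orientation) (p : ℝ≥0∞) (Z : Fin k → G) (v : G) : ℝ≥0∞ :=
  ⨅ (ρ : List (Fin k × ℤˣ)) (_ : IsPathTo o Z ρ v), ENNReal.ofReal (lpNorm p (usage ρ))

/-- The `L_p` ball of radius `R` about `0` in the Cayley graph. -/
def lpBall (o : Orientation) (p : ℝ≥0∞) (Z : Fin k → G) (R : ℝ≥0) : Set G :=
  {v : G | lpDist o p Z v ≤ (R : ℝ≥0∞)}

/-- The `L_p` typical distance: the least radius `R ≥ 0` for which the ball of radius `R` contains
at least a proportion `β` of the group; it is `∞` if there is no such radius. -/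
def typicalDist (o : Orientation) (p : ℝ≥0∞) (β : ℝ) (Z : Fin k → G) : ℝ≥0∞ :=
  ⨅ (R : ℝ≥0) (_ : β * (Nat.card G : ℝ) ≤ ((lpBall o p Z R).ncard : ℝ)), (R : ℝ≥0∞)

end Cayley

/-- The probability that `P Z` holds when `Z = [Z_1, …, Z_k]` consists of `k` independent uniformly
distributed elements of the finite group `G`, i.e. when `Z` is uniform on `G^k`. -/
def uniformProb {G : Type*} {k : ℕ} (P : (Fin k → G) → Prop) : ℝ :=
  (Nat.card {Z : Fin k → G // P Z} : ℝ) / (Nat.card (Fin k → G) : ℝ)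

/-! ## The hypotheses -/

/-- The growth conditions on the number of generators `k_N` and the group size `n_N`. -/
def HypothesisOne (k n : ℕ → ℕ) (p : ℝ≥0∞) : Prop :=
  Tendsto n atTop atTop ∧ Tendsto k atTop atTop ∧
    ((p = 1 ∧ ∃ lam : ℝ, 0 ≤ lam ∧
        Tendsto (fun N => (k N : ℝ) / Real.log (n N)) atTop (𝓝 lam)) ∨
      (p = ⊤ ∧ Tendsto (fun N => (k N : ℝ) / Real.log (n N)) atTop (𝓝 0)) ∨
      (1 < p ∧ p < ⊤ ∧ ∀ N, (k N : ℝ) ≤ Real.log (n N) / Real.log (Real.log (n N))))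

/-- The conditions on the dimensions `d_N` and the minimal side-lengths `m_N`. For `p = ∞`, the
exponent `1 / p`, written `p.toReal⁻¹`, is `0`. -/
def HypothesisTwo (k n d m : ℕ → ℕ) (p : ℝ≥0∞) : Prop :=
  Tendsto (fun N => (k N : ℝ) ^ p.toReal⁻¹ * (n N : ℝ) ^ (1 / (k N : ℝ)) / (m N : ℝ))
      atTop (𝓝 0) ∧
    ((Tendsto (fun N => (k N : ℝ) / Real.log (n N)) atTop (𝓝 0) ∧
        limsup (fun N => (d N : ℝ≥0∞) / (k N : ℝ≥0∞)) atTop < 1) ∨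
      ((∃ lam : ℝ, 0 < lam ∧ Tendsto (fun N => (k N : ℝ) / Real.log (n N)) atTop (𝓝 lam)) ∧
        p = 1 ∧
        ∀ N, (d N : ℝ) ≤ 1 / 2 * Real.log (n N) / Real.log (Real.log (n N))))

/-! ## The predicted typical distance and the error term -/

/-- `C_p = 2 Γ(1/p + 1) (p e)^{1/p}` and `C_∞ = 2` in the undirected case; half of this in the
directed case. -/
def normConst (o : Orientation) (p : ℝ≥0∞) : ℝ :=
  let C : ℝ :=
    if p = ⊤ then 2
    else 2 * Real.Gamma (1 / p.toReal + 1) * (p.toReal * Real.exp 1) ^ (1 / p.toReal)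
  match o with
  | Orientation.undirected => C
  | Orientation.directed => C / 2

/-- The predicted typical distance `k^{1/p} n^{1/k} / C_p` (which is `n^{1/k} / C_∞` if `p = ∞`). -/
def radius (o : Orientation) (p : ℝ≥0∞) (k n : ℕ) : ℝ :=
  (k : ℝ) ^ p.toReal⁻¹ * (n : ℝ) ^ (1 / (k : ℝ)) / normConst o p

/-- The error term `K max{(log k)², k / n^{1/(2k)}} / k`. -/
def errorTerm (K : ℝ) (k n : ℕ) : ℝ :=
  K * max (Real.log k ^ 2) ((k : ℝ) / (n : ℝ) ^ (1 / (2 * (k : ℝ)))) / (k : ℝ)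

/-! ## The two types of conclusion -/

/-- With high probability over `Z`, the typical distance is finite and differs from `M_N` by a
relative error of at most `ξ_N`. -/
def ConcentratesWhp (o : Orientation) (p : ℝ≥0∞) (β : ℝ) (k : ℕ → ℕ) (G : ℕ → Type*)
    [∀ N, AddCommGroup (G N)] (M ξ : ℕ → ℝ) : Prop :=
  Tendsto
    (fun N => uniformProb fun Z : Fin (k N) → G N =>
      typicalDist o p β Z ≠ ⊤ ∧ |(typicalDist o p β Z).toReal - M N| / M N ≤ ξ N)
    atTop (𝓝 1)

end TypicalDistance

end

/-!
A path in the Cayley graph ends at `∑ w i • Z i`, where the integer vector `w` counts the signed uses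
of the generators, and its norm is at least that of `w`. Hence the ball of radius `R` in the graph is
the image, under `w ↦ ∑ w i • Z i`, of the ball of radius `R` in `ℤ ^ k` (in `ℕ ^ k` in the directed
case), up to an arbitrarily small change of the radius. The typical distance is, to first order, the
radius at which this lattice ball has `n` points.

*Lower bound.* The image has at most as many points as the lattice ball, for all generators
(`le_typicalDist`). Chernoff's bound shows that the lattice ball is too small at the radius
`M * (1 - ξ)` (`card_residueClass_le` with modulus one, `eventually_le_typicalDist`).

*Upper bound.* By the second moment method (`one_sub_le_uniformProb`) it is enough to find a set `B`
of vectors in the lattice ball of radius `M * (1 + ξ)` for which two independent uniform elements of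
`B` have the same image with probability `(1 + o(1)) / n`. If the entries of `w - w'` have greatest
common divisor `g`, then `∑ (w i - w' i) • Z i` is uniform on a subgroup containing `g • G`, and so it
vanishes with probability at most `g ^ d / n`, as at most `g ^ d` elements of a group of dimension `d`
are killed by `g` (`card_solutions_mul_le`). Two things remain: `B` must have many more than `n`
elements, and its residue classes modulo `g` must be so small that the factor `g ^ d` does no harm.

*Few generators.* Let `x = n ^ (1 / k)`, which tends to infinity. A residue class modulo `g` in the
lattice ball has at most `(2 * e + (1 + ξ) * x / g) ^ k` elements (`card_residueClass_le`), because
in one dimension the sum of a unimodal weight over a residue class exceeds a `g`-th of its total by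
at most its maximum (`sum_residueClass_le`). Since `d ≤ (1 - δ) * k`, this is small enough as long as
`g ≤ x ^ (1 + δ / 2)` (`tendsto_sum_congruent_pairs`), so `B` is taken to be the lattice ball with all
entries truncated at that height. Its size is bounded below by the volume of a truncated `L_p` ball,
which is read off from slices of the integral of `exp (-∑ |x i| ^ p)` over a cube
(`pow_le_volume_truncBall`, `pow_le_card_latticeBall`). All losses are absorbed by `ξ` with constant
`K = 1`: its term `(log k) ^ 2 / k` pays for factors polynomial in `k`, and its term `x ^ (-1 / 2)` for
the truncation and for rounding to lattice points.

*Generators proportional to `log n`, `p = 1`.* Under the weights `exp (-s * |y|)` on the integers, let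
`α s` be the mean of `|y|`. The lattice ball of radius `α s * k` has `exp (k * (H s + o(1)))` points,
where `H s` is the entropy of these weights, so `α = α s` for the solution `s` of `H s = 1 / lam`
(`exists_entropy_eq`). For a fixed relative error `ε` the set `B` can be taken with entries bounded by a
constant (`exists_latticeSet`); then only boundedly many `g` occur, and residue classes are
exponentially smaller than `B`, while `g ^ d = exp (o(k))`. All these bounds depend on the group only
through `n` and `d` (`IsApproxRadius`), so that a diagonal argument produces an error `ξ` that tends
to zero and depends only on the sequences `k` and `n`.
-/

namespace TypicalDistance

/-! ### Linear equations in a finite Abelian group -/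

theorem exists_decomposition_dimension (G : Type*) [AddCommGroup G] [Finite G] :
    ∃ a : Fin (dimension G) → ℕ, IsDecomposition G a := by
  have hne : {d : ℕ | ∃ a : Fin d → ℕ, IsDecomposition G a}.Nonempty := by
    obtain ⟨ι, _, m, -, ⟨e⟩⟩ := AddCommGroup.equiv_directSum_zmod_of_finite' G
    classical
    let f := Fintype.equivFin ι
    exact ⟨Fintype.card ι, fun j => m (f.symm j), ⟨(e.trans (DirectSum.addEquivProd _)).trans
      (RingEquiv.piCongrLeft' (fun i => ZMod (m i)) f).toAddEquiv⟩⟩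
  exact Nat.sInf_mem hne

/-- A group of dimension `d` has at most `g ^ d` elements killed by `g`, since a cyclic group has
at most `g` of them. -/
theorem card_ker_nsmul_le (G : Type*) [AddCommGroup G] [Finite G] {g : ℕ} (hg : 0 < g) :
    Nat.card (nsmulAddMonoidHom (α := G) g).ker ≤ g ^ dimension G := by
  classical
  obtain ⟨a, ⟨e⟩⟩ := exists_decomposition_dimension G
  have hfin : ∀ j, Finite (ZMod (a j)) := fun j =>
    Finite.of_surjective (fun x : G => e x j) fun y =>
      ⟨e.symm (Function.update 0 j y), by simp⟩
  let F : (nsmulAddMonoidHom (α := G) g).ker → ∀ j, {x : ZMod (a j) // g • x = 0} := fun x j =>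
    ⟨e x.1 j, by
      have h : g • x.1 = 0 := x.2
      have h2 := congrFun (congrArg e h) j
      simpa [map_nsmul] using h2⟩
  have hF : Function.Injective F := by
    intro x y hxy
    refine Subtype.ext (e.injective (funext fun j => ?_))
    exact congrArg Subtype.val (congrFun hxy j)
  have hcard : ∀ j, Nat.card {x : ZMod (a j) // g • x = 0} ≤ g := by
    intro j
    have : Fintype (ZMod (a j)) := Fintype.ofFinite _
    rw [Nat.card_eq_fintype_card, Fintype.card_subtype]
    exact IsAddCyclic.card_nsmul_eq_zero_le hg
  calc Nat.card (nsmulAddMonoidHom (α := G) g).ker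
      ≤ Nat.card (∀ j, {x : ZMod (a j) // g • x = 0}) := Nat.card_le_card_of_injective F hF
    _ = ∏ j, Nat.card {x : ZMod (a j) // g • x = 0} := Nat.card_pi
    _ ≤ ∏ _j : Fin (dimension G), g := Finset.prod_le_prod' fun j _ => hcard j
    _ = g ^ dimension G := by simp

/-- If the entries of `v` have greatest common divisor `g`, then by Bézout `Z ↦ ∑ v i • Z i` maps
onto a subgroup containing `g • G`. -/
theorem card_solutions_mul_le {G : Type*} [AddCommGroup G] [Finite G] {k : ℕ} (v : Fin k → ℤ)
    (hv : v ≠ 0) :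
    Nat.card {Z : Fin k → G // ∑ i, v i • Z i = 0} * Nat.card G ≤
      (Finset.univ.gcd v).natAbs ^ dimension G * Nat.card (Fin k → G) := by
  set g := (Finset.univ.gcd v).natAbs with hg
  have hg0 : 0 < g := by
    rw [hg, Int.natAbs_pos, Finset.gcd_ne_zero_iff]
    obtain ⟨i, hi⟩ := Function.ne_iff.mp hv
    exact ⟨i, Finset.mem_univ _, hi⟩
  let φ : (Fin k → G) →+ G := ∑ i, (zsmulAddGroupHom (v i)).comp (Pi.evalAddMonoidHom (fun _ => G) i)
  have hφ : ∀ Z, φ Z = ∑ i, v i • Z i := by intro Z; simp [φ]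
  let ψ : G →+ G := nsmulAddMonoidHom g
  have h1 : Nat.card φ.ker * Nat.card φ.range = Nat.card (Fin k → G) := by
    rw [← AddSubgroup.index_ker, AddSubgroup.card_mul_index]
  have h2 : Nat.card ψ.ker * Nat.card ψ.range = Nat.card G := by
    rw [← AddSubgroup.index_ker, AddSubgroup.card_mul_index]
  -- Bézout: `g • h` is the value at the tuple of multiples of `h` by the Bézout coefficients
  have hle : ψ.range ≤ φ.range := by
    rintro _ ⟨h, rfl⟩
    obtain ⟨f, hf⟩ := Finset.gcd_eq_sum_mul Finset.univ v
    have hgz : (g : ℤ) = Finset.univ.gcd v := by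
      rw [hg, Int.natAbs_of_nonneg Finset.Int.finsetGcd_nonneg]
    refine ⟨fun i => f i • h, ?_⟩
    rw [hφ]
    have : ψ h = (g : ℤ) • h := by simp [ψ]
    rw [this, hgz, hf, Finset.sum_smul]
    exact Finset.sum_congr rfl fun i _ => by rw [smul_smul]
  have h3 : Nat.card ψ.range ≤ Nat.card φ.range := AddSubgroup.card_le_of_le hle
  have h4 : Nat.card {Z : Fin k → G // ∑ i, v i • Z i = 0} = Nat.card φ.ker :=
    Nat.card_congr (Equiv.subtypeEquivRight fun Z => by rw [AddMonoidHom.mem_ker, hφ])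
  rw [h4, ← h2, ← h1]
  calc Nat.card φ.ker * (Nat.card ψ.ker * Nat.card ψ.range)
      ≤ Nat.card φ.ker * (g ^ dimension G * Nat.card φ.range) := by
        gcongr; exact card_ker_nsmul_le G hg0
    _ = _ := by ring

/-! ### Uniform generators -/

theorem uniformProb_eq_card_filter {G : Type*} {k : ℕ} [Fintype G] (P : (Fin k → G) → Prop)
    [DecidablePred P] :
    uniformProb P = ((Finset.univ.filter P).card : ℝ) / Nat.card (Fin k → G) := by
  classical
  unfold uniformProb
  rw [Nat.card_eq_fintype_card, Fintype.card_subtype]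

theorem uniformProb_le_one {G : Type*} {k : ℕ} [Finite G] (P : (Fin k → G) → Prop) :
    uniformProb P ≤ 1 := by
  refine div_le_one_of_le₀ ?_ (by positivity)
  exact_mod_cast Nat.card_le_card_of_injective _ Subtype.val_injective

theorem uniformProb_mono {G : Type*} {k : ℕ} [Finite G] {P Q : (Fin k → G) → Prop}
    (h : ∀ Z, P Z → Q Z) :
    uniformProb P ≤ uniformProb Q := by
  unfold uniformProb
  gcongr
  exact Nat.card_le_card_of_injective _ (Subtype.map_injective h Function.injective_id)

/-! ### Paths in the Cayley graph and lattice vectors -/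

section Cayley

variable {G : Type*} [AddCommGroup G] {k : ℕ}

/-- The `p`-norm of a vector of integers. -/
noncomputable def intNorm (p : ℝ≥0∞) (w : Fin k → ℤ) : ℝ := lpNorm p fun i => (w i).natAbs

/-- The net exponent vectors that a path with the given orientation may have. -/
def Admissible (o : Orientation) (w : Fin k → ℤ) : Prop := o = Orientation.directed → ∀ i, 0 ≤ w i

theorem lpNorm_mono {p : ℝ≥0∞} (hp : 1 ≤ p) {x y : Fin k → ℕ} (h : ∀ i, x i ≤ y i) :
    lpNorm p x ≤ lpNorm p y := by
  have : Fact (1 ≤ p) := ⟨hp⟩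
  unfold lpNorm
  rcases eq_or_ne p ⊤ with rfl | hpt
  · simp only [PiLp.norm_eq_ciSup]
    rcases isEmpty_or_nonempty (Fin k) with hE | hE
    · simp
    · refine ciSup_mono (Set.finite_range _).bddAbove fun i => ?_
      simpa using h i
  · have h0 : 0 < p.toReal := ENNReal.toReal_pos (by positivity) hpt
    simp only [PiLp.norm_eq_sum h0]
    gcongr with i
    simpa using h i

/-- The path that uses generator `i` exactly `|w i|` times, with the sign of `w i`. -/
theorem exists_path (o : Orientation) (Z : Fin k → G) (w : Fin k → ℤ) (hw : Admissible o w) :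
    ∃ ρ, IsPathTo o Z ρ (∑ i, w i • Z i) ∧ usage ρ = fun i => (w i).natAbs := by
  let sg : ℤ → ℤˣ := fun z => if 0 ≤ z then 1 else -1
  have hsg : ∀ z : ℤ, (z.natAbs : ℤ) * (sg z : ℤ) = z := by
    intro z
    by_cases h : 0 ≤ z
    · simp [sg, h]
    · simp only [sg, h, if_false, Units.val_neg, Units.val_one]; omega
  refine ⟨(List.finRange k).flatMap fun i => List.replicate (w i).natAbs (i, sg (w i)), ⟨?_, ?_⟩, ?_⟩
  · intro ho s hs
    simp only [List.mem_flatMap, List.mem_replicate] at hs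
    obtain ⟨i, -, -, rfl⟩ := hs
    simp [sg, hw ho i]
  · rw [List.map_flatMap, List.flatMap_def, List.sum_flatten, List.map_map, ← List.ofFn_eq_map,
      List.sum_ofFn]
    refine Finset.sum_congr rfl fun i _ => ?_
    rw [Function.comp_apply, List.map_replicate, List.sum_replicate, ← natCast_zsmul, smul_smul, hsg]
  · funext i
    unfold usage
    rw [List.map_flatMap, List.count_flatMap, ← List.ofFn_eq_map, List.sum_ofFn,
      Finset.sum_eq_single i]
    · simp
    · intro b _ hb
      simp [List.count_replicate, hb]
    · simp

/-- Collecting the steps of a path that use the same generator. -/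
theorem exists_vector_of_path (o : Orientation) (Z : Fin k → G) (ρ : List (Fin k × ℤˣ)) (v : G)
    (h : IsPathTo o Z ρ v) :
    ∃ w : Fin k → ℤ, Admissible o w ∧ (∀ i, (w i).natAbs ≤ usage ρ i) ∧ ∑ i, w i • Z i = v := by
  obtain ⟨hd, rfl⟩ := h
  induction ρ with
  | nil => exact ⟨0, fun _ _ => le_rfl, by simp, by simp⟩
  | cons s ρ ih =>
    obtain ⟨w, hw, hu, hs⟩ := ih fun ho t ht => hd ho t (List.mem_cons_of_mem _ ht)
    refine ⟨w + Pi.single s.1 (s.2 : ℤ), ?_, ?_, ?_⟩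
    · intro ho i
      have h1 := hd ho s List.mem_cons_self
      have h2 := hw ho i
      by_cases hi : i = s.1
      · subst hi; simp [h1]; omega
      · simpa [Pi.single_eq_of_ne hi] using h2
    · intro i
      have h2 := hu i
      unfold usage at h2 ⊢
      rw [List.map_cons, List.count_cons]
      by_cases hi : i = s.1
      · subst hi
        have : ((s.2 : ℤ)).natAbs = 1 := Int.units_natAbs s.2
        have h3 := Int.natAbs_add_le (w s.1) (s.2 : ℤ)
        simp only [Pi.add_apply, Pi.single_eq_same, beq_self_eq_true, if_true]
        omega
      · simp only [Pi.add_apply, Pi.single_eq_of_ne hi, add_zero]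
        exact h2.trans (Nat.le_add_right _ _)
    · simp only [Pi.add_apply, add_smul, Finset.sum_add_distrib, hs, List.map_cons, List.sum_cons]
      rw [add_comm, Finset.sum_eq_single s.1]
      · simp
      · intro b _ hb; simp [Pi.single_eq_of_ne hb]
      · simp

theorem mem_lpBall_of_vector (o : Orientation) (p : ℝ≥0∞) (Z : Fin k → G) (R : ℝ≥0)
    (w : Fin k → ℤ) (hw : Admissible o w) (hR : intNorm p w ≤ R) :
    ∑ i, w i • Z i ∈ lpBall o p Z R := by
  obtain ⟨ρ, h1, h2⟩ := exists_path o Z w hw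
  refine (iInf₂_le (f := fun ρ (_ : IsPathTo o Z ρ _) => ENNReal.ofReal (lpNorm p (usage ρ)))
    ρ h1).trans ?_
  rw [h2]
  exact ENNReal.ofReal_le_of_le_toReal (by simpa [intNorm] using hR)

/-- The distance is an infimum over paths, so a slightly larger radius `R'` is needed to find a path
that realises it. -/
theorem exists_vector_of_mem_lpBall (o : Orientation) {p : ℝ≥0∞} (hp : 1 ≤ p) (Z : Fin k → G)
    (R : ℝ≥0) {R' : ℝ} (hR : (R : ℝ) < R') {v : G} (hv : v ∈ lpBall o p Z R) :
    ∃ w : Fin k → ℤ, Admissible o w ∧ intNorm p w ≤ R' ∧ ∑ i, w i • Z i = v := by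
  have h1 : lpDist o p Z v < ENNReal.ofReal R' := by
    refine lt_of_le_of_lt hv ?_
    rw [← ENNReal.ofReal_coe_nnreal]
    exact (ENNReal.ofReal_lt_ofReal_iff (lt_of_le_of_lt R.2 hR)).mpr hR
  unfold lpDist at h1
  simp only [iInf_lt_iff] at h1
  obtain ⟨ρ, hρ, hlt⟩ := h1
  obtain ⟨w, hw, hu, hs⟩ := exists_vector_of_path o Z ρ v hρ
  refine ⟨w, hw, (lpNorm_mono hp hu).trans ?_, hs⟩
  exact (ENNReal.ofReal_lt_ofReal_iff'.mp hlt).1.le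

/-- A radius whose lattice ball has fewer than `β * n` points is a lower bound for the typical
distance, whatever the generators are. -/
theorem le_typicalDist [Finite G] (o : Orientation) {p : ℝ≥0∞} (hp : 1 ≤ p) {β : ℝ}
    (Z : Fin k → G) {R' : ℝ} (B : Finset (Fin k → ℤ))
    (hB : ∀ w, Admissible o w → intNorm p w ≤ R' → w ∈ B)
    (hcard : (B.card : ℝ) < β * Nat.card G) :
    ENNReal.ofReal R' ≤ typicalDist o p β Z := by
  refine le_iInf₂ fun R hR => ?_
  by_contra hlt
  push Not at hlt
  have hlt' : (R : ℝ) < R' := by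
    rw [← ENNReal.ofReal_coe_nnreal] at hlt
    exact (ENNReal.ofReal_lt_ofReal_iff'.mp hlt).1
  have hsub : lpBall o p Z R ⊆ (fun w : Fin k → ℤ => ∑ i, w i • Z i) '' (B : Set (Fin k → ℤ)) := by
    intro v hv
    obtain ⟨w, h1, h2, h3⟩ := exists_vector_of_mem_lpBall o hp Z R hlt' hv
    exact ⟨w, hB w h1 h2, h3⟩
  have h1 : (lpBall o p Z R).ncard ≤ B.card := by
    refine (Set.ncard_le_ncard hsub (Set.toFinite _)).trans ?_
    refine (Set.ncard_image_le B.finite_toSet).trans ?_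
    rw [Set.ncard_coe_finset]
  have h2 : ((lpBall o p Z R).ncard : ℝ) ≤ B.card := by exact_mod_cast h1
  linarith

/-! ### The second moment method -/

/-- By Cauchy–Schwarz, the combinations in `B` take many values at `Z` if few pairs of them
coincide there. -/
theorem card_sq_le_card_image_mul [DecidableEq G] (B : Finset (Fin k → ℤ)) (Z : Fin k → G) :
    (B.card : ℝ) ^ 2 ≤ ((B.image fun w => ∑ i, w i • Z i).card : ℝ) *
      (((B ×ˢ B).filter fun q => ∑ i, q.1 i • Z i = ∑ i, q.2 i • Z i).card : ℝ) := by
  set f : (Fin k → ℤ) → G := fun w => ∑ i, w i • Z i with hf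
  have h1 : (B.card : ℝ) = ∑ h ∈ B.image f, ((B.filter fun w => f w = h).card : ℝ) := by
    exact_mod_cast Finset.card_eq_sum_card_image f B
  have h2 : (((B ×ˢ B).filter fun q => f q.1 = f q.2).card : ℝ) =
      ∑ h ∈ B.image f, ((B.filter fun w => f w = h).card : ℝ) ^ 2 := by
    have : ((B ×ˢ B).filter fun q => f q.1 = f q.2).card =
        ∑ h ∈ B.image f, (B.filter fun w => f w = h).card ^ 2 := by
      rw [Finset.card_eq_sum_card_fiberwise (f := fun q => f q.1) (t := B.image f)]
      · refine Finset.sum_congr rfl fun h _ => ?_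
        rw [sq, ← Finset.card_product]
        congr 1
        ext q
        simp only [Finset.mem_filter, Finset.mem_product]
        constructor
        · rintro ⟨⟨⟨a, b⟩, c⟩, d⟩; exact ⟨⟨a, d⟩, b, c ▸ d⟩
        · rintro ⟨⟨a, b⟩, c, d⟩; exact ⟨⟨⟨a, c⟩, b.trans d.symm⟩, b⟩
      · intro q hq
        simp only [Finset.coe_filter, Finset.mem_product, Set.mem_ofPred_eq] at hq
        exact Finset.mem_coe.mpr (Finset.mem_image_of_mem _ hq.1.1)
    exact_mod_cast this
  rw [h2, h1]
  exact sq_sum_le_card_mul_sum_sq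

/-- The average over `Z` of the number of coincidences: a pair `w ≠ w'` coincides with probability
at most `g ^ d / n`, where `g` is the greatest common divisor of the entries of `w - w'`. -/
theorem sum_coincidences_le [Fintype G] [DecidableEq G] (B : Finset (Fin k → ℤ)) (T : ℕ)
    (hT : ∀ w ∈ B, ∀ i, |w i| ≤ T) (D : ℕ → ℝ)
    (hD : ∀ g ∈ Finset.Icc 2 (2 * T), ∀ r : Fin k → ℤ,
      ((B.filter fun w => ∀ i, (g : ℤ) ∣ w i - r i).card : ℝ) ≤ D g) :
    (Nat.card G : ℝ) * ∑ Z : Fin k → G,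
        (((B ×ˢ B).filter fun q => ∑ i, q.1 i • Z i = ∑ i, q.2 i • Z i).card : ℝ) ≤
      (Nat.card (Fin k → G) : ℝ) * (Nat.card G * B.card + B.card ^ 2 +
        ∑ g ∈ Finset.Icc 2 (2 * T), (g : ℝ) ^ dimension G * (B.card * D g)) := by
  classical
  set n : ℝ := (Nat.card G : ℝ) with hn
  set M : ℝ := (Nat.card (Fin k → G) : ℝ) with hM
  have hn0 : 0 ≤ n := by positivity
  have hM0 : 0 ≤ M := by positivity
  have hswap : ∑ Z : Fin k → G,
        (((B ×ˢ B).filter fun q => ∑ i, q.1 i • Z i = ∑ i, q.2 i • Z i).card : ℝ) =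
      ∑ q ∈ B ×ˢ B, (Nat.card {Z : Fin k → G // ∑ i, (q.1 - q.2) i • Z i = 0} : ℝ) := by
    simp only [Finset.card_filter, Nat.cast_sum]
    rw [Finset.sum_comm]
    refine Finset.sum_congr rfl fun q _ => ?_
    rw [Nat.card_eq_fintype_card, Fintype.card_subtype, Finset.card_filter, Nat.cast_sum]
    refine Finset.sum_congr rfl fun Z _ => ?_
    have : (∑ i, q.1 i • Z i = ∑ i, q.2 i • Z i) ↔ ∑ i, (q.1 - q.2) i • Z i = 0 := by
      simp only [Pi.sub_apply, sub_smul, Finset.sum_sub_distrib, sub_eq_zero]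
    simp only [this]
  -- the three terms account for equal vectors, for greatest common divisor one, and for a larger one
  have hpt : ∀ q ∈ B ×ˢ B, n * (Nat.card {Z : Fin k → G // ∑ i, (q.1 - q.2) i • Z i = 0} : ℝ) ≤
      M * ((if q.1 = q.2 then n else 0) + 1 + ∑ g ∈ Finset.Icc 2 (2 * T),
        (g : ℝ) ^ dimension G * (if ∀ i, (g : ℤ) ∣ q.2 i - q.1 i then 1 else 0)) := by
    intro q hq
    rw [Finset.mem_product] at hq
    have hs : ∀ g ∈ Finset.Icc 2 (2 * T), (0 : ℝ) ≤
        (g : ℝ) ^ dimension G * (if ∀ i, (g : ℤ) ∣ q.2 i - q.1 i then 1 else 0) := by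
      intro g _; split_ifs <;> positivity
    by_cases heq : q.1 = q.2
    · have h1 : (Nat.card {Z : Fin k → G // ∑ i, (q.1 - q.2) i • Z i = 0} : ℝ) ≤ M := by
        rw [hM]
        exact_mod_cast Nat.card_le_card_of_injective _ Subtype.val_injective
      rw [if_pos heq]
      have := Finset.sum_nonneg hs
      nlinarith
    · have hv : q.1 - q.2 ≠ 0 := sub_ne_zero.mpr heq
      have h1 := card_solutions_mul_le (G := G) (q.1 - q.2) hv
      set g := (Finset.univ.gcd (q.1 - q.2)).natAbs with hg
      have h2 : n * (Nat.card {Z : Fin k → G // ∑ i, (q.1 - q.2) i • Z i = 0} : ℝ) ≤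
          M * (g : ℝ) ^ dimension G := by
        rw [mul_comm n, mul_comm M, hn, hM]; exact_mod_cast h1
      have hgdvd : ∀ i, (g : ℤ) ∣ q.2 i - q.1 i := by
        intro i
        rw [hg, Int.natAbs_dvd, dvd_sub_comm]
        exact Finset.gcd_dvd (Finset.mem_univ i)
      have hgT : g ≤ 2 * T := by
        obtain ⟨i, hi⟩ := Function.ne_iff.mp hv
        have hi' : q.2 i - q.1 i ≠ 0 := by
          intro h; apply hi; simp only [Pi.sub_apply, Pi.zero_apply]; omega
        have h3 := Int.natAbs_le_of_dvd_ne_zero (hgdvd i) hi'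
        have h4 := hT _ hq.1 i
        have h5 := hT _ hq.2 i
        rw [abs_le] at h4 h5
        simp only [Int.natAbs_natCast] at h3
        omega
      refine h2.trans (mul_le_mul_of_nonneg_left ?_ hM0)
      rw [if_neg heq]
      have hg0 : g ≠ 0 := by
        rw [hg, Int.natAbs_ne_zero, Finset.gcd_ne_zero_iff]
        obtain ⟨i, hi⟩ := Function.ne_iff.mp hv
        exact ⟨i, Finset.mem_univ _, hi⟩
      by_cases hg1 : g = 1
      · rw [hg1]
        have := Finset.sum_nonneg hs
        simp only [Nat.cast_one, one_pow]; linarith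
      · have h6 := Finset.single_le_sum hs (Finset.mem_Icc.mpr ⟨by omega, hgT⟩ : g ∈ _)
        rw [if_pos hgdvd] at h6
        linarith
  rw [hswap, Finset.mul_sum]
  refine (Finset.sum_le_sum hpt).trans ?_
  rw [← Finset.mul_sum]
  refine mul_le_mul_of_nonneg_left ?_ hM0
  rw [Finset.sum_add_distrib, Finset.sum_add_distrib, Finset.sum_comm]
  refine add_le_add (add_le_add (le_of_eq ?_) (le_of_eq ?_)) (Finset.sum_le_sum fun g hg => ?_)
  · rw [Finset.sum_product]
    simp [mul_comm]
  · simp [sq]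
  · rw [← Finset.mul_sum]
    refine mul_le_mul_of_nonneg_left ?_ (by positivity)
    rw [Finset.sum_product, ← nsmul_eq_mul]
    refine Finset.sum_le_card_nsmul _ _ _ fun w _ => ?_
    rw [Finset.sum_boole]
    exact hD g hg w

/-- If `B` consists of lattice vectors of norm at most `R`, the ball of radius `R` has size at least
`β * n` up to an event whose probability is controlled by the average number of coincidences. -/
theorem one_sub_le_uniformProb [Finite G] (o : Orientation) (p : ℝ≥0∞) {β : ℝ} (hβ0 : 0 < β)
    (hβ1 : β < 1) (R : ℝ≥0) (B : Finset (Fin k → ℤ)) (hBne : B.Nonempty)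
    (hB : ∀ w ∈ B, Admissible o w ∧ intNorm p w ≤ R) (T : ℕ)
    (hT : ∀ w ∈ B, ∀ i, |w i| ≤ T) (D : ℕ → ℝ)
    (hD : ∀ g ∈ Finset.Icc 2 (2 * T), ∀ r : Fin k → ℤ,
      ((B.filter fun w => ∀ i, (g : ℤ) ∣ w i - r i).card : ℝ) ≤ D g) :
    1 - ((Nat.card G : ℝ) / B.card +
        ∑ g ∈ Finset.Icc 2 (2 * T), (g : ℝ) ^ dimension G * (D g / B.card)) / (1 / β - 1) ≤
      uniformProb fun Z : Fin k → G => typicalDist o p β Z ≤ R := by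
  classical
  have : Fintype G := Fintype.ofFinite G
  set n : ℝ := (Nat.card G : ℝ) with hn
  set M : ℝ := (Nat.card (Fin k → G) : ℝ) with hM
  set b : ℝ := (B.card : ℝ) with hb
  have hb0 : 0 < b := by rw [hb]; exact_mod_cast hBne.card_pos
  have hn0 : 0 < n := by rw [hn]; exact_mod_cast Nat.card_pos
  have hM0 : 0 < M := by rw [hM]; exact_mod_cast Nat.card_pos
  set S := ∑ g ∈ Finset.Icc 2 (2 * T), (g : ℝ) ^ dimension G * (b * D g) with hS
  let C : (Fin k → G) → ℝ := fun Z =>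
    (((B ×ˢ B).filter fun q => ∑ i, q.1 i • Z i = ∑ i, q.2 i • Z i).card : ℝ)
  let I : (Fin k → G) → ℝ := fun Z => ((B.image fun w => ∑ i, w i • Z i).card : ℝ)
  have hCI : ∀ Z, b ^ 2 ≤ I Z * C Z := fun Z => card_sq_le_card_image_mul B Z
  have hI : ∀ Z, I Z ≤ n := by
    intro Z
    rw [hn, Nat.card_eq_fintype_card]
    simp only [I]
    exact_mod_cast Finset.card_le_univ _
  have hI0 : ∀ Z, 0 < I Z := fun Z => by
    simp only [I]; exact_mod_cast (hBne.image _).card_pos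
  have hC0 : ∀ Z, 0 ≤ C Z := fun Z => by positivity
  have hsum : n * ∑ Z, C Z ≤ M * (n * b + b ^ 2 + S) := sum_coincidences_le B T hT D hD
  -- Markov's inequality for the nonnegative quantity `n * C Z - b ^ 2`
  set bad := Finset.univ.filter fun Z : Fin k → G => I Z < β * n with hbad
  have hβ' : 0 < 1 / β - 1 := by rw [sub_pos, lt_div_iff₀ hβ0]; linarith
  have hMarkov : (bad.card : ℝ) * (b ^ 2 * (1 / β - 1)) ≤ M * (n * b + S) := by
    have h1 : (bad.card : ℝ) * (b ^ 2 * (1 / β - 1)) ≤ ∑ Z, (n * C Z - b ^ 2) := by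
      rw [← nsmul_eq_mul]
      refine (Finset.card_nsmul_le_sum bad (fun Z => n * C Z - b ^ 2) _ fun Z hZ => ?_).trans
        (Finset.sum_le_sum_of_subset_of_nonneg (Finset.subset_univ _) fun Z _ _ => ?_)
      · have hZ' : I Z < β * n := (Finset.mem_filter.mp hZ).2
        have h2 : b ^ 2 ≤ β * n * C Z := (hCI Z).trans (by gcongr)
        have h3 : b ^ 2 * (1 / β) ≤ n * C Z := by
          rw [mul_one_div, div_le_iff₀ hβ0]; linarith
        linarith
      · have := hCI Z
        have h2 : I Z * C Z ≤ n * C Z := by gcongr; exact hI Z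
        linarith
    refine h1.trans ?_
    rw [Finset.sum_sub_distrib, ← Finset.mul_sum]
    have : ∑ _Z : Fin k → G, b ^ 2 = M * b ^ 2 := by
      rw [Finset.sum_const, nsmul_eq_mul, Finset.card_univ, hM, Nat.card_eq_fintype_card]
    rw [this]; linarith
  have hgood : ∀ Z, ¬ I Z < β * n → typicalDist o p β Z ≤ R := by
    intro Z hZ
    push Not at hZ
    refine iInf₂_le R (hZ.trans ?_)
    have hsub : ((B.image fun w => ∑ i, w i • Z i : Finset G) : Set G) ⊆ lpBall o p Z R := by
      intro v hv
      rw [Finset.mem_coe, Finset.mem_image] at hv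
      obtain ⟨w, hw, rfl⟩ := hv
      exact mem_lpBall_of_vector o p Z R w (hB w hw).1 (hB w hw).2
    have := Set.ncard_le_ncard hsub (Set.toFinite _)
    rw [Set.ncard_coe_finset] at this
    simp only [I]
    exact_mod_cast this
  refine le_trans ?_ (uniformProb_mono hgood)
  rw [uniformProb_eq_card_filter]
  have hcompl : ((Finset.univ.filter fun Z : Fin k → G => ¬ I Z < β * n).card : ℝ) =
      M - bad.card := by
    have := Finset.card_filter_add_card_filter_not (s := Finset.univ)
      (fun Z : Fin k → G => I Z < β * n)
    rw [Finset.card_univ, ← Nat.card_eq_fintype_card] at this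
    rw [hM, ← this, hbad]; push_cast; ring
  rw [hcompl, sub_div, div_self hM0.ne']
  refine sub_le_sub_left ?_ _
  rw [div_le_div_iff₀ hM0 hβ']
  have hE : n / b + ∑ g ∈ Finset.Icc 2 (2 * T), (g : ℝ) ^ dimension G * (D g / b) =
      (n * b + S) / b ^ 2 := by
    rw [hS, add_div, Finset.sum_div]
    congr 1
    · field_simp
    · refine Finset.sum_congr rfl fun g _ => ?_
      field_simp
  rw [hE, div_mul_eq_mul_div, le_div_iff₀ (by positivity)]
  calc _ = (bad.card : ℝ) * (b ^ 2 * (1 / β - 1)) := by ring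
    _ ≤ _ := hMarkov
    _ = _ := by ring

end Cayley

/-! ### Sums over residue classes -/

/-- The integers of absolute value at most `T` that may be coordinates of an admissible vector. -/
noncomputable def box (o : Orientation) (T : ℕ) : Finset ℤ :=
  match o with
  | Orientation.undirected => Finset.Icc (-(T : ℤ)) T
  | Orientation.directed => Finset.Icc 0 (T : ℤ)

/-- The number of half-lines of integers that the coordinates of admissible vectors fill. -/
def numSides (o : Orientation) : ℕ :=
  match o with
  | Orientation.undirected => 2
  | Orientation.directed => 1

theorem one_le_numSides (o : Orientation) : 1 ≤ numSides o := by cases o <;> simp [numSides]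

theorem mem_box {o : Orientation} {T : ℕ} {y : ℤ} :
    y ∈ box o T ↔ |y| ≤ T ∧ (o = Orientation.directed → 0 ≤ y) := by
  cases o
  · simp [box, abs_le]
  · simp only [box, Finset.mem_Icc, abs_le]
    constructor
    · rintro ⟨h1, h2⟩; exact ⟨⟨by omega, h2⟩, fun _ => h1⟩
    · rintro ⟨⟨h1, h2⟩, h3⟩; exact ⟨h3 trivial, h2⟩

/-- The sum of an even unimodal function over a residue class modulo `g` exceeds a `g`-th of its
total sum by at most its maximum: apart from the element `y'` of least absolute value, each element
`y` of the class is the worst point of a window of length `g` that extends from `y` towards `y'`, and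
these windows are disjoint. -/
theorem sum_residueClass_le (o : Orientation) (T : ℕ) {F : ℤ → ℝ} (hF0 : ∀ y, 0 ≤ F y)
    (hF : ∀ a b : ℤ, |a| ≤ |b| → F b ≤ F a) {g : ℕ} (hg : 0 < g) (r : ℤ) :
    ∑ y ∈ (box o T).filter (fun y => (g : ℤ) ∣ y - r), F y ≤
      F 0 + (1 / (g : ℝ)) * ∑ t ∈ box o T, F t := by
  set S := (box o T).filter (fun y => (g : ℤ) ∣ y - r) with hS
  have htot : 0 ≤ (1 / (g : ℝ)) * ∑ t ∈ box o T, F t :=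
    mul_nonneg (by positivity) (Finset.sum_nonneg fun y _ => hF0 y)
  rcases S.eq_empty_or_nonempty with hE | hne
  · rw [hE, Finset.sum_empty]; linarith [hF0 0]
  -- the element `m` of least absolute value contributes at most `F 0`
  obtain ⟨m, hm, hmin⟩ := Finset.exists_min_image S (fun y => |y|) hne
  rw [← Finset.add_sum_erase S F hm]
  refine add_le_add (hF 0 m (by simp)) ?_
  have hgR : (0 : ℝ) < g := by exact_mod_cast hg
  rw [one_div, inv_mul_eq_div, le_div_iff₀ hgR]
  have hmS := Finset.mem_filter.mp hm
  have hmb := mem_box.mp hmS.1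
  have hdv : ∀ y ∈ S.erase m, ∀ z ∈ S, (g : ℤ) ∣ y - z := by
    intro y hy z hz
    have h1 := (Finset.mem_filter.mp (Finset.mem_of_mem_erase hy)).2
    have h2 := (Finset.mem_filter.mp hz).2
    simpa using dvd_sub h1 h2
  -- every other element lies at distance at least `g` from `m`, and further from `0` than `m`;
  -- in the directed case `m` is the least element
  have key : ∀ y ∈ S.erase m, (m < y ∧ m + g ≤ y ∧ |m| ≤ y ∧ y ≤ T) ∨
      (y < m ∧ y + g ≤ m ∧ |m| ≤ -y ∧ -y ≤ T ∧ o ≠ Orientation.directed) := by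
    intro y hy
    have hyS := Finset.mem_of_mem_erase hy
    have hyb := mem_box.mp (Finset.mem_filter.mp hyS).1
    have h1 := hmin y hyS
    have h2 := hdv y hy m hm
    rcases lt_or_gt_of_ne (Finset.ne_of_mem_erase hy) with h | h
    · right
      have h3 := Int.le_of_dvd (by omega) ((dvd_sub_comm).mp h2)
      simp only [abs_eq_max_neg] at *
      refine ⟨h, by omega, by omega, by omega, fun ho => ?_⟩
      have := hyb.2 ho
      have := hmb.2 ho
      omega
    · left
      have h3 := Int.le_of_dvd (by omega) h2
      simp only [abs_eq_max_neg] at *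
      exact ⟨h, by omega, by omega, by omega⟩
  -- the `j`-th point, counted from `y` towards `m`, of the window belonging to `y`
  let win : ℤ × ℕ → ℤ := fun q => if m < q.1 then q.1 - q.2 else q.1 + q.2
  calc (∑ y ∈ S.erase m, F y) * g
      = ∑ q ∈ S.erase m ×ˢ Finset.range g, F q.1 := by
        rw [Finset.sum_product, Finset.sum_mul]
        simp [mul_comm]
    _ ≤ ∑ q ∈ S.erase m ×ˢ Finset.range g, F (win q) := by
        refine Finset.sum_le_sum fun q hq => hF _ _ ?_
        rw [Finset.mem_product, Finset.mem_range] at hq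
        simp only [win]
        have := key q.1 hq.1
        split_ifs <;> simp only [abs_eq_max_neg] at * <;> omega
    _ = ∑ t ∈ (S.erase m ×ˢ Finset.range g).image win, F t := by
        rw [Finset.sum_image]
        rintro ⟨y, j⟩ hq ⟨y', j'⟩ hq' heq
        rw [Finset.mem_coe, Finset.mem_product, Finset.mem_range] at hq hq'
        dsimp only at hq hq'
        have h1 := key y hq.1
        have h2 := key y' hq'.1
        have h3 := hdv y hq.1 y' (Finset.mem_of_mem_erase hq'.1)
        have h4 : y - y' = 0 := by
          refine Int.eq_zero_of_abs_lt_dvd h3 ?_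
          simp only [win] at heq
          rw [abs_lt]
          split_ifs at heq <;> omega
        have h5 : y = y' := by omega
        subst h5
        have h6 : j = j' := by
          simp only [win] at heq
          split_ifs at heq <;> omega
        rw [h6]
    _ ≤ ∑ t ∈ box o T, F t := by
        refine Finset.sum_le_sum_of_subset_of_nonneg ?_ fun y _ _ => hF0 y
        intro t ht
        rw [Finset.mem_image] at ht
        obtain ⟨⟨y, j⟩, hq, rfl⟩ := ht
        rw [Finset.mem_product, Finset.mem_range] at hq
        dsimp only at hq
        have h1 := key y hq.1
        rw [mem_box]
        simp only [win]
        have h2 := hmb.2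
        constructor
        · split_ifs <;> simp only [abs_eq_max_neg] at * <;> omega
        · intro ho
          have := h2 ho
          rcases h1 with h1 | h1
          · rw [if_pos h1.1]; omega
          · exact absurd ho h1.2.2.2.2

theorem sum_box_eq (o : Orientation) (T : ℕ) {F : ℤ → ℝ} (hF : ∀ y, F (-y) = F y) :
    ∑ t ∈ box o T, F t = F 0 + numSides o * ∑ i ∈ Finset.range T, F ((i : ℤ) + 1) := by
  induction T with
  | zero => cases o <;> simp [box]
  | succ T ih =>
    cases o
    · have h : box Orientation.undirected (T + 1) =
          insert ((T : ℤ) + 1) (insert (-((T : ℤ) + 1)) (box Orientation.undirected T)) := by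
        ext y; simp only [box, Finset.mem_Icc, Finset.mem_insert]; push_cast; omega
      rw [h, Finset.sum_insert, Finset.sum_insert, ih, Finset.sum_range_succ, hF]
      · simp only [numSides]; push_cast; ring
      · simp only [box, Finset.mem_Icc]; omega
      · simp only [box, Finset.mem_Icc, Finset.mem_insert]; omega
    · have h : box Orientation.directed (T + 1) =
          insert ((T : ℤ) + 1) (box Orientation.directed T) := by
        ext y; simp only [box, Finset.mem_Icc, Finset.mem_insert]; push_cast; omega
      rw [h, Finset.sum_insert, ih, Finset.sum_range_succ]
      · simp only [numSides]; push_cast; ring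
      · simp only [box, Finset.mem_Icc]; omega

/-! ### Exponential bounds for the number of lattice vectors -/

/-- Chernoff's bound for the number of vectors of `B` in a residue class modulo `g`. -/
theorem card_residueClass_mul_le {k : ℕ} (o : Orientation) (T : ℕ) (B : Finset (Fin k → ℤ))
    (hB : ∀ w ∈ B, ∀ i, w i ∈ box o T) {F : ℤ → ℝ} (hF0 : ∀ y, 0 ≤ F y) {c A : ℝ}
    (hc : ∀ w ∈ B, c ≤ ∏ i, F (w i)) (g : ℕ)
    (hA : ∀ r : ℤ, ∑ y ∈ (box o T).filter (fun y => (g : ℤ) ∣ y - r), F y ≤ A)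
    (r : Fin k → ℤ) :
    ((B.filter fun w => ∀ i, (g : ℤ) ∣ w i - r i).card : ℝ) * c ≤ A ^ k := by
  classical
  calc ((B.filter fun w => ∀ i, (g : ℤ) ∣ w i - r i).card : ℝ) * c
      ≤ ∑ w ∈ B.filter fun w => ∀ i, (g : ℤ) ∣ w i - r i, ∏ i, F (w i) := by
        rw [← nsmul_eq_mul]
        exact Finset.card_nsmul_le_sum _ _ _ fun w hw => hc w (Finset.mem_of_mem_filter w hw)
    _ ≤ ∑ w ∈ Fintype.piFinset fun i => (box o T).filter (fun y => (g : ℤ) ∣ y - r i),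
          ∏ i, F (w i) := by
        refine Finset.sum_le_sum_of_subset_of_nonneg ?_ fun w _ _ =>
          Finset.prod_nonneg fun i _ => hF0 _
        intro w hw
        rw [Finset.mem_filter] at hw
        rw [Fintype.mem_piFinset]
        exact fun i => Finset.mem_filter.mpr ⟨hB w hw.1 i, hw.2 i⟩
    _ = ∏ i, ∑ y ∈ (box o T).filter (fun y => (g : ℤ) ∣ y - r i), F y :=
        (Finset.prod_univ_sum _ (fun _ y => F y)).symm
    _ ≤ ∏ _i : Fin k, A :=
        Finset.prod_le_prod (fun i _ => Finset.sum_nonneg fun y _ => hF0 y) fun i _ => hA (r i)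
    _ = A ^ k := by simp

theorem intNorm_top_le_iff {k : ℕ} {w : Fin k → ℤ} {R : ℝ} (hR : 0 ≤ R) :
    intNorm ⊤ w ≤ R ↔ ∀ i, |(w i : ℝ)| ≤ R := by
  unfold intNorm lpNorm
  rw [PiLp.norm_eq_ciSup]
  rcases isEmpty_or_nonempty (Fin k) with hE | hE
  · simp [hR]
  · rw [ciSup_le_iff (Set.finite_range _).bddAbove]
    simp [Nat.cast_natAbs]

theorem intNorm_le_iff {k : ℕ} {p : ℝ≥0∞} (hp : 1 ≤ p) (hpt : p ≠ ⊤) {w : Fin k → ℤ} {R : ℝ}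
    (hR : 0 ≤ R) : intNorm p w ≤ R ↔ ∑ i, |(w i : ℝ)| ^ p.toReal ≤ R ^ p.toReal := by
  have h0 : 0 < p.toReal := ENNReal.toReal_pos (by positivity) hpt
  have : Fact (1 ≤ p) := ⟨hp⟩
  unfold intNorm lpNorm
  rw [PiLp.norm_eq_sum h0]
  have hs : (0 : ℝ) ≤ ∑ i, |(w i : ℝ)| ^ p.toReal :=
    Finset.sum_nonneg fun i _ => by positivity
  have : ∑ i, ‖(WithLp.toLp p fun i => (((w i).natAbs : ℕ) : ℝ)) i‖ ^ p.toReal =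
      ∑ i, |(w i : ℝ)| ^ p.toReal := by
    refine Finset.sum_congr rfl fun i _ => ?_
    simp [Nat.cast_natAbs]
  rw [this, ← Real.rpow_le_rpow_iff (by positivity) hR h0, ← Real.rpow_mul hs,
    one_div_mul_cancel h0.ne', Real.rpow_one]

theorem abs_le_of_intNorm_le {k : ℕ} {p : ℝ≥0∞} (hp : 1 ≤ p) {w : Fin k → ℤ} {R : ℝ}
    (hR : 0 ≤ R) (h : intNorm p w ≤ R) (i : Fin k) : |(w i : ℝ)| ≤ R := by
  rcases eq_or_ne p ⊤ with rfl | hpt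
  · exact (intNorm_top_le_iff hR).mp h i
  · have h0 : 0 < p.toReal := ENNReal.toReal_pos (by positivity) hpt
    rw [intNorm_le_iff hp hpt hR] at h
    rw [← Real.rpow_le_rpow_iff (abs_nonneg _) hR h0]
    refine le_trans ?_ h
    exact Finset.single_le_sum (f := fun i => |(w i : ℝ)| ^ p.toReal)
      (fun i _ => by positivity) (Finset.mem_univ i)

theorem mem_box_of_intNorm_le {k : ℕ} {o : Orientation} {p : ℝ≥0∞} (hp : 1 ≤ p) {w : Fin k → ℤ}
    {R : ℝ} (hR : 0 ≤ R) (ha : Admissible o w) (h : intNorm p w ≤ R) (i : Fin k) :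
    w i ∈ box o ⌊R⌋₊ := by
  rw [mem_box]
  refine ⟨?_, fun ho => ha ho i⟩
  have h1 := abs_le_of_intNorm_le hp hR h i
  have h2 : (|w i|.toNat) ≤ ⌊R⌋₊ := by
    rw [Nat.le_floor_iff hR]
    have : ((|w i|.toNat : ℤ) : ℝ) = |(w i : ℝ)| := by
      rw [Int.toNat_of_nonneg (abs_nonneg _)]; push_cast; rfl
    have h3 : ((|w i|.toNat : ℕ) : ℝ) = |(w i : ℝ)| := by exact_mod_cast this
    rw [h3]; exact h1
  have := abs_nonneg (w i)
  omega

/-- The constant `C_p` is the integral of `exp (-|x| ^ p)` over the admissible half-lines, times the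
factor `(p * e) ^ (1 / p)` that results from optimising the exponent in Chernoff's bound. -/
theorem normConst_of_ne_top (o : Orientation) {p : ℝ≥0∞} (hpt : p ≠ ⊤) :
    normConst o p = numSides o * (Real.Gamma (1 / p.toReal + 1) *
      (p.toReal * Real.exp 1) ^ (1 / p.toReal)) := by
  cases o <;> simp [normConst, hpt, numSides] <;> ring

theorem normConst_top (o : Orientation) : normConst o ⊤ = numSides o := by
  cases o <;> simp [normConst, numSides]

theorem normConst_pos (o : Orientation) {p : ℝ≥0∞} (hp : 1 ≤ p) : 0 < normConst o p := by
  have hs : (0 : ℝ) < numSides o := by exact_mod_cast one_le_numSides o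
  rcases eq_or_ne p ⊤ with rfl | hpt
  · rwa [normConst_top]
  · have h0 : 0 < p.toReal := ENNReal.toReal_pos (by positivity) hpt
    have : 0 < Real.Gamma (1 / p.toReal + 1) := Real.Gamma_pos_of_pos (by positivity)
    rw [normConst_of_ne_top o hpt]
    positivity

/-- The sum of `exp (-s * |t| ^ q)` over the box is at most one plus the corresponding integral. -/
theorem sum_box_exp_le (o : Orientation) (T : ℕ) {q s : ℝ} (hq : 0 < q) (hs : 0 < s) :
    ∑ t ∈ box o T, Real.exp (-s * |(t : ℝ)| ^ q) ≤
      1 + numSides o * (s ^ (-1 / q) * Real.Gamma (1 / q + 1)) := by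
  rw [sum_box_eq o T (F := fun t : ℤ => Real.exp (-s * |(t : ℝ)| ^ q)) (by intro y; simp)]
  refine add_le_add (by simp [hq.ne']) (mul_le_mul_of_nonneg_left ?_ (by positivity))
  have hanti : AntitoneOn (fun x : ℝ => Real.exp (-s * x ^ q)) (Set.Ici 0) := by
    intro x hx y hy hxy
    simp only [Set.mem_Ici] at hx
    refine Real.exp_le_exp.mpr ?_
    have := Real.rpow_le_rpow hx hxy hq.le
    nlinarith
  have hint : MeasureTheory.IntegrableOn (fun x : ℝ => Real.exp (-s * x ^ q)) (Set.Ioi 0) := by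
    have := integrableOn_rpow_mul_exp_neg_mul_rpow (s := 0) (by norm_num) hq hs
    simpa using this
  have h1 := AntitoneOn.sum_le_integral (x₀ := 0) (a := T) (f := fun x : ℝ => Real.exp (-s * x ^ q))
    (hanti.mono (by intro x hx; exact hx.1))
  calc ∑ i ∈ Finset.range T, Real.exp (-s * |(((i : ℤ) + 1 : ℤ) : ℝ)| ^ q)
      = ∑ i ∈ Finset.range T, Real.exp (-s * (0 + ((i + 1 : ℕ) : ℝ)) ^ q) := by
        refine Finset.sum_congr rfl fun i _ => ?_
        congr 3
        push_cast
        rw [abs_of_nonneg (by positivity)]; ring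
    _ ≤ ∫ x in (0 : ℝ)..0 + T, Real.exp (-s * x ^ q) := h1
    _ ≤ ∫ x in Set.Ioi (0 : ℝ), Real.exp (-s * x ^ q) := by
        rw [intervalIntegral.integral_of_le (by positivity)]
        refine MeasureTheory.setIntegral_mono_set hint ?_ ?_
        · exact Filter.Eventually.of_forall fun x => (Real.exp_pos _).le
        · exact (Set.Ioc_subset_Ioi_self).eventuallyLE
    _ = s ^ (-1 / q) * Real.Gamma (1 / q + 1) := integral_exp_neg_mul_rpow hq hs

/-- The number of admissible lattice vectors of norm at most `R` in a residue class modulo `g`. The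
case `g = 1` counts all of them. -/
theorem card_residueClass_le {k : ℕ} (hk : 0 < k) (o : Orientation) {p : ℝ≥0∞} (hp : 1 ≤ p)
    {R : ℝ} (hR : 0 < R) (B : Finset (Fin k → ℤ))
    (hB : ∀ w ∈ B, Admissible o w ∧ intNorm p w ≤ R) {g : ℕ} (hg : 0 < g) (r : Fin k → ℤ) :
    ((B.filter fun w => ∀ i, (g : ℤ) ∣ w i - r i).card : ℝ) ≤
      (2 * Real.exp 1 + normConst o p * R / (g * (k : ℝ) ^ p.toReal⁻¹)) ^ k := by
  have hbox : ∀ w ∈ B, ∀ i, w i ∈ box o ⌊R⌋₊ := fun w hw i =>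
    mem_box_of_intNorm_le hp hR.le (hB w hw).1 (hB w hw).2 i
  have hkR : (0 : ℝ) < k := by exact_mod_cast hk
  have hgR : (1 : ℝ) ≤ g := by exact_mod_cast hg
  have hg1 : 1 / (g : ℝ) ≤ 1 := by rw [div_le_one (by linarith)]; exact hgR
  have hs : (0 : ℝ) < numSides o := by exact_mod_cast one_le_numSides o
  -- for `p = ∞` the weight is constant on the box; otherwise it is `exp (-s * |y| ^ p)`
  rcases eq_or_ne p ⊤ with rfl | hpt
  · have h := card_residueClass_mul_le o ⌊R⌋₊ B hbox (F := fun _ => 1) (by simp) (c := 1)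
      (A := 1 + 1 / (g : ℝ) * (1 + numSides o * R)) (by simp) g (fun r => ?_) r
    · rw [mul_one] at h
      refine h.trans (pow_le_pow_left₀ (by positivity) ?_ k)
      have he : (1 : ℝ) ≤ Real.exp 1 := Real.one_le_exp (by norm_num)
      rw [normConst_top]
      simp only [ENNReal.toReal_top, inv_zero, Real.rpow_zero, mul_one]
      rw [mul_add, one_div_mul_eq_div, one_div_mul_eq_div]
      linarith
    · refine (sum_residueClass_le o ⌊R⌋₊ (F := fun _ => 1) (by simp) (by simp) hg r).trans ?_
      rw [sum_box_eq o ⌊R⌋₊ (F := fun _ => 1) (by simp)]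
      simp only [Finset.sum_const, Finset.card_range, nsmul_eq_mul, mul_one]
      gcongr
      exact Nat.floor_le hR.le
  · have h0 : 0 < p.toReal := ENNReal.toReal_pos (by positivity) hpt
    have h1p : 1 ≤ p.toReal := by
      have := ENNReal.toReal_mono hpt hp
      simpa using this
    set q := p.toReal with hq
    -- the parameter for which `s * R ^ q - (k / q) * log s` is least
    set s : ℝ := k / (q * R ^ q) with hsdef
    have hRq : 0 < R ^ q := by positivity
    have hs0 : 0 < s := by positivity
    have hmono : ∀ a b : ℤ, |a| ≤ |b| →
        Real.exp (-s * |(b : ℝ)| ^ q) ≤ Real.exp (-s * |(a : ℝ)| ^ q) := by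
      intro a b hab
      refine Real.exp_le_exp.mpr ?_
      have h1 : |(a : ℝ)| ≤ |(b : ℝ)| := by exact_mod_cast hab
      have := Real.rpow_le_rpow (abs_nonneg _) h1 h0.le
      nlinarith
    have h := card_residueClass_mul_le o ⌊R⌋₊ B hbox
      (F := fun y => Real.exp (-s * |(y : ℝ)| ^ q)) (fun y => (Real.exp_pos _).le)
      (c := Real.exp (-(1 / q)) ^ k)
      (A := 1 + 1 / (g : ℝ) * (1 + numSides o * (s ^ (-1 / q) * Real.Gamma (1 / q + 1))))
      (fun w hw => ?_) g (fun r => ?_) r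
    · have hΓ : 0 < Real.Gamma (1 / q + 1) := Real.Gamma_pos_of_pos (by positivity)
      rw [← le_div_iff₀ (by positivity), ← div_pow] at h
      refine h.trans (pow_le_pow_left₀ (by positivity) ?_ k)
      rw [Real.exp_neg, div_inv_eq_mul]
      have hspow : s ^ (-1 / q) = q ^ (1 / q) * R / (k : ℝ) ^ q⁻¹ := by
        rw [hsdef, neg_div, Real.rpow_neg (by positivity), Real.div_rpow (by positivity)
          (by positivity), inv_div, Real.mul_rpow (by positivity) (by positivity),
          ← Real.rpow_mul hR.le, mul_one_div_cancel h0.ne', Real.rpow_one, one_div]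
      have hC : Real.exp (1 / q) * (numSides o * (s ^ (-1 / q) * Real.Gamma (1 / q + 1))) =
          normConst o p * R / (k : ℝ) ^ q⁻¹ := by
        rw [normConst_of_ne_top o hpt, hspow, Real.mul_rpow (by positivity) (by positivity),
          ← Real.exp_mul, one_mul]
        ring
      have he : Real.exp (1 / q) ≤ Real.exp 1 := by
        refine Real.exp_le_exp.mpr ?_
        rw [div_le_one h0]; exact h1p
      have he0 := Real.exp_pos (1 / q)
      calc (1 + 1 / (g : ℝ) * (1 + numSides o * (s ^ (-1 / q) * Real.Gamma (1 / q + 1)))) *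
            Real.exp (1 / q)
          = (1 + 1 / (g : ℝ)) * Real.exp (1 / q) + 1 / (g : ℝ) *
              (Real.exp (1 / q) * (numSides o * (s ^ (-1 / q) * Real.Gamma (1 / q + 1)))) := by
            ring
        _ ≤ 2 * Real.exp 1 + 1 / (g : ℝ) * (normConst o p * R / (k : ℝ) ^ q⁻¹) := by
            rw [hC]
            gcongr
            linarith
        _ = _ := by rw [div_mul_div_comm, one_mul]
    · rw [← Real.exp_sum, ← Real.exp_nat_mul]
      refine Real.exp_le_exp.mpr ?_
      rw [← Finset.mul_sum]
      have h1 := (intNorm_le_iff hp hpt hR.le).mp (hB w hw).2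
      have h2 : s * ∑ i, |(w i : ℝ)| ^ q ≤ s * R ^ q := by gcongr
      have h3 : s * R ^ q = k * (1 / q) := by rw [hsdef]; field_simp
      linarith
    · refine (sum_residueClass_le o ⌊R⌋₊ (fun y => (Real.exp_pos _).le) hmono hg r).trans ?_
      gcongr
      · simp [h0.ne']
      · exact sum_box_exp_le o _ h0 hs0

/-! ### The volume of a truncated ball -/

section Volume

open MeasureTheory
open scoped Pointwise

/-- The ball `∑ |x i| ^ q ≤ a`, intersected with the cube `|x i| ≤ t`. -/
def truncBall (k : ℕ) (q a t : ℝ) : Set (Fin k → ℝ) :=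
  {x | (∀ i, |x i| ≤ t) ∧ ∑ i, |x i| ^ q ≤ a}

theorem truncBall_subset_pi (k : ℕ) (q a t : ℝ) :
    truncBall k q a t ⊆ Set.univ.pi fun _ => Set.Icc (-t) t :=
  fun _ hx i _ => abs_le.mp (hx.1 i)

theorem truncBall_mono (k : ℕ) (q a : ℝ) {t t' : ℝ} (h : t ≤ t') :
    truncBall k q a t ⊆ truncBall k q a t' :=
  fun _ hx => ⟨fun i => (hx.1 i).trans h, hx.2⟩

theorem volume_truncBall_ne_top (k : ℕ) (q a t : ℝ) : volume (truncBall k q a t) ≠ ⊤ := by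
  refine ne_top_of_le_ne_top ?_ (measure_mono (truncBall_subset_pi k q a t))
  rw [volume_pi_pi]
  exact ENNReal.prod_ne_top fun i _ => by simp

theorem measurableSet_truncBall (k : ℕ) {q : ℝ} (hq : 0 ≤ q) (a t : ℝ) :
    MeasurableSet (truncBall k q a t) := by
  have : IsClosed (truncBall k q a t) := by
    have h1 : IsClosed {x : Fin k → ℝ | ∀ i, |x i| ≤ t} := by
      simp only [Set.ofPred_forall]
      exact isClosed_iInter fun i => isClosed_le (by fun_prop) continuous_const
    have h2 : IsClosed {x : Fin k → ℝ | ∑ i, |x i| ^ q ≤ a} :=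
      isClosed_le (continuous_finsetSum _ fun i _ =>
        ((continuous_apply i).abs).rpow_const fun _ => Or.inr hq) continuous_const
    exact h1.inter h2
  exact this.measurableSet

theorem volume_truncBall_scale (k : ℕ) (q a t : ℝ) {c : ℝ} (hc : 0 < c) :
    volume.real (truncBall k q (c ^ q * a) (c * t)) = c ^ k * volume.real (truncBall k q a t) := by
  have h : truncBall k q (c ^ q * a) (c * t) = c • truncBall k q a t := by
    ext x
    rw [Set.mem_smul_set_iff_inv_smul_mem₀ hc.ne']
    have h1 : ∀ i, |(c⁻¹ • x) i| = c⁻¹ * |x i| := by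
      intro i; rw [Pi.smul_apply, smul_eq_mul, abs_mul, abs_of_pos (inv_pos.mpr hc)]
    simp only [truncBall, Set.mem_ofPred_eq, h1]
    refine and_congr (forall_congr' fun i => ?_) ?_
    · rw [inv_mul_le_iff₀ hc]
    · have h2 : ∑ i, (c⁻¹ * |x i|) ^ q = (c ^ q)⁻¹ * ∑ i, |x i| ^ q := by
        rw [Finset.mul_sum]
        refine Finset.sum_congr rfl fun i _ => ?_
        rw [Real.mul_rpow (by positivity) (abs_nonneg _), Real.inv_rpow hc.le]
      rw [h2, inv_mul_le_iff₀ (by positivity)]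
  rw [h, measureReal_def, Measure.addHaar_smul, ENNReal.toReal_mul, measureReal_def,
    ENNReal.toReal_ofReal (abs_nonneg _)]
  simp [abs_of_pos hc]

theorem integrable_exp_neg_mul_abs_rpow {q b : ℝ} (hq : 0 < q) (hb : 0 < b) :
    Integrable (fun x : ℝ => Real.exp (-b * |x| ^ q)) := by
  have h : IntegrableOn (fun x : ℝ => Real.exp (-b * x ^ q)) (Set.Ioi 0) := by
    simpa using integrableOn_rpow_mul_exp_neg_mul_rpow (s := 0) (by norm_num) hq hb
  have h1 : IntegrableOn (fun x : ℝ => Real.exp (-b * |x| ^ q)) (Set.Ioi 0) :=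
    h.congr_fun (fun x hx => by simp only [abs_of_pos (Set.mem_Ioi.mp hx)]) measurableSet_Ioi
  have h2 : IntegrableOn (fun x : ℝ => Real.exp (-b * |x| ^ q)) (Set.Iic 0) := by
    rw [integrableOn_Iic_iff_integrableOn_Iio]
    have h3 : IntegrableOn (fun x : ℝ => Real.exp (-b * |x| ^ q)) (Set.Ioi (-0)) := by
      rwa [neg_zero]
    have h4 := h3.comp_neg_Iio
    simp only [abs_neg] at h4
    exact h4
  rw [← integrableOn_univ, ← Set.Iic_union_Ioi (a := (0 : ℝ))]
  exact h2.union h1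

theorem integral_exp_neg_mul_abs_rpow {q b : ℝ} (hq : 0 < q) (hb : 0 < b) :
    ∫ x : ℝ, Real.exp (-b * |x| ^ q) = b ^ (-1 / q) * (2 * Real.Gamma (1 / q + 1)) := by
  rw [integral_comp_abs (f := fun x : ℝ => Real.exp (-b * x ^ q)), integral_exp_neg_mul_rpow hq hb]
  ring

/-- On the removed part, `exp (-|x| ^ q) ≤ exp (-t / 2) * exp (-|x| ^ q / 2)`. -/
theorem integral_exp_neg_truncated_ge {q : ℝ} (hq : 1 ≤ q) {t : ℝ} (ht : 1 ≤ t) :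
    (1 - 2 * Real.exp (-t / 2)) * (2 * Real.Gamma (1 / q + 1)) ≤
      ∫ x : ℝ, (Set.Icc (-t) t).indicator (fun x => Real.exp (-1 * |x| ^ q)) x := by
  have hq0 : 0 < q := by linarith
  have i1 := integrable_exp_neg_mul_abs_rpow hq0 (b := 1) one_pos
  have i2 := integrable_exp_neg_mul_abs_rpow hq0 (b := 1 / 2) (by norm_num)
  have i3 := i1.indicator (measurableSet_Icc (a := -t) (b := t))
  have hΓ : 0 < Real.Gamma (1 / q + 1) := Real.Gamma_pos_of_pos (by positivity)
  have h1 : ∫ x : ℝ, (Real.exp (-1 * |x| ^ q) - Real.exp (-t / 2) * Real.exp (-(1 / 2) * |x| ^ q)) ≤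
      ∫ x : ℝ, (Set.Icc (-t) t).indicator (fun x => Real.exp (-1 * |x| ^ q)) x := by
    refine integral_mono (i1.sub (i2.const_mul _)) i3 fun x => ?_
    by_cases hx : x ∈ Set.Icc (-t) t
    · rw [Set.indicator_of_mem hx]
      have : 0 ≤ Real.exp (-t / 2) * Real.exp (-(1 / 2) * |x| ^ q) := by positivity
      linarith
    · rw [Set.indicator_of_notMem hx, sub_nonpos, ← Real.exp_add]
      refine Real.exp_le_exp.mpr ?_
      have hx' : t < |x| := by
        by_contra h
        exact hx (abs_le.mp (not_lt.mp h))
      have h2 : |x| ≤ |x| ^ q := by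
        conv_lhs => rw [← Real.rpow_one |x|]
        exact Real.rpow_le_rpow_of_exponent_le (by linarith) hq
      linarith
  rw [integral_sub i1 (i2.const_mul _), integral_const_mul, integral_exp_neg_mul_abs_rpow hq0 one_pos,
    integral_exp_neg_mul_abs_rpow hq0 (by norm_num : (0 : ℝ) < 1 / 2), Real.one_rpow] at h1
  have h3 : ((1 : ℝ) / 2) ^ (-1 / q) ≤ 2 := by
    rw [neg_div, Real.rpow_neg (by norm_num), ← Real.inv_rpow (by norm_num)]
    norm_num
    calc (2 : ℝ) ^ q⁻¹ ≤ 2 ^ (1 : ℝ) :=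
        Real.rpow_le_rpow_of_exponent_le (by norm_num) (inv_le_one_of_one_le₀ hq)
      _ = 2 := by simp
  refine le_trans ?_ h1
  have : Real.exp (-t / 2) * (((1 : ℝ) / 2) ^ (-1 / q) * (2 * Real.Gamma (1 / q + 1))) ≤
      Real.exp (-t / 2) * (2 * (2 * Real.Gamma (1 / q + 1))) := by gcongr
  linarith

/-- The maximum of `y ^ m * exp (-y)` is attained at `y = m`. -/
theorem rpow_mul_exp_neg_le {m y : ℝ} (hm : 0 < m) (hy : 0 < y) :
    y ^ m * Real.exp (-y) ≤ (m / Real.exp 1) ^ m := by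
  have h1 : y / m ≤ Real.exp (y / m - 1) := by
    have := Real.add_one_le_exp (y / m - 1); linarith
  have h2 : (y / m) ^ m ≤ Real.exp (y - m) := by
    calc (y / m) ^ m ≤ (Real.exp (y / m - 1)) ^ m := by gcongr
      _ = Real.exp (y - m) := by
        rw [← Real.exp_mul]; congr 1; field_simp
  rw [Real.div_rpow hy.le hm.le, div_le_iff₀ (by positivity), Real.exp_sub] at h2
  rw [Real.div_rpow hm.le (Real.exp_pos _).le, ← Real.exp_mul, one_mul, Real.exp_neg,
    ← div_eq_mul_inv, div_le_div_iff₀ (Real.exp_pos _) (Real.exp_pos _)]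
  rw [div_mul_eq_mul_div, le_div_iff₀ (Real.exp_pos _)] at h2
  linarith

/-- Slicing the integral of `exp (-∑ |x i| ^ q)` over the cube according to the integer part of
the exponent; the slices far from the mean are estimated with a changed exponent. -/
theorem pow_integral_le_sum_slices (k : ℕ) {q : ℝ} (hq : 0 < q) (t : ℝ) (a₀ a₁ : ℝ) :
    (∫ x : ℝ, (Set.Icc (-t) t).indicator (fun x => Real.exp (-1 * |x| ^ q)) x) ^ k ≤
      Real.exp a₀ * (∫ x : ℝ, Real.exp (-2 * |x| ^ q)) ^ k +
      Real.exp (-a₁ / 2) * (∫ x : ℝ, Real.exp (-(1 / 2) * |x| ^ q)) ^ k +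
      ∑ j ∈ Finset.Icc ⌊a₀⌋₊ ⌊a₁⌋₊,
        Real.exp (-j) * volume.real (truncBall k q ((j : ℝ) + 1) t) := by
  have i1 := (integrable_exp_neg_mul_abs_rpow hq (b := 1) one_pos).indicator
    (measurableSet_Icc (a := -t) (b := t))
  have i2 := integrable_exp_neg_mul_abs_rpow hq (b := 2) (by norm_num)
  have i3 := integrable_exp_neg_mul_abs_rpow hq (b := 1 / 2) (by norm_num)
  have j1 : Integrable (fun x : Fin k → ℝ => ∏ i, (Set.Icc (-t) t).indicator
      (fun x => Real.exp (-1 * |x| ^ q)) (x i)) := Integrable.fintype_prod fun _ => i1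
  have j2 : Integrable (fun x : Fin k → ℝ => Real.exp a₀ * ∏ i, Real.exp (-2 * |x i| ^ q)) :=
    (Integrable.fintype_prod fun _ => i2).const_mul _
  have j3 : Integrable (fun x : Fin k → ℝ =>
      Real.exp (-a₁ / 2) * ∏ i, Real.exp (-(1 / 2) * |x i| ^ q)) :=
    (Integrable.fintype_prod fun _ => i3).const_mul _
  have j4 : ∀ j ∈ Finset.Icc ⌊a₀⌋₊ ⌊a₁⌋₊, Integrable (fun x : Fin k → ℝ =>
      Real.exp (-j) * (truncBall k q ((j : ℝ) + 1) t).indicator (fun _ => (1 : ℝ)) x) := by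
    intro j _
    refine Integrable.const_mul ?_ _
    rw [integrable_indicator_iff (measurableSet_truncBall k hq.le _ _)]
    exact integrableOn_const (volume_truncBall_ne_top _ _ _ _)
  have hprod : ∀ (b : ℝ) (x : Fin k → ℝ),
      ∏ i, Real.exp (-b * |x i| ^ q) = Real.exp (-b * ∑ i, |x i| ^ q) := by
    intro b x; rw [← Real.exp_sum, Finset.mul_sum]
  have hle := integral_mono j1 ((j2.add j3).add (integrable_finsetSum _ j4)) (fun x => by
    simp only [Pi.add_apply]
    have hs : ∀ j ∈ Finset.Icc ⌊a₀⌋₊ ⌊a₁⌋₊, 0 ≤ Real.exp (-(j : ℝ)) *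
        (truncBall k q ((j : ℝ) + 1) t).indicator (fun _ => (1 : ℝ)) x := fun j _ =>
      mul_nonneg (Real.exp_pos _).le (Set.indicator_nonneg (fun _ _ => zero_le_one) _)
    have hs' := Finset.sum_nonneg hs
    rw [hprod, hprod]
    set Φ := ∑ i, |x i| ^ q with hΦ
    have hΦ0 : 0 ≤ Φ := Finset.sum_nonneg fun i _ => by positivity
    have p2 : 0 ≤ Real.exp a₀ * Real.exp (-2 * Φ) := by positivity
    have p3 : 0 ≤ Real.exp (-a₁ / 2) * Real.exp (-(1 / 2) * Φ) := by positivity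
    by_cases hx : ∀ i, x i ∈ Set.Icc (-t) t
    · have h1 : ∏ i, (Set.Icc (-t) t).indicator (fun x => Real.exp (-1 * |x| ^ q)) (x i) =
          Real.exp (-1 * Φ) := by
        rw [hΦ, ← hprod]
        exact Finset.prod_congr rfl fun i _ => Set.indicator_of_mem (hx i) _
      rw [h1]
      rcases lt_or_ge Φ a₀ with h | h
      · have : Real.exp (-1 * Φ) ≤ Real.exp a₀ * Real.exp (-2 * Φ) := by
          rw [← Real.exp_add]; exact Real.exp_le_exp.mpr (by linarith)
        linarith
      rcases lt_or_ge a₁ Φ with h' | h'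
      · have : Real.exp (-1 * Φ) ≤ Real.exp (-a₁ / 2) * Real.exp (-(1 / 2) * Φ) := by
          rw [← Real.exp_add]; exact Real.exp_le_exp.mpr (by linarith)
        linarith
      have h2 := Finset.single_le_sum hs
        (Finset.mem_Icc.mpr ⟨Nat.floor_le_floor h, Nat.floor_le_floor h'⟩ : ⌊Φ⌋₊ ∈ _)
      rw [Set.indicator_of_mem (show x ∈ truncBall k q ((⌊Φ⌋₊ : ℝ) + 1) t from
        ⟨fun i => abs_le.mpr (hx i), (Nat.lt_floor_add_one Φ).le⟩), mul_one] at h2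
      have : Real.exp (-1 * Φ) ≤ Real.exp (-(⌊Φ⌋₊ : ℝ)) :=
        Real.exp_le_exp.mpr (by have := Nat.floor_le hΦ0; linarith)
      linarith
    · push Not at hx
      obtain ⟨i, hi⟩ := hx
      rw [Finset.prod_eq_zero (Finset.mem_univ i) (Set.indicator_of_notMem hi _)]
      linarith)
  rw [integral_fintype_prod_volume_eq_pow, Fintype.card_fin] at hle
  refine hle.trans (le_of_eq ?_)
  simp only [Pi.add_apply]
  rw [integral_add (by exact j2.add j3) (integrable_finsetSum _ j4), integral_add j2 j3,
    integral_const_mul, integral_const_mul,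
    integral_fintype_prod_volume_eq_pow (fun x : ℝ => Real.exp (-2 * |x| ^ q)),
    integral_fintype_prod_volume_eq_pow (fun x : ℝ => Real.exp (-(1 / 2) * |x| ^ q)), Fintype.card_fin,
    integral_finsetSum _ j4]
  congr 1
  refine Finset.sum_congr rfl fun j _ => ?_
  rw [integral_const_mul, integral_indicator_const _ (measurableSet_truncBall k hq.le _ _),
    smul_eq_mul, mul_one]

/-- A lower bound for the volume of the truncated ball. By scaling, each slice has a volume that is
at most an explicit multiple of that of the truncated ball with `∑ |x i| ^ q ≤ R ^ q`, so the bound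
follows from the value of the integral of `exp (-∑ |x i| ^ q)` over the cube. -/
theorem pow_le_volume_truncBall {q : ℝ} (hq : 1 ≤ q) :
    ∃ k₀ : ℕ, ∃ t₀ : ℝ, 1 ≤ t₀ ∧ ∀ k : ℕ, k₀ ≤ k → ∀ R : ℝ, 0 < R → ∀ t : ℝ, t₀ ≤ t →
      (2 * Real.Gamma (1 / q + 1) * (q * Real.exp 1) ^ (1 / q) * (R / (k : ℝ) ^ q⁻¹) *
        (1 - 2 * Real.exp (-t / 2))) ^ k / (30 * k) ≤
        volume.real (truncBall k q (R ^ q) (t * R * (2 * q / k) ^ q⁻¹)) := by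
  have hq0 : 0 < q := by linarith
  set J : ℝ := 2 * Real.Gamma (1 / q + 1) with hJ
  have hJ0 : 0 < J := by
    have : 0 < Real.Gamma (1 / q + 1) := Real.Gamma_pos_of_pos (by positivity)
    positivity
  have hl2 := Real.log_two_gt_d9
  have hl2' := Real.log_two_lt_d9
  -- `ρ ^ k` bounds the proportion of the integral outside the window `k / (2 * q) ≤ Φ ≤ 4 * k / q`, where
  -- `Φ = ∑ |x i| ^ q` has mean `k / q`; it is negligible against the loss `σ ^ k` by truncation
  set ρ : ℝ := Real.exp ((1 / 2 - Real.log 2) / q) with hρ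
  have hρ0 : 0 < ρ := Real.exp_pos _
  have hρ1 : ρ < 1 := by
    rw [hρ, Real.exp_lt_one_iff]
    exact div_neg_of_neg_of_pos (by linarith) hq0
  set σ : ℝ := (1 + ρ) / 2 with hσ
  have hσ0 : 0 < σ := by positivity
  have hσ1 : σ < 1 := by rw [hσ]; linarith
  have hρσ : ρ / σ < 1 := by rw [div_lt_one hσ0, hσ]; linarith
  obtain ⟨k₁, hk₁⟩ := (((tendsto_pow_atTop_nhds_zero_of_lt_one (by positivity) hρσ).eventually
    (gt_mem_nhds (show (0 : ℝ) < 1 / 4 by norm_num))).exists_forall_of_atTop)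
  have ht : Tendsto (fun t : ℝ => 2 * Real.exp (-t / 2)) atTop (𝓝 (2 * 0)) := by
    refine Tendsto.const_mul _ (Real.tendsto_exp_atBot.comp ?_)
    exact (tendsto_neg_atTop_atBot).atBot_div_const (by norm_num)
  rw [mul_zero] at ht
  obtain ⟨t₁, ht₁⟩ := ((ht.eventually
    (gt_mem_nhds (show 0 < 1 - σ by linarith))).exists_forall_of_atTop)
  refine ⟨max k₁ 1, max t₁ 1, le_max_right _ _, fun k hk R hR t ht => ?_⟩
  have hkpos : 0 < k := lt_of_lt_of_le one_pos ((le_max_right _ _).trans hk)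
  have hk0 : (0 : ℝ) < k := by exact_mod_cast hkpos
  have ht1 : 1 ≤ t := (le_max_right _ _).trans ht
  set η : ℝ := 2 * Real.exp (-t / 2) with hη
  have hη1 : σ ≤ 1 - η := by
    have := ht₁ t ((le_max_left _ _).trans ht); linarith
  have hkσ := hk₁ k ((le_max_left _ _).trans hk)
  rw [div_pow, div_lt_iff₀ (by positivity)] at hkσ
  have hσk : σ ^ k ≤ (1 - η) ^ k := pow_le_pow_left₀ hσ0.le hη1 k
  set V := volume.real (truncBall k q (R ^ q) (t * R * (2 * q / k) ^ q⁻¹)) with hV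
  have hV0 : 0 ≤ V := measureReal_nonneg
  have hsl := pow_integral_le_sum_slices k hq0 t (k / (2 * q)) (4 * k / q)
  have hI := integral_exp_neg_truncated_ge hq ht1
  rw [← hJ, ← hη] at hI
  have hIk := pow_le_pow_left₀ (mul_nonneg (by linarith) hJ0.le) hI k
  rw [integral_exp_neg_mul_abs_rpow hq0 (by norm_num : (0 : ℝ) < 2),
    integral_exp_neg_mul_abs_rpow hq0 (by norm_num : (0 : ℝ) < 1 / 2), ← hJ] at hsl
  have e2 : (2 : ℝ) ^ (-1 / q) = Real.exp (-Real.log 2 / q) := by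
    rw [Real.rpow_def_of_pos (by norm_num)]; congr 1; ring
  have e3 : ((1 : ℝ) / 2) ^ (-1 / q) = Real.exp (Real.log 2 / q) := by
    rw [Real.rpow_def_of_pos (by norm_num), one_div, Real.log_inv]; congr 1; ring
  have h1 : Real.exp (k / (2 * q)) * ((2 : ℝ) ^ (-1 / q) * J) ^ k ≤ ρ ^ k * J ^ k := by
    rw [mul_pow, ← mul_assoc, e2, hρ, ← Real.exp_nat_mul, ← Real.exp_nat_mul, ← Real.exp_add]
    refine le_of_eq ?_
    congr 2
    field_simp
    ring
  have h2 : Real.exp (-(4 * k / q) / 2) * (((1 : ℝ) / 2) ^ (-1 / q) * J) ^ k ≤ ρ ^ k * J ^ k := by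
    rw [mul_pow, ← mul_assoc, e3, hρ, ← Real.exp_nat_mul, ← Real.exp_nat_mul, ← Real.exp_add]
    gcongr
    have : -(4 * (k : ℝ) / q) / 2 + k * (Real.log 2 / q) = k * ((-2 + Real.log 2) / q) := by
      field_simp; ring
    rw [this]
    gcongr
    linarith
  -- the slice `Φ ≤ j + 1` is rescaled to `Φ ≤ R ^ q`; this enlarges the cutoff by at most the factor
  -- in the definition of `V`, because `j + 1 ≥ k / (2 * q)`
  have h3 : ∀ j ∈ Finset.Icc ⌊(k : ℝ) / (2 * q)⌋₊ ⌊4 * (k : ℝ) / q⌋₊,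
      Real.exp (-(j : ℝ)) * volume.real (truncBall k q ((j : ℝ) + 1) t) ≤
        Real.exp 1 * (k / q / Real.exp 1) ^ (k / q) / R ^ k * V := by
    intro j hj
    rw [Finset.mem_Icc] at hj
    have hj1 : (k : ℝ) / (2 * q) ≤ (j : ℝ) + 1 := by
      have a1 := Nat.lt_floor_add_one ((k : ℝ) / (2 * q))
      have a2 : (⌊(k : ℝ) / (2 * q)⌋₊ : ℝ) ≤ j := by exact_mod_cast hj.1
      linarith
    have hy : (0 : ℝ) < (j : ℝ) + 1 := by positivity
    set c : ℝ := ((j : ℝ) + 1) ^ q⁻¹ / R with hc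
    have hc0 : 0 < c := by positivity
    have s1 : c ^ q * R ^ q = (j : ℝ) + 1 := by
      rw [← Real.mul_rpow hc0.le hR.le, hc, div_mul_cancel₀ _ hR.ne', Real.rpow_inv_rpow hy.le hq0.ne']
    have s2 : c * (t / c) = t := by field_simp
    have s3 := volume_truncBall_scale k q (R ^ q) (t / c) hc0
    rw [s1, s2] at s3
    have s4 : t / c ≤ t * R * (2 * q / k) ^ q⁻¹ := by
      rw [hc, div_div_eq_mul_div, div_eq_mul_inv, ← Real.inv_rpow hy.le]
      gcongr
      rw [inv_le_comm₀ hy (by positivity), inv_div]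
      exact hj1
    have s5 : volume.real (truncBall k q (R ^ q) (t / c)) ≤ V :=
      measureReal_mono (truncBall_mono k q _ s4) (volume_truncBall_ne_top _ _ _ _)
    have s6 : c ^ k = ((j : ℝ) + 1) ^ ((k : ℝ) / q) / R ^ k := by
      rw [hc, div_pow, ← Real.rpow_natCast (((j : ℝ) + 1) ^ q⁻¹) k, ← Real.rpow_mul hy.le,
        inv_mul_eq_div]
    have s7 := rpow_mul_exp_neg_le (m := k / q) (by positivity) hy
    have s8 : Real.exp (-(j : ℝ)) = Real.exp 1 * Real.exp (-((j : ℝ) + 1)) := by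
      rw [← Real.exp_add]; congr 1; ring
    calc Real.exp (-(j : ℝ)) * volume.real (truncBall k q ((j : ℝ) + 1) t)
        ≤ Real.exp (-(j : ℝ)) * (c ^ k * V) := by rw [s3]; gcongr
      _ = Real.exp 1 * (((j : ℝ) + 1) ^ ((k : ℝ) / q) * Real.exp (-((j : ℝ) + 1))) / R ^ k * V := by
          rw [s6, s8]; ring
      _ ≤ _ := by gcongr
  have h4 := Finset.sum_le_card_nsmul _ _ _ h3
  rw [nsmul_eq_mul] at h4
  have hcard : ((Finset.Icc ⌊(k : ℝ) / (2 * q)⌋₊ ⌊4 * (k : ℝ) / q⌋₊).card : ℝ) ≤ 5 * k := by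
    have a1 : (Finset.Icc ⌊(k : ℝ) / (2 * q)⌋₊ ⌊4 * (k : ℝ) / q⌋₊).card ≤ ⌊4 * (k : ℝ) / q⌋₊ + 1 := by
      rw [Nat.card_Icc]; omega
    have a2 : (⌊4 * (k : ℝ) / q⌋₊ : ℝ) ≤ 4 * k / q := Nat.floor_le (by positivity)
    have a3 : 4 * (k : ℝ) / q ≤ 4 * k := div_le_self (by positivity) hq
    have a4 : (1 : ℝ) ≤ k := by exact_mod_cast hkpos
    have a5 : ((Finset.Icc ⌊(k : ℝ) / (2 * q)⌋₊ ⌊4 * (k : ℝ) / q⌋₊).card : ℝ) ≤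
        (⌊4 * (k : ℝ) / q⌋₊ : ℝ) + 1 := by exact_mod_cast a1
    linarith
  have he3 : Real.exp 1 ≤ 3 := by have := Real.exp_one_lt_d9; linarith
  -- the two tails take up at most half of the integral, and there are at most `5 * k` slices
  have h5 : ((1 - η) * J) ^ k / 2 ≤
      15 * k * ((k / q / Real.exp 1) ^ (k / q) / R ^ k * V) := by
    have b1 : ((1 - η) * J) ^ k / 2 ≤ ((1 - η) * J) ^ k - 2 * (ρ ^ k * J ^ k) := by
      rw [mul_pow]
      have : ρ ^ k * J ^ k ≤ (1 / 4 * (1 - η) ^ k) * J ^ k := by gcongr; linarith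
      linarith
    have b2 : ((1 - η) * J) ^ k - 2 * (ρ ^ k * J ^ k) ≤
        ((Finset.Icc ⌊(k : ℝ) / (2 * q)⌋₊ ⌊4 * (k : ℝ) / q⌋₊).card : ℝ) *
        (Real.exp 1 * (k / q / Real.exp 1) ^ (k / q) / R ^ k * V) := by linarith
    refine b1.trans (b2.trans ?_)
    calc _ ≤ 5 * k * (3 * (k / q / Real.exp 1) ^ (k / q) / R ^ k * V) := by gcongr
      _ = _ := by ring
  have hpow : (q * Real.exp 1) ^ (1 / q) / (k : ℝ) ^ q⁻¹ = ((k / q / Real.exp 1) ^ q⁻¹)⁻¹ := by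
    rw [one_div, ← Real.div_rpow (by positivity) (by positivity), ← Real.inv_rpow (by positivity)]
    congr 1
    field_simp
  have hpow2 : (((k : ℝ) / q / Real.exp 1) ^ q⁻¹) ^ k = (k / q / Real.exp 1) ^ (k / q) := by
    rw [← Real.rpow_natCast, ← Real.rpow_mul (by positivity), inv_mul_eq_div]
  rw [div_le_iff₀ (by positivity)]
  have hD : 0 < (k / q / Real.exp 1) ^ (k / q) := by positivity
  have hfin : (J * (q * Real.exp 1) ^ (1 / q) * (R / (k : ℝ) ^ q⁻¹) * (1 - η)) ^ k =
      ((1 - η) * J) ^ k * (R ^ k / (k / q / Real.exp 1) ^ (k / q)) := by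
    rw [← hpow2, ← div_pow, ← mul_pow]
    congr 1
    calc _ = (1 - η) * J * (R * ((q * Real.exp 1) ^ (1 / q) / (k : ℝ) ^ q⁻¹)) := by ring
      _ = _ := by rw [hpow]; ring
  rw [hfin]
  calc ((1 - η) * J) ^ k * (R ^ k / (k / q / Real.exp 1) ^ (k / q))
      ≤ (2 * (15 * k * ((k / q / Real.exp 1) ^ (k / q) / R ^ k * V))) *
          (R ^ k / (k / q / Real.exp 1) ^ (k / q)) := by
        gcongr; linarith
    _ = V * (30 * k) := by field_simp; ring

/-! ### Lattice points in the truncated ball -/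

/-- The admissible lattice vectors of norm at most `R` with entries of absolute value at most `T`. -/
noncomputable def latticeBall (o : Orientation) (p : ℝ≥0∞) (k : ℕ) (R : ℝ) (T : ℕ) :
    Finset (Fin k → ℤ) :=
  open Classical in (Fintype.piFinset fun _ => box o T).filter fun w => intNorm p w ≤ R

theorem mem_latticeBall {o : Orientation} {p : ℝ≥0∞} {k : ℕ} {R : ℝ} {T : ℕ} {w : Fin k → ℤ} :
    w ∈ latticeBall o p k R T ↔ Admissible o w ∧ (∀ i, |w i| ≤ T) ∧ intNorm p w ≤ R := by
  simp only [latticeBall, Finset.mem_filter, Fintype.mem_piFinset, mem_box, Admissible]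
  constructor
  · rintro ⟨h1, h2⟩; exact ⟨fun ho i => (h1 i).2 ho, fun i => (h1 i).1, h2⟩
  · rintro ⟨h1, h2, h3⟩; exact ⟨fun i => ⟨h2 i, fun ho => h1 ho i⟩, h3⟩

/-- The integer to which a real coordinate is rounded; in the directed case the sign is dropped. -/
noncomputable def cell (o : Orientation) (x : ℝ) : ℤ :=
  match o with
  | Orientation.undirected => ⌊x⌋
  | Orientation.directed => ⌊|x|⌋

theorem abs_cell_le (o : Orientation) (x : ℝ) : |(cell o x : ℝ)| ≤ |x| + 1 := by
  cases o
  · simp only [cell]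
    have h1 := Int.floor_le x
    have h2 := Int.lt_floor_add_one x
    have h3 := neg_abs_le x
    have h4 := le_abs_self x
    rw [abs_le]; constructor <;> linarith
  · simp only [cell]
    have h1 := Int.floor_le |x|
    have h2 : (0 : ℝ) ≤ ⌊|x|⌋ := by exact_mod_cast Int.floor_nonneg.mpr (abs_nonneg x)
    rw [abs_of_nonneg h2]; linarith

theorem volume_cell_le (o : Orientation) (y : ℤ) :
    volume {x : ℝ | cell o x = y} ≤ ENNReal.ofReal (2 / numSides o) := by
  cases o
  · have h : {x : ℝ | cell Orientation.undirected x = y} ⊆ Set.Icc (y : ℝ) (y + 1) := by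
      intro x hx
      have hx' : ⌊x⌋ = y := hx
      rw [Int.floor_eq_iff] at hx'
      exact ⟨hx'.1, hx'.2.le⟩
    refine (measure_mono h).trans ?_
    rw [Real.volume_Icc]
    refine ENNReal.ofReal_le_ofReal ?_
    simp [numSides]
  · have h : {x : ℝ | cell Orientation.directed x = y} ⊆
        Set.Icc (y : ℝ) (y + 1) ∪ Set.Icc (-((y : ℝ) + 1)) (-y) := by
      intro x hx
      have hx' : ⌊|x|⌋ = y := hx
      rw [Int.floor_eq_iff] at hx'
      rcases abs_cases x with ⟨h1, -⟩ | ⟨h1, -⟩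
      · left; rw [h1] at hx'; exact ⟨hx'.1, hx'.2.le⟩
      · right; rw [h1] at hx'; exact ⟨by linarith, by linarith⟩
    refine (measure_mono h).trans ((measure_union_le _ _).trans ?_)
    rw [Real.volume_Icc, Real.volume_Icc, ← ENNReal.ofReal_add (by linarith) (by linarith)]
    refine ENNReal.ofReal_le_ofReal ?_
    simp [numSides]; norm_num

/-- Rounding changes the norm by at most `k ^ (1 / q)`, and each lattice vector is the rounding of a
set of measure at most one (undirected case) or `2 ^ k` (directed case). -/
theorem volume_truncBall_le_card (o : Orientation) {p : ℝ≥0∞} (hp : 1 ≤ p) (hpt : p ≠ ⊤) {k : ℕ}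
    {R t : ℝ} (hR : (k : ℝ) ^ p.toReal⁻¹ ≤ R) {T : ℕ} (hT : t + 1 ≤ T) :
    volume.real (truncBall k p.toReal ((R - (k : ℝ) ^ p.toReal⁻¹) ^ p.toReal) t) ≤
      (2 / numSides o : ℝ) ^ k * (latticeBall o p k R T).card := by
  have h1 : 1 ≤ p.toReal := by
    have := ENNReal.toReal_mono hpt hp
    simpa using this
  have hR0 : 0 ≤ R := le_trans (by positivity) hR
  set q := p.toReal with hq
  have h0 : 0 < q := by linarith
  -- Minkowski: rounding adds a vector with entries at most one
  have hsub : truncBall k q ((R - (k : ℝ) ^ q⁻¹) ^ q) t ⊆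
      ⋃ w ∈ latticeBall o p k R T, Set.univ.pi fun i => {x : ℝ | cell o x = w i} := by
    intro x hx
    rw [Set.mem_iUnion₂]
    refine ⟨fun i => cell o (x i), mem_latticeBall.mpr ⟨?_, fun i => ?_, ?_⟩, fun i _ => rfl⟩
    · rintro rfl i
      exact Int.floor_nonneg.mpr (abs_nonneg _)
    · have := (abs_cell_le o (x i)).trans (add_le_add_left (hx.1 i) 1)
      have h3 : |(cell o (x i) : ℝ)| ≤ T := this.trans hT
      exact_mod_cast h3
    · rw [intNorm_le_iff hp hpt hR0, ← hq]
      have hmink := Real.Lp_add_le_of_nonneg (s := Finset.univ) (f := fun i => |x i|)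
        (g := fun _ : Fin k => (1 : ℝ)) h1 (fun i _ => abs_nonneg _) (fun i _ => zero_le_one)
      have hs : 0 ≤ ∑ i, |x i| ^ q := Finset.sum_nonneg fun i _ => by positivity
      have h2 : (∑ i, |x i| ^ q) ^ (1 / q) ≤ R - (k : ℝ) ^ q⁻¹ := by
        rw [one_div, Real.rpow_inv_le_iff_of_pos hs (by linarith) h0]
        exact hx.2
      have h3 : (∑ _i : Fin k, (1 : ℝ) ^ q) ^ (1 / q) = (k : ℝ) ^ q⁻¹ := by simp
      rw [h3] at hmink
      have h4 : (∑ i, (|x i| + 1) ^ q) ^ (1 / q) ≤ R := by linarith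
      rw [one_div, Real.rpow_inv_le_iff_of_pos
        (Finset.sum_nonneg fun i _ => by positivity) hR0 h0] at h4
      refine le_trans (Finset.sum_le_sum fun i _ => ?_) h4
      exact Real.rpow_le_rpow (abs_nonneg _) (abs_cell_le o (x i)) h0.le
  have hmeas : volume (truncBall k q ((R - (k : ℝ) ^ q⁻¹) ^ q) t) ≤
      ((latticeBall o p k R T).card : ℝ≥0∞) * ENNReal.ofReal (2 / numSides o) ^ k := by
    refine (measure_mono hsub).trans ((measure_biUnion_finset_le _ _).trans ?_)
    rw [← nsmul_eq_mul]
    refine Finset.sum_le_card_nsmul _ _ _ fun w _ => ?_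
    rw [volume_pi_pi]
    refine (Finset.prod_le_prod' fun i _ => volume_cell_le o (w i)).trans ?_
    simp
  have := ENNReal.toReal_mono (by finiteness) hmeas
  rw [ENNReal.toReal_mul, ENNReal.toReal_pow, ENNReal.toReal_ofReal (by positivity),
    ENNReal.toReal_natCast] at this
  rw [measureReal_def, mul_comm]
  exact this

/-- A lower bound for the number of admissible lattice vectors of norm at most `R`, with entries not
much larger than the typical size `R / k ^ (1 / p)`. -/
theorem pow_le_card_latticeBall {p : ℝ≥0∞} (hp : 1 ≤ p) :
    ∃ k₀ : ℕ, ∃ t₀ c : ℝ, 0 < c ∧ ∀ (o : Orientation) (k : ℕ), k₀ ≤ k → ∀ R t : ℝ, t₀ ≤ t →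
      (k : ℝ) ^ p.toReal⁻¹ < R → ∀ T : ℕ, c * t * (R / (k : ℝ) ^ p.toReal⁻¹) + 1 ≤ T →
      (normConst o p * (R / (k : ℝ) ^ p.toReal⁻¹ - 1) * (1 - 2 * Real.exp (-t / 2))) ^ k /
        (30 * k) ≤ (latticeBall o p k R T).card := by
  rcases eq_or_ne p ⊤ with rfl | hpt
  · refine ⟨1, 2, 1, one_pos, fun o k hk R t ht hR T hT => ?_⟩
    simp only [ENNReal.toReal_top, inv_zero, Real.rpow_zero, div_one, one_mul] at *
    have hs : (1 : ℝ) ≤ numSides o := by exact_mod_cast one_le_numSides o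
    have hs2 : (numSides o : ℝ) ≤ 2 := by cases o <;> simp [numSides]
    -- for `p = ∞` the lattice ball is itself a box
    have hsub : (Fintype.piFinset fun _ : Fin k => box o ⌊R⌋₊) ⊆ latticeBall o ⊤ k R T := by
      intro w hw
      rw [Fintype.mem_piFinset] at hw
      have hfl : (⌊R⌋₊ : ℝ) ≤ R := Nat.floor_le (by linarith)
      have habs : ∀ i, |(w i : ℝ)| ≤ R := fun i =>
        le_trans (by exact_mod_cast (mem_box.mp (hw i)).1) hfl
      refine mem_latticeBall.mpr ⟨fun ho i => (mem_box.mp (hw i)).2 ho, fun i => ?_, ?_⟩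
      · have : |(w i : ℝ)| ≤ T := (habs i).trans (by nlinarith)
        exact_mod_cast this
      · exact (intNorm_top_le_iff (by linarith)).mpr habs
    have hcard := Finset.card_le_card hsub
    rw [Fintype.card_piFinset_const] at hcard
    have hbox : ((box o ⌊R⌋₊).card : ℝ) = 1 + numSides o * ⌊R⌋₊ := by
      have := sum_box_eq o ⌊R⌋₊ (F := fun _ => 1) (by simp)
      simpa using this
    have hexp : Real.exp (-t / 2) ≤ 1 / 2 := by
      have h1 : Real.exp (-t / 2) ≤ Real.exp (-1) := Real.exp_le_exp.mpr (by linarith)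
      have h2 := Real.exp_neg_one_lt_d9
      linarith
    have hk1 : (1 : ℝ) ≤ 30 * k := by
      have : (1 : ℝ) ≤ k := by exact_mod_cast hk
      linarith
    have hfl2 := Nat.lt_floor_add_one R
    have he := Real.exp_pos (-t / 2)
    have hbase0 : 0 ≤ normConst o ⊤ * (R - 1) * (1 - 2 * Real.exp (-t / 2)) := by
      rw [normConst_top]
      refine mul_nonneg (mul_nonneg (by linarith) (by linarith)) (by linarith)
    have hbase : normConst o ⊤ * (R - 1) * (1 - 2 * Real.exp (-t / 2)) ≤ (box o ⌊R⌋₊).card := by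
      rw [normConst_top, hbox]
      have a1 : numSides o * (R - 1) * (1 - 2 * Real.exp (-t / 2)) ≤ numSides o * (R - 1) :=
        mul_le_of_le_one_right (mul_nonneg (by linarith) (by linarith)) (by linarith)
      have a2 : numSides o * (R - 1) ≤ (numSides o : ℝ) * ⌊R⌋₊ := by gcongr; linarith
      linarith
    calc _ ≤ (normConst o ⊤ * (R - 1) * (1 - 2 * Real.exp (-t / 2))) ^ k :=
          div_le_self (by positivity) hk1
      _ ≤ ((box o ⌊R⌋₊).card : ℝ) ^ k := pow_le_pow_left₀ hbase0 hbase k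
      _ ≤ _ := by exact_mod_cast hcard
  · have h1 : 1 ≤ p.toReal := by
      have := ENNReal.toReal_mono hpt hp
      simpa using this
    set q := p.toReal with hq
    have h0 : 0 < q := by linarith
    obtain ⟨k₀, t₀, ht₀, H⟩ := pow_le_volume_truncBall h1
    refine ⟨max k₀ 1, t₀, (2 * q) ^ q⁻¹, by positivity, fun o k hk R t ht hR T hT => ?_⟩
    have hk1 : 0 < k := lt_of_lt_of_le one_pos ((le_max_right _ _).trans hk)
    have hk0 : (0 : ℝ) < k := by exact_mod_cast hk1
    have hV := H k ((le_max_left _ _).trans hk) (R - (k : ℝ) ^ q⁻¹) (by linarith) t ht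
    have hkq : 0 < (k : ℝ) ^ q⁻¹ := by positivity
    have hT' : t * (R - (k : ℝ) ^ q⁻¹) * (2 * q / k) ^ q⁻¹ + 1 ≤ T := by
      refine le_trans ?_ hT
      rw [Real.div_rpow (by positivity) hk0.le]
      have : t * (R - (k : ℝ) ^ q⁻¹) * ((2 * q) ^ q⁻¹ / (k : ℝ) ^ q⁻¹) =
        (2 * q) ^ q⁻¹ * t * ((R - (k : ℝ) ^ q⁻¹) / (k : ℝ) ^ q⁻¹) := by ring
      rw [this]
      have ht0 : 0 ≤ t := by linarith
      gcongr
      linarith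
    have hc := volume_truncBall_le_card o hp hpt hR.le hT'
    rw [← hq] at hc
    have hs : (0 : ℝ) < numSides o := by exact_mod_cast one_le_numSides o
    have hmain := hV.trans hc
    rw [← div_le_iff₀' (by positivity), div_right_comm, ← div_pow] at hmain
    refine le_trans (le_of_eq ?_) hmain
    rw [normConst_of_ne_top o hpt, ← hq]
    congr 2
    rw [sub_div, div_self hkq.ne']
    field_simp

end Volume

/-! ### From bounds to concentration -/

theorem concentratesWhp_of_bounds {o : Orientation} {p : ℝ≥0∞} {β : ℝ} {k : ℕ → ℕ}
    {G : ℕ → Type*} [∀ N, AddCommGroup (G N)] [∀ N, Finite (G N)] {M ξ err : ℕ → ℝ}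
    (hM : ∀ᶠ N in atTop, 0 < M N) (hξ : ∀ᶠ N in atTop, 0 ≤ ξ N)
    (hlow : ∀ᶠ N in atTop, ∀ Z : Fin (k N) → G N,
      ENNReal.ofReal (M N * (1 - ξ N)) ≤ typicalDist o p β Z)
    (herr : Tendsto err atTop (𝓝 0))
    (hup : ∀ᶠ N in atTop, 1 - err N ≤ uniformProb fun Z : Fin (k N) → G N =>
      typicalDist o p β Z ≤ (M N * (1 + ξ N)).toNNReal) :
    ConcentratesWhp o p β k G M ξ := by
  have h1 : Tendsto (fun N => 1 - err N) atTop (𝓝 1) := by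
    simpa using herr.const_sub 1
  refine tendsto_of_tendsto_of_tendsto_of_le_of_le' h1 tendsto_const_nhds ?_
    (Eventually.of_forall fun N => uniformProb_le_one _)
  filter_upwards [hM, hξ, hlow, hup] with N hM hξ hlow hup
  refine hup.trans (uniformProb_mono fun Z hZ => ?_)
  have hne : typicalDist o p β Z ≠ ⊤ := ne_top_of_le_ne_top ENNReal.coe_ne_top hZ
  refine ⟨hne, ?_⟩
  rw [div_le_iff₀ hM, abs_le]
  have h2 := ENNReal.toReal_mono ENNReal.coe_ne_top hZ
  rw [ENNReal.coe_toReal, Real.coe_toNNReal _ (by positivity)] at h2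
  have h3 := (ENNReal.ofReal_le_iff_le_toReal hne).mp (hlow Z)
  constructor <;> linarith

/-! ### Fewer generators than the logarithm of the group size: the error sum -/

/-- The contribution to the second moment of the pairs of lattice vectors that are congruent modulo
some `g ≥ 2`. For bounded `g` the terms decay exponentially as `d < k`; the truncation of the
entries at `x ^ (1 + δ / 2)` makes the same true of the large `g`. -/
theorem tendsto_sum_congruent_pairs {k d T : ℕ → ℕ} {x ξ : ℕ → ℝ} {δ : ℝ} (hδ0 : 0 < δ)
    (hδ1 : δ < 1) (hk : Tendsto k atTop atTop) (hx : Tendsto x atTop atTop)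
    (hξ : Tendsto ξ atTop (𝓝 0)) (hξ0 : ∀ᶠ N in atTop, 0 ≤ ξ N)
    (hT : ∀ᶠ N in atTop, 2 * (T N : ℝ) ≤ x N ^ (1 + δ / 2))
    (hd : ∀ᶠ N in atTop, (d N : ℝ) ≤ (1 - δ) * k N) :
    Tendsto (fun N => ∑ g ∈ Finset.Icc 2 (2 * T N), (g : ℝ) ^ d N *
      (2 * Real.exp 1 / x N + (1 + ξ N) / g) ^ k N) atTop (𝓝 0) := by
  obtain ⟨G₀, hG₀, hG₀1⟩ : ∃ G₀ : ℝ, (∀ g : ℝ, G₀ ≤ g → 8 * g ^ (-(δ / 4)) ≤ 1 / 2) ∧ 1 ≤ G₀ := by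
    have h := (tendsto_rpow_neg_atTop (show 0 < δ / 4 by positivity)).const_mul 8
    rw [mul_zero] at h
    obtain ⟨G, hG⟩ := (h.eventually
      (gt_mem_nhds (show (0 : ℝ) < 1 / 2 by norm_num))).exists_forall_of_atTop
    exact ⟨max G 1, fun g hg => (hG g ((le_max_left _ _).trans hg)).le, le_max_right _ _⟩
  have hkR : Tendsto (fun N => (k N : ℝ)) atTop atTop := tendsto_natCast_atTop_atTop.comp hk
  set S : ℝ := ∑' g : ℕ, (g : ℝ) ^ (-2 : ℝ) with hS
  have hsum : Summable fun g : ℕ => (g : ℝ) ^ (-2 : ℝ) :=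
    Real.summable_nat_rpow.mpr (by norm_num)
  have hb1 : Tendsto (fun N => ((1 : ℝ) / 2) ^ k N) atTop (𝓝 0) :=
    (tendsto_pow_atTop_nhds_zero_of_lt_one (by norm_num) (by norm_num)).comp hk
  have hb2 : Tendsto (fun N => (2 : ℝ) ^ (2 - δ * k N / 2)) atTop (𝓝 0) := by
    have h1 : Tendsto (fun N => 2 - δ * k N / 2) atTop atBot := by
      refine tendsto_atBot_add_const_left _ _ (tendsto_neg_atTop_atBot.comp ?_)
      exact (hkR.const_mul_atTop hδ0).atTop_div_const (by norm_num)
    exact (tendsto_rpow_atBot_of_base_gt_one 2 (by norm_num)).comp h1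
  have hlim : Tendsto (fun N => (((1 : ℝ) / 2) ^ k N + (2 : ℝ) ^ (2 - δ * k N / 2)) * S)
      atTop (𝓝 0) := by
    simpa using (hb1.add hb2).mul_const S
  have h2δ : (0 : ℝ) < 2 ^ (δ / 2) - 1 := by
    have := Real.one_lt_rpow (x := 2) (z := δ / 2) (by norm_num) (by positivity)
    linarith
  have hsmall : ∀ᶠ N in atTop, ξ N + 2 * Real.exp 1 * G₀ / x N < 2 ^ (δ / 2) - 1 := by
    have : Tendsto (fun N => ξ N + 2 * Real.exp 1 * G₀ / x N) atTop (𝓝 (0 + 0)) :=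
      hξ.add (hx.const_div_atTop _)
    rw [add_zero] at this
    exact this.eventually (gt_mem_nhds h2δ)
  refine squeeze_zero' ?_ ?_ hlim
  · filter_upwards [hx.eventually_gt_atTop 0, hξ0] with N hx0 hξ0
    refine Finset.sum_nonneg fun g _ => by positivity
  filter_upwards [hx.eventually_ge_atTop 1, hξ0, hT, hd, hsmall, hξ.eventually
    (gt_mem_nhds (show (0 : ℝ) < 1 by norm_num)), hkR.eventually_ge_atTop (8 / δ)]
    with N hx1 hξ0 hT hd hsmall hξ1 hkδ
  have hx0 : 0 < x N := by linarith
  have hkδ' : 8 ≤ δ * k N := by rw [div_le_iff₀ hδ0] at hkδ; linarith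
  have hk0 : (0 : ℝ) < k N := by
    by_contra h
    nlinarith
  have he3 : Real.exp 1 ≤ 3 := by have := Real.exp_one_lt_d9; linarith
  have hterm : ∀ g ∈ Finset.Icc 2 (2 * T N), (g : ℝ) ^ d N *
      (2 * Real.exp 1 / x N + (1 + ξ N) / g) ^ k N ≤
      (((1 : ℝ) / 2) ^ k N + (2 : ℝ) ^ (2 - δ * k N / 2)) * (g : ℝ) ^ (-2 : ℝ) := by
    intro g hg
    rw [Finset.mem_Icc] at hg
    have hg2 : (2 : ℝ) ≤ g := by exact_mod_cast hg.1
    have hg0 : (0 : ℝ) < g := by linarith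
    have hg1 : (1 : ℝ) ≤ g := by linarith
    have hgT : (g : ℝ) ≤ x N ^ (1 + δ / 2) := by
      refine le_trans ?_ hT
      exact_mod_cast hg.2
    have hgd : (g : ℝ) ^ d N ≤ (g : ℝ) ^ ((1 - δ) * k N) := by
      rw [← Real.rpow_natCast]
      exact Real.rpow_le_rpow_of_exponent_le hg1 hd
    have p1 : (0 : ℝ) ≤ ((1 : ℝ) / 2) ^ k N := by positivity
    have p2 : (0 : ℝ) ≤ (2 : ℝ) ^ (2 - δ * k N / 2) := by positivity
    have p3 : (0 : ℝ) ≤ (g : ℝ) ^ (-2 : ℝ) := by positivity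
    rcases le_or_gt G₀ (g : ℝ) with hGg | hGg
    -- large `g`: as `g ≤ x ^ (1 + δ / 2)`, both summands are `O(g ^ (-(1 - δ / 2)))`, so that the
    -- term is `O(1) ^ k * g ^ (-δ * k / 2)`
    · have hxg : (x N)⁻¹ ≤ (g : ℝ) ^ (-(1 - δ / 2)) := by
        rw [Real.rpow_neg hg0.le]
        refine inv_anti₀ (by positivity) ?_
        calc (g : ℝ) ^ (1 - δ / 2) ≤ (x N ^ (1 + δ / 2)) ^ (1 - δ / 2) :=
              Real.rpow_le_rpow hg0.le hgT (by linarith)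
          _ = x N ^ ((1 + δ / 2) * (1 - δ / 2)) := (Real.rpow_mul hx0.le _ _).symm
          _ ≤ x N ^ (1 : ℝ) := Real.rpow_le_rpow_of_exponent_le hx1 (by nlinarith)
          _ = x N := Real.rpow_one _
      have hgg : (g : ℝ)⁻¹ ≤ (g : ℝ) ^ (-(1 - δ / 2)) := by
        rw [← Real.rpow_neg_one]
        exact Real.rpow_le_rpow_of_exponent_le hg1 (by linarith)
      have hbase : 2 * Real.exp 1 / x N + (1 + ξ N) / g ≤ 8 * (g : ℝ) ^ (-(1 - δ / 2)) := by
        rw [div_eq_mul_inv, div_eq_mul_inv]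
        have a1 : 2 * Real.exp 1 * (x N)⁻¹ ≤ 6 * (g : ℝ) ^ (-(1 - δ / 2)) := by
          gcongr; linarith
        have a2 : (1 + ξ N) * (g : ℝ)⁻¹ ≤ 2 * (g : ℝ) ^ (-(1 - δ / 2)) := by
          gcongr; linarith
        linarith
      calc (g : ℝ) ^ d N * (2 * Real.exp 1 / x N + (1 + ξ N) / g) ^ k N
          ≤ (g : ℝ) ^ ((1 - δ) * k N) * (8 * (g : ℝ) ^ (-(1 - δ / 2))) ^ k N := by gcongr
        _ = (8 * (g : ℝ) ^ (-(δ / 4))) ^ k N * (g : ℝ) ^ (-(δ * k N / 4)) := by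
            rw [mul_pow, mul_pow, ← Real.rpow_natCast ((g : ℝ) ^ (-(1 - δ / 2))),
              ← Real.rpow_natCast ((g : ℝ) ^ (-(δ / 4))), ← Real.rpow_mul hg0.le,
              ← Real.rpow_mul hg0.le, mul_left_comm, ← Real.rpow_add hg0, mul_assoc,
              ← Real.rpow_add hg0]
            congr 2
            ring
        _ ≤ (1 / 2) ^ k N * (g : ℝ) ^ (-2 : ℝ) := by
            gcongr
            · exact hG₀ _ hGg
            · linarith
        _ ≤ _ := by nlinarith
    -- bounded `g`: the base is `(1 + o(1)) / g`, so that the term is at most `g ^ (-δ * k / 2)`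
    · have hbase : 2 * Real.exp 1 / x N + (1 + ξ N) / g ≤ 2 ^ (δ / 2) * (g : ℝ)⁻¹ := by
        have a1 : 2 * Real.exp 1 / x N + (1 + ξ N) / g =
            (2 * Real.exp 1 * g / x N + (1 + ξ N)) * (g : ℝ)⁻¹ := by field_simp
        have a2 : 2 * Real.exp 1 * g / x N ≤ 2 * Real.exp 1 * G₀ / x N := by gcongr
        rw [a1]
        gcongr
        linarith
      have hgb : (2 : ℝ) ^ (δ / 2) ≤ (g : ℝ) ^ (δ / 2) :=
        Real.rpow_le_rpow (by norm_num) hg2 (by positivity)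
      calc (g : ℝ) ^ d N * (2 * Real.exp 1 / x N + (1 + ξ N) / g) ^ k N
          ≤ (g : ℝ) ^ ((1 - δ) * k N) * ((g : ℝ) ^ (δ / 2) * (g : ℝ)⁻¹) ^ k N := by
            gcongr
            exact hbase.trans (by gcongr)
        _ = (g : ℝ) ^ (2 - δ * k N / 2) * (g : ℝ) ^ (-2 : ℝ) := by
            rw [← Real.rpow_neg_one, ← Real.rpow_add hg0, ← Real.rpow_natCast, ← Real.rpow_mul hg0.le,
              ← Real.rpow_add hg0, ← Real.rpow_add hg0]
            congr 1
            ring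
        _ ≤ 2 ^ (2 - δ * k N / 2) * (g : ℝ) ^ (-2 : ℝ) := by
            refine mul_le_mul_of_nonneg_right ?_ p3
            exact Real.rpow_le_rpow_of_nonpos (by norm_num) hg2 (by linarith)
        _ ≤ _ := by nlinarith
  refine (Finset.sum_le_sum hterm).trans ?_
  rw [← Finset.mul_sum]
  gcongr
  exact hsum.sum_le_tsum _ fun g _ => by positivity

/-! ### Fewer generators than the logarithm of the group size: radii -/

theorem tendsto_rpow_inv_atTop {k n : ℕ → ℕ} (hn : Tendsto n atTop atTop)
    (hk : Tendsto k atTop atTop)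
    (hkn : Tendsto (fun N => (k N : ℝ) / Real.log (n N)) atTop (𝓝 0)) :
    Tendsto (fun N => (n N : ℝ) ^ (1 / (k N : ℝ))) atTop atTop := by
  have h1 : Tendsto (fun N => Real.log (n N) / (k N : ℝ)) atTop atTop := by
    have h2 : Tendsto (fun N => (k N : ℝ) / Real.log (n N)) atTop (𝓝[>] 0) := by
      refine tendsto_nhdsWithin_iff.mpr ⟨hkn, ?_⟩
      filter_upwards [hn.eventually_ge_atTop 2, hk.eventually_ge_atTop 1] with N h2 h1
      have a1 : (0 : ℝ) < k N := by exact_mod_cast h1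
      have a2 : 0 < Real.log (n N) := Real.log_pos (by exact_mod_cast h2)
      exact div_pos a1 a2
    exact h2.inv_tendsto_nhdsGT_zero.congr fun N => by rw [Pi.inv_apply, inv_div]
  refine (Real.tendsto_exp_atTop.comp h1).congr' ?_
  filter_upwards [hn.eventually_ge_atTop 1] with N h
  have : (0 : ℝ) < n N := by exact_mod_cast h
  rw [Real.rpow_def_of_pos this, Function.comp_apply, mul_one_div]

theorem errorTerm_one_eq {k n : ℕ} (hk : 0 < k) :
    errorTerm 1 k n =
      max (Real.log k ^ 2 / k) (((n : ℝ) ^ (1 / (k : ℝ))) ^ (-(1 / 2) : ℝ)) := by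
  have hk0 : (0 : ℝ) < k := by exact_mod_cast hk
  unfold errorTerm
  rw [one_mul, ← Real.rpow_mul (by positivity), ← max_div_div_right hk0.le]
  congr 1
  rw [div_div, mul_comm, ← div_div, div_self hk0.ne', one_div, ← Real.rpow_neg (by positivity)]
  congr 1
  field_simp

theorem tendsto_errorTerm {k n : ℕ → ℕ} (hn : Tendsto n atTop atTop)
    (hk : Tendsto k atTop atTop)
    (hkn : Tendsto (fun N => (k N : ℝ) / Real.log (n N)) atTop (𝓝 0)) :
    Tendsto (fun N => errorTerm 1 (k N) (n N)) atTop (𝓝 0) := by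
  have hkR : Tendsto (fun N => (k N : ℝ)) atTop atTop := tendsto_natCast_atTop_atTop.comp hk
  have h1 : Tendsto (fun N => Real.log (k N) ^ 2 / (k N : ℝ)) atTop (𝓝 0) := by
    have := (isLittleO_log_rpow_rpow_atTop 2 (one_pos)).tendsto_div_nhds_zero
    have h2 := this.comp hkR
    refine h2.congr fun N => ?_
    simp
  have h2 : Tendsto (fun N => ((n N : ℝ) ^ (1 / (k N : ℝ))) ^ (-(1 / 2) : ℝ)) atTop (𝓝 0) :=
    (tendsto_rpow_neg_atTop (by norm_num)).comp (tendsto_rpow_inv_atTop hn hk hkn)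
  have h3 := h1.max h2
  rw [max_self] at h3
  refine h3.congr' ?_
  filter_upwards [hk.eventually_ge_atTop 1] with N h
  exact (errorTerm_one_eq h).symm

theorem radius_pos (o : Orientation) {p : ℝ≥0∞} (hp : 1 ≤ p) {k n : ℕ} (hk : 0 < k) (hn : 0 < n) :
    0 < radius o p k n := by
  have h1 := normConst_pos o hp
  have h2 : (0 : ℝ) < k := by exact_mod_cast hk
  have h3 : (0 : ℝ) < n := by exact_mod_cast hn
  unfold radius
  positivity

theorem radius_div_rpow (o : Orientation) (p : ℝ≥0∞) {k : ℕ} (hk : 0 < k) (n : ℕ) :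
    radius o p k n / (k : ℝ) ^ p.toReal⁻¹ = (n : ℝ) ^ (1 / (k : ℝ)) / normConst o p := by
  have h2 : (0 : ℝ) < k := by exact_mod_cast hk
  unfold radius
  field_simp

theorem rpow_one_div_pow {k : ℕ} (hk : 0 < k) (n : ℕ) :
    ((n : ℝ) ^ (1 / (k : ℝ))) ^ k = n := by
  rw [one_div, Real.rpow_inv_natCast_pow (by positivity) hk.ne']

/-- The deterministic lower bound: at the radius `M * (1 - ξ)` the lattice ball has only
`o(n)` points. -/
theorem eventually_le_typicalDist {p : ℝ≥0∞} (hp : 1 ≤ p) {k n : ℕ → ℕ}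
    (hn : Tendsto n atTop atTop) (hk : Tendsto k atTop atTop)
    (hkn : Tendsto (fun N => (k N : ℝ) / Real.log (n N)) atTop (𝓝 0)) (o : Orientation) {β : ℝ}
    (hβ : 0 < β) :
    ∀ᶠ N in atTop, ∀ (G : Type*) [AddCommGroup G] [Finite G], Nat.card G = n N →
      ∀ Z : Fin (k N) → G, ENNReal.ofReal (radius o p (k N) (n N) *
        (1 - errorTerm 1 (k N) (n N))) ≤ typicalDist o p β Z := by
  have hkR : Tendsto (fun N => (k N : ℝ)) atTop atTop := tendsto_natCast_atTop_atTop.comp hk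
  have hx := tendsto_rpow_inv_atTop hn hk hkn
  have hξ := tendsto_errorTerm hn hk hkn
  have hβlim : Tendsto (fun N => Real.exp (-(Real.log (k N) ^ 2 / 2))) atTop (𝓝 0) := by
    refine Real.tendsto_exp_atBot.comp (tendsto_neg_atTop_atBot.comp ?_)
    exact ((tendsto_pow_atTop (two_ne_zero)).comp
      (Real.tendsto_log_atTop.comp hkR)).atTop_div_const (by norm_num)
  filter_upwards [hk.eventually_ge_atTop 1, hn.eventually_ge_atTop 1,
    hξ.eventually (gt_mem_nhds (show (0 : ℝ) < 1 by norm_num)),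
    hx.eventually_ge_atTop ((4 * Real.exp 1) ^ 2), hβlim.eventually (gt_mem_nhds hβ)]
    with N hk1 hn1 hξ1 hx1 hβN G _ _ hG Z
  have hk0 : (0 : ℝ) < k N := by exact_mod_cast hk1
  have hn0 : (0 : ℝ) < n N := by exact_mod_cast hn1
  set x : ℝ := (n N : ℝ) ^ (1 / (k N : ℝ)) with hxdef
  set ξ : ℝ := errorTerm 1 (k N) (n N) with hξdef
  have hx0 : 0 < x := by positivity
  have hξk : Real.log (k N) ^ 2 / k N ≤ ξ := by
    rw [hξdef, errorTerm_one_eq hk1]; exact le_max_left _ _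
  have hξx : x ^ (-(1 / 2) : ℝ) ≤ ξ := by
    rw [hξdef, errorTerm_one_eq hk1]; exact le_max_right _ _
  have hR0 : 0 < radius o p (k N) (n N) * (1 - ξ) :=
    mul_pos (radius_pos o hp hk1 hn1) (by linarith)
  have hC := normConst_pos o hp
  refine le_typicalDist o hp Z (latticeBall o p (k N) (radius o p (k N) (n N) * (1 - ξ))
    ⌊radius o p (k N) (n N) * (1 - ξ)⌋₊) (fun w ha hw => mem_latticeBall.mpr ⟨ha, fun i => ?_, hw⟩) ?_
  · exact (mem_box.mp (mem_box_of_intNorm_le hp hR0.le ha hw i)).1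
  · have h1 := card_residueClass_le hk1 o hp hR0 (latticeBall o p (k N)
      (radius o p (k N) (n N) * (1 - ξ)) ⌊radius o p (k N) (n N) * (1 - ξ)⌋₊)
      (fun w hw => ⟨(mem_latticeBall.mp hw).1, (mem_latticeBall.mp hw).2.2⟩) one_pos 0
    rw [Finset.filter_true_of_mem (fun w _ i => by simp)] at h1
    refine lt_of_le_of_lt h1 ?_
    have h2 : 2 * Real.exp 1 + normConst o p * (radius o p (k N) (n N) * (1 - ξ)) /
        ((1 : ℕ) * (k N : ℝ) ^ p.toReal⁻¹) = 2 * Real.exp 1 + x * (1 - ξ) := by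
      have h3 := radius_div_rpow o p hk1 (n N)
      rw [Nat.cast_one, one_mul, ← mul_assoc, mul_div_right_comm, mul_div_assoc, h3,
        mul_div_cancel₀ _ hC.ne']
    -- the additive constant is absorbed since `x * ξ ≥ x ^ (1 / 2)`
    have h4 : 2 * Real.exp 1 ≤ x * (ξ / 2) := by
      have a1 : 4 * Real.exp 1 ≤ x ^ (1 / 2 : ℝ) := by
        rw [← Real.sqrt_eq_rpow]
        exact Real.le_sqrt_of_sq_le hx1
      have a2 : x * x ^ (-(1 / 2) : ℝ) = x ^ (1 / 2 : ℝ) := by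
        nth_rewrite 1 [← Real.rpow_one x]
        rw [← Real.rpow_add hx0]; norm_num
      have a3 : x * x ^ (-(1 / 2) : ℝ) ≤ x * ξ := by gcongr
      linarith
    have h5 : 2 * Real.exp 1 + x * (1 - ξ) ≤ x * Real.exp (-(ξ / 2)) := by
      have := Real.add_one_le_exp (-(ξ / 2))
      have a1 : x * (-(ξ / 2) + 1) ≤ x * Real.exp (-(ξ / 2)) := by gcongr
      linarith
    rw [h2, hG]
    calc (2 * Real.exp 1 + x * (1 - ξ)) ^ k N ≤ (x * Real.exp (-(ξ / 2))) ^ k N := by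
          have : 0 ≤ x * (1 - ξ) := mul_nonneg hx0.le (by linarith)
          gcongr
      _ = Real.exp (-(k N * ξ / 2)) * n N := by
          rw [mul_pow, hxdef, rpow_one_div_pow hk1, ← Real.exp_nat_mul, mul_comm]
          congr 2; ring
      _ ≤ Real.exp (-(Real.log (k N) ^ 2 / 2)) * n N := by
          rw [div_le_iff₀ hk0] at hξk
          gcongr
          linarith
      _ < β * n N := by gcongr

/-! ### Fewer generators than the logarithm of the group size: concentration -/

/-- At the radius `M * (1 + ξ)` the lattice ball, truncated at `x ^ (1 + δ / 2)` with
`x = n ^ (1 / k)`, still has many more than `n` points. -/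
theorem exists_truncation {p : ℝ≥0∞} (hp : 1 ≤ p) {k n : ℕ → ℕ}
    (hn : Tendsto n atTop atTop) (hk : Tendsto k atTop atTop)
    (hkn : Tendsto (fun N => (k N : ℝ) / Real.log (n N)) atTop (𝓝 0)) (o : Orientation)
    {δ : ℝ} (hδ : 0 < δ) :
    ∃ T : ℕ → ℕ,
      (∀ᶠ N in atTop, 2 * (T N : ℝ) ≤ ((n N : ℝ) ^ (1 / (k N : ℝ))) ^ (1 + δ / 2)) ∧
      ∀ᶠ N in atTop, (n N : ℝ) * (k N / 30) ≤ (latticeBall o p (k N)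
        (radius o p (k N) (n N) * (1 + errorTerm 1 (k N) (n N))) (T N)).card := by
  obtain ⟨k₀, t₀, c, hc, H⟩ := pow_le_card_latticeBall hp
  have hC := normConst_pos o hp
  set C := normConst o p with hCdef
  have hkR : Tendsto (fun N => (k N : ℝ)) atTop atTop := tendsto_natCast_atTop_atTop.comp hk
  have hx := tendsto_rpow_inv_atTop hn hk hkn
  have hξ := tendsto_errorTerm hn hk hkn
  set x : ℕ → ℝ := fun N => (n N : ℝ) ^ (1 / (k N : ℝ)) with hxdef
  set ξ : ℕ → ℝ := fun N => errorTerm 1 (k N) (n N) with hξdef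
  have ht : Tendsto (fun N => x N ^ (δ / 4)) atTop atTop :=
    (tendsto_rpow_atTop (by positivity)).comp hx
  have hη : Tendsto (fun N => x N ^ (1 / 2 : ℝ) * Real.exp (-x N ^ (δ / 4) / 2)) atTop (𝓝 0) := by
    have h1 := (tendsto_rpow_mul_exp_neg_mul_atTop_nhds_zero (2 / δ) (1 / 2) (by norm_num)).comp ht
    refine h1.congr' ?_
    filter_upwards [hx.eventually_gt_atTop 0] with N hN
    simp only [Function.comp_apply]
    rw [← Real.rpow_mul hN.le]
    congr 2
    · field_simp; norm_num
    · ring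
  -- `t = x ^ (δ / 4)` in the lower bound for the lattice ball
  refine ⟨fun N => ⌈c * x N ^ (δ / 4) * (x N * (1 + ξ N) / C) + 1⌉₊, ?_, ?_⟩
  · filter_upwards [hx.eventually_ge_atTop 1, ht.eventually_ge_atTop (4 * c / C + 4),
      hξ.eventually (gt_mem_nhds (show (0 : ℝ) < 1 by norm_num)),
      hk.eventually_ge_atTop 1] with N hx1 ht1 hξ1 hk1
    have hx0 : 0 < x N := by linarith
    have hξ0 : 0 ≤ ξ N := by
      simp only [hξdef]; rw [errorTerm_one_eq hk1]
      exact le_max_of_le_left (by positivity)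
    have h1 := (Nat.ceil_lt_add_one (a := c * x N ^ (δ / 4) * (x N * (1 + ξ N) / C) + 1)
      (by positivity)).le
    have h2 : c * x N ^ (δ / 4) * (x N * (1 + ξ N) / C) ≤
        2 * c / C * (x N ^ (δ / 4) * x N) := by
      calc _ ≤ c * x N ^ (δ / 4) * (x N * (1 + 1) / C) := by gcongr
        _ = _ := by ring
    have h3 : x N ^ (1 + δ / 2) = x N ^ (δ / 4) * (x N ^ (δ / 4) * x N) := by
      nth_rewrite 4 [← Real.rpow_one (x N)]
      rw [← Real.rpow_add hx0, ← Real.rpow_add hx0]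
      congr 1; ring
    have h4 : 1 ≤ x N ^ (δ / 4) := Real.one_le_rpow hx1 (by positivity)
    have h5 : 1 ≤ x N ^ (δ / 4) * x N := by nlinarith
    have h6 : (4 * c / C + 4) * (x N ^ (δ / 4) * x N) ≤
      x N ^ (δ / 4) * (x N ^ (δ / 4) * x N) := by gcongr
    have h7 : (4 * c / C + 4) * (x N ^ (δ / 4) * x N) =
      2 * (2 * c / C * (x N ^ (δ / 4) * x N)) + 4 * (x N ^ (δ / 4) * x N) := by ring
    change _ ≤ x N ^ (1 + δ / 2)
    rw [h3]
    linarith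
  · filter_upwards [hk.eventually_ge_atTop 1, hn.eventually_ge_atTop 1,
      hξ.eventually (gt_mem_nhds (show (0 : ℝ) < 1 by norm_num)), hk.eventually_ge_atTop k₀,
      hx.eventually_gt_atTop C, hx.eventually_ge_atTop ((2 * C) ^ 2), ht.eventually_ge_atTop t₀,
      hη.eventually (gt_mem_nhds (show (0 : ℝ) < 1 / 16 by norm_num)),
      (Real.tendsto_log_atTop.comp hkR).eventually_ge_atTop 16] with
      N hk1 hn1 hξ1 hkk₀ hxC hxC2 htt₀ hη1 hlog
    have hk0 : (0 : ℝ) < k N := by exact_mod_cast hk1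
    have hn0 : (0 : ℝ) < n N := by exact_mod_cast hn1
    have hx0 : 0 < x N := by linarith
    have hξk : Real.log (k N) ^ 2 / k N ≤ ξ N := by
      simp only [hξdef]; rw [errorTerm_one_eq hk1]; exact le_max_left _ _
    have hξx : x N ^ (-(1 / 2) : ℝ) ≤ ξ N := by
      simp only [hξdef]; rw [errorTerm_one_eq hk1]; exact le_max_right _ _
    have hξ0 : 0 ≤ ξ N := le_trans (by positivity) hξx
    have hdiv : radius o p (k N) (n N) * (1 + ξ N) / (k N : ℝ) ^ p.toReal⁻¹ =
        x N * (1 + ξ N) / C := by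
      rw [mul_div_right_comm, radius_div_rpow o p hk1]; ring
    have hR : (k N : ℝ) ^ p.toReal⁻¹ < radius o p (k N) (n N) * (1 + ξ N) := by
      rw [← one_lt_div (by positivity), hdiv, one_lt_div hC]
      nlinarith
    have hH := H o (k N) hkk₀ (radius o p (k N) (n N) * (1 + ξ N)) (x N ^ (δ / 4)) htt₀ hR
      ⌈c * x N ^ (δ / 4) * (x N * (1 + ξ N) / C) + 1⌉₊ (by rw [hdiv]; exact Nat.le_ceil _)
    refine le_trans ?_ hH
    rw [hdiv, ← hCdef]
    have hhalf : x N ^ (1 / 2 : ℝ) * x N ^ (-(1 / 2) : ℝ) = 1 := by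
      rw [← Real.rpow_add hx0]; norm_num
    have hh0 : 0 < x N ^ (1 / 2 : ℝ) := by positivity
    -- the losses by truncation and by rounding are small compared with `ξ ≥ x ^ (-1 / 2)`
    have hη2 : 2 * Real.exp (-x N ^ (δ / 4) / 2) ≤ ξ N / 8 := by
      have a1 : Real.exp (-x N ^ (δ / 4) / 2) ≤ 1 / 16 * x N ^ (-(1 / 2) : ℝ) := by
        rw [← mul_le_mul_iff_of_pos_left hh0]
        calc _ ≤ 1 / 16 := hη1.le
          _ = _ := by rw [mul_left_comm, hhalf, mul_one]
      linarith
    have hCx : C ≤ x N * (ξ N / 2) := by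
      have a1 : 2 * C ≤ x N ^ (1 / 2 : ℝ) := by
        rw [← Real.sqrt_eq_rpow]
        exact Real.le_sqrt_of_sq_le hxC2
      have a2 : x N * x N ^ (-(1 / 2) : ℝ) = x N ^ (1 / 2 : ℝ) := by
        nth_rewrite 1 [← Real.rpow_one (x N)]
        rw [← Real.rpow_add hx0]; norm_num
      have a3 : x N * x N ^ (-(1 / 2) : ℝ) ≤ x N * ξ N := by gcongr
      linarith
    have hbase : x N * Real.exp (ξ N / 8) ≤
        C * (x N * (1 + ξ N) / C - 1) * (1 - 2 * Real.exp (-x N ^ (δ / 4) / 2)) := by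
      have a1 : C * (x N * (1 + ξ N) / C - 1) = x N * (1 + ξ N) - C := by field_simp
      have a2 : Real.exp (ξ N / 8) ≤ 1 + ξ N / 4 := by
        have b1 := Real.one_sub_le_exp_neg (ξ N / 8)
        have b2 : Real.exp (ξ N / 8) * Real.exp (-(ξ N / 8)) = 1 := by
          rw [← Real.exp_add]; simp
        have b3 := Real.exp_pos (ξ N / 8)
        have b4 : Real.exp (ξ N / 8) * (1 - ξ N / 8) ≤ 1 := by
          exact (mul_le_mul_of_nonneg_left b1 b3.le).trans_eq b2
        have b5 : 1 ≤ (1 + ξ N / 4) * (1 - ξ N / 8) := by nlinarith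
        have b6 : 0 < 1 - ξ N / 8 := by linarith
        exact le_of_mul_le_mul_right (b4.trans b5) b6
      rw [a1]
      calc x N * Real.exp (ξ N / 8) ≤ x N * (1 + ξ N / 4) := by gcongr
        _ ≤ x N * ((1 + ξ N / 2) * (1 - ξ N / 8)) := by gcongr; nlinarith
        _ = (x N * (1 + ξ N / 2)) * (1 - ξ N / 8) := by ring
        _ ≤ (x N * (1 + ξ N) - C) * (1 - ξ N / 8) := by
            have : 0 ≤ 1 - ξ N / 8 := by linarith
            gcongr
            linarith
        _ ≤ _ := by
            have : 0 ≤ x N * (1 + ξ N) - C := by nlinarith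
            gcongr
    -- `k * ξ ≥ (log k) ^ 2` outweighs the polynomial loss in the volume bound
    calc (n N : ℝ) * (k N / 30) = n N * Real.exp (2 * Real.log (k N)) / (30 * k N) := by
          rw [two_mul, Real.exp_add, Real.exp_log hk0]; field_simp
      _ ≤ n N * Real.exp (k N * (ξ N / 8)) / (30 * k N) := by
          rw [div_le_iff₀ hk0] at hξk
          simp only [Function.comp_apply] at hlog
          have hexp : 2 * Real.log (k N) ≤ k N * (ξ N / 8) := by nlinarith
          exact div_le_div_of_nonneg_right (mul_le_mul_of_nonneg_left (Real.exp_le_exp.mpr hexp)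
            hn0.le) (by positivity)
      _ = (x N * Real.exp (ξ N / 8)) ^ k N / (30 * k N) := by
          rw [mul_pow, ← Real.exp_nat_mul]
          simp only [hxdef]
          rw [rpow_one_div_pow hk1]
      _ ≤ _ := by gcongr

theorem exists_dim_le_of_limsup {d k : ℕ → ℕ} (hk : Tendsto k atTop atTop)
    (h : limsup (fun N => (d N : ℝ≥0∞) / (k N : ℝ≥0∞)) atTop < 1) :
    ∃ δ : ℝ, 0 < δ ∧ δ < 1 ∧ ∀ᶠ N in atTop, (d N : ℝ) ≤ (1 - δ) * k N := by
  obtain ⟨c, hc1, hc2⟩ := exists_between h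
  have hct : c ≠ ⊤ := (hc2.trans ENNReal.one_lt_top).ne
  have hc0 : 0 < c.toReal := ENNReal.toReal_pos (pos_of_gt hc1).ne' hct
  have hcr : c.toReal < 1 := by
    have := (ENNReal.toReal_lt_toReal hct ENNReal.one_ne_top).mpr hc2
    simpa using this
  refine ⟨1 - c.toReal, by linarith, by linarith, ?_⟩
  filter_upwards [eventually_lt_of_limsup_lt hc1, hk.eventually_ge_atTop 1] with N hN hk1
  have hk0 : (k N : ℝ≥0∞) ≠ 0 := by
    have : k N ≠ 0 := by omega
    exact_mod_cast this
  have h2 := (ENNReal.div_le_iff hk0 (by simp)).mp hN.le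
  have h3 := ENNReal.toReal_mono (by finiteness) h2
  simpa using h3

/-- Concentration when the number of generators is much smaller than the logarithm of the size of
the group. -/
theorem concentratesWhp_radius {p : ℝ≥0∞} (hp : 1 ≤ p) {k n : ℕ → ℕ}
    (hn : Tendsto n atTop atTop) (hk : Tendsto k atTop atTop)
    (hkn : Tendsto (fun N => (k N : ℝ) / Real.log (n N)) atTop (𝓝 0))
    (G : ℕ → Type*) [∀ N, AddCommGroup (G N)] [∀ N, Finite (G N)]
    (hG : ∀ N, Nat.card (G N) = n N)
    (hd : limsup (fun N => (dimension (G N) : ℝ≥0∞) / (k N : ℝ≥0∞)) atTop < 1)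
    (o : Orientation) {β : ℝ} (hβ0 : 0 < β) (hβ1 : β < 1) :
    ConcentratesWhp o p β k G (fun N => radius o p (k N) (n N))
      (fun N => errorTerm 1 (k N) (n N)) := by
  obtain ⟨δ, hδ0, hδ1, hdδ⟩ := exists_dim_le_of_limsup hk hd
  obtain ⟨T, hT, hcard⟩ := exists_truncation hp hn hk hkn o hδ0
  have hx := tendsto_rpow_inv_atTop hn hk hkn
  have hξ := tendsto_errorTerm hn hk hkn
  have hkR : Tendsto (fun N => (k N : ℝ)) atTop atTop := tendsto_natCast_atTop_atTop.comp hk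
  have hξ0 : ∀ᶠ N in atTop, 0 ≤ errorTerm 1 (k N) (n N) := by
    filter_upwards [hk.eventually_ge_atTop 1] with N hk1
    rw [errorTerm_one_eq hk1]
    exact le_max_of_le_left (by positivity)
  have hC := normConst_pos o hp
  have hsum := tendsto_sum_congruent_pairs hδ0 hδ1 hk hx hξ hξ0 hT hdδ
  have herr := ((hkR.const_div_atTop 30).add hsum).div_const (1 / β - 1)
  rw [add_zero, zero_div] at herr
  refine concentratesWhp_of_bounds ?_ hξ0 ?_ herr ?_
  · filter_upwards [hk.eventually_ge_atTop 1, hn.eventually_ge_atTop 1] with N hk1 hn1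
    exact radius_pos o hp hk1 hn1
  · filter_upwards [eventually_le_typicalDist hp hn hk hkn o hβ0] with N h
    exact h (G N) (hG N)
  · filter_upwards [hk.eventually_ge_atTop 30, hn.eventually_ge_atTop 1, hcard, hξ0,
      hx.eventually_gt_atTop 0] with N hk30 hn1 hcard hξ0 hx0
    have hk1 : 0 < k N := by omega
    have hk0 : (30 : ℝ) ≤ k N := by exact_mod_cast hk30
    have hn0 : (0 : ℝ) < n N := by exact_mod_cast hn1
    set R : ℝ := radius o p (k N) (n N) * (1 + errorTerm 1 (k N) (n N)) with hR
    have hR0 : 0 < R := mul_pos (radius_pos o hp hk1 hn1) (by linarith)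
    set B := latticeBall o p (k N) R (T N) with hB
    have hBn : (n N : ℝ) ≤ B.card := by
      refine le_trans ?_ hcard
      have : 1 ≤ (k N : ℝ) / 30 := by rw [le_div_iff₀ (by norm_num)]; linarith
      nlinarith
    have hB0 : (0 : ℝ) < B.card := by linarith
    have hmem : ∀ w ∈ B, Admissible o w ∧ intNorm p w ≤ R := fun w hw =>
      ⟨(mem_latticeBall.mp hw).1, (mem_latticeBall.mp hw).2.2⟩
    have hβ' : 0 < 1 / β - 1 := by rw [sub_pos, lt_div_iff₀ hβ0]; linarith
    refine le_trans ?_ (one_sub_le_uniformProb o p hβ0 hβ1 R.toNNReal B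
      (Finset.card_pos.mp (by exact_mod_cast hB0))
      (fun w hw => by rw [Real.coe_toNNReal _ hR0.le]; exact hmem w hw) (T N)
      (fun w hw => (mem_latticeBall.mp hw).2.1)
      (fun g => (2 * Real.exp 1 + normConst o p * R / (g * (k N : ℝ) ^ p.toReal⁻¹)) ^ k N)
      (fun g hg r => card_residueClass_le hk1 o hp hR0 B hmem
        (by rw [Finset.mem_Icc] at hg; omega) r))
    rw [hG N]
    refine sub_le_sub_left (div_le_div_of_nonneg_right (add_le_add ?_ ?_) hβ'.le) _
    · rw [div_le_div_iff₀ hB0 (by linarith)]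
      linarith
    · refine Finset.sum_le_sum fun g hg => ?_
      have hg0 : (0 : ℝ) < g := by
        rw [Finset.mem_Icc] at hg
        have : 0 < g := by omega
        exact_mod_cast this
      gcongr
      have h2 : 2 * Real.exp 1 + normConst o p * R / (g * (k N : ℝ) ^ p.toReal⁻¹) =
          (2 * Real.exp 1 / (n N : ℝ) ^ (1 / (k N : ℝ)) + (1 + errorTerm 1 (k N) (n N)) / g) *
            (n N : ℝ) ^ (1 / (k N : ℝ)) := by
        have h3 := radius_div_rpow o p hk1 (n N)
        have h4 : normConst o p * R / (g * (k N : ℝ) ^ p.toReal⁻¹) =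
            normConst o p * (radius o p (k N) (n N) / (k N : ℝ) ^ p.toReal⁻¹) *
              (1 + errorTerm 1 (k N) (n N)) / g := by rw [hR]; field_simp
        rw [h4, h3]
        field_simp
      rw [h2, mul_pow, rpow_one_div_pow hk1, div_le_iff₀ hB0]
      gcongr

/-! ### Generators proportional to the logarithm of the group size: the geometric weights -/

/-- The sum of `exp (-s * |y|)` over all integers `y` (undirected case) or all `y ≥ 0`
(directed case). -/
noncomputable def partitionSum (o : Orientation) (s : ℝ) : ℝ :=
  (1 + (numSides o - 1) * Real.exp (-s)) / (1 - Real.exp (-s))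

/-- The mean of `|y|` under the weights `exp (-s * |y|)`. -/
noncomputable def meanEntry (o : Orientation) (s : ℝ) : ℝ :=
  numSides o * Real.exp (-s) / ((1 - Real.exp (-s)) * (1 + (numSides o - 1) * Real.exp (-s)))

/-- The entropy of the probability distribution with weights `exp (-s * |y|)`. -/
noncomputable def entropy (o : Orientation) (s : ℝ) : ℝ :=
  s * meanEntry o s + Real.log (partitionSum o s)

theorem exp_neg_lt_one {s : ℝ} (hs : 0 < s) : Real.exp (-s) < 1 := by
  rw [Real.exp_lt_one_iff]; linarith

theorem denom_pos (o : Orientation) (s : ℝ) :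
    0 < 1 + ((numSides o : ℝ) - 1) * Real.exp (-s) := by
  have h : (1 : ℝ) ≤ numSides o := by exact_mod_cast one_le_numSides o
  have := Real.exp_pos (-s)
  nlinarith

theorem partitionSum_pos (o : Orientation) {s : ℝ} (hs : 0 < s) : 0 < partitionSum o s :=
  div_pos (denom_pos o s) (by linarith [exp_neg_lt_one hs])

theorem one_le_partitionSum (o : Orientation) {s : ℝ} (hs : 0 < s) : 1 ≤ partitionSum o s := by
  unfold partitionSum
  rw [one_le_div (by linarith [exp_neg_lt_one hs])]
  have := denom_pos o s
  have h : (1 : ℝ) ≤ numSides o := by exact_mod_cast one_le_numSides o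
  have := Real.exp_pos (-s)
  nlinarith

theorem meanEntry_pos (o : Orientation) {s : ℝ} (hs : 0 < s) : 0 < meanEntry o s := by
  have h : (0 : ℝ) < numSides o := by exact_mod_cast one_le_numSides o
  have h1 := denom_pos o s
  have h2 : 0 < 1 - Real.exp (-s) := by linarith [exp_neg_lt_one hs]
  unfold meanEntry
  positivity

theorem sum_box_exp_le_partitionSum (o : Orientation) (T : ℕ) {s : ℝ} (hs : 0 < s) :
    ∑ y ∈ box o T, Real.exp (-s * |(y : ℝ)|) ≤ partitionSum o s := by
  have hq := exp_neg_lt_one hs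
  have hq0 := Real.exp_pos (-s)
  rw [sum_box_eq o T (F := fun y : ℤ => Real.exp (-s * |(y : ℝ)|)) (by intro y; simp)]
  have h1 : ∀ i ∈ Finset.range T, Real.exp (-s * |(((i : ℤ) + 1 : ℤ) : ℝ)|) =
      Real.exp (-s) * Real.exp (-s) ^ i := by
    intro i _
    rw [← pow_succ', ← Real.exp_nat_mul]
    congr 1; push_cast; rw [abs_of_nonneg (by positivity)]; ring
  rw [Finset.sum_congr rfl h1, ← Finset.mul_sum]
  have h2 : ∑ i ∈ Finset.range T, Real.exp (-s) ^ i ≤ (1 - Real.exp (-s))⁻¹ := by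
    rw [← tsum_geometric_of_lt_one hq0.le hq]
    exact (summable_geometric_of_lt_one hq0.le hq).sum_le_tsum _ fun i _ => by positivity
  have h3 : partitionSum o s = 1 + numSides o * (Real.exp (-s) * (1 - Real.exp (-s))⁻¹) := by
    have : 1 - Real.exp (-s) ≠ 0 := by linarith
    unfold partitionSum; field_simp; ring
  rw [h3]
  simp only [Int.cast_zero, abs_zero, mul_zero, Real.exp_zero]
  gcongr

theorem tendsto_sum_box_exp (o : Orientation) {s : ℝ} (hs : 0 < s) :
    Tendsto (fun T => ∑ y ∈ box o T, Real.exp (-s * |(y : ℝ)|)) atTop (𝓝 (partitionSum o s)) := by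
  have hq := exp_neg_lt_one hs
  have hq0 := Real.exp_pos (-s)
  have h1 := ((hasSum_geometric_of_lt_one hq0.le hq).tendsto_sum_nat.const_mul
    ((numSides o : ℝ) * Real.exp (-s))).const_add 1
  have h3 : partitionSum o s = 1 + numSides o * Real.exp (-s) * (1 - Real.exp (-s))⁻¹ := by
    have : 1 - Real.exp (-s) ≠ 0 := by linarith
    unfold partitionSum; field_simp; ring
  rw [h3]
  refine h1.congr fun T => ?_
  rw [sum_box_eq o T (F := fun y : ℤ => Real.exp (-s * |(y : ℝ)|)) (by intro y; simp), mul_assoc,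
    Finset.mul_sum]
  simp only [Int.cast_zero, abs_zero, mul_zero, Real.exp_zero]
  congr 2
  refine Finset.sum_congr rfl fun i _ => ?_
  rw [← pow_succ', ← Real.exp_nat_mul]
  congr 1; push_cast; rw [abs_of_nonneg (by positivity)]; ring

theorem hasDerivAt_log_partitionSum (o : Orientation) {s : ℝ} (hs : 0 < s) :
    HasDerivAt (fun s => Real.log (partitionSum o s)) (-meanEntry o s) s := by
  have h1 := denom_pos o s
  have h2 : 0 < 1 - Real.exp (-s) := by linarith [exp_neg_lt_one hs]
  have he : HasDerivAt (fun s : ℝ => Real.exp (-s)) (-Real.exp (-s)) s := by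
    simpa using (hasDerivAt_neg s).exp
  have hn := (he.const_mul ((numSides o : ℝ) - 1)).const_add 1
  have hd := he.const_sub 1
  have h := (hn.div hd h2.ne').log (div_pos h1 h2).ne'
  refine h.congr_deriv ?_
  simp only [meanEntry, Pi.div_apply]
  field_simp
  ring

theorem strictAntiOn_meanEntry (o : Orientation) : StrictAntiOn (meanEntry o) (Set.Ioi 0) := by
  intro a ha b hb hab
  have ha' := exp_neg_lt_one ha
  have hb' := exp_neg_lt_one hb
  have hab' : Real.exp (-b) < Real.exp (-a) := Real.exp_lt_exp.mpr (by linarith)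
  have hb0 := Real.exp_pos (-b)
  have h2 : 0 < 1 - Real.exp (-a) := by linarith
  have h3 : 0 < 1 - Real.exp (-b) := by linarith
  have d1 := denom_pos o a
  have d2 := denom_pos o b
  unfold meanEntry
  rw [div_lt_div_iff₀ (by positivity) (by positivity)]
  set u := Real.exp (-a)
  set v := Real.exp (-b)
  cases o
  · simp only [numSides]
    push_cast
    have : 0 < u * v := by positivity
    nlinarith
  · simp only [numSides]
    push_cast
    nlinarith

theorem continuousAt_meanEntry (o : Orientation) {s : ℝ} (hs : 0 < s) :
    ContinuousAt (meanEntry o) s := by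
  have h1 := denom_pos o s
  have h2 : 0 < 1 - Real.exp (-s) := by linarith [exp_neg_lt_one hs]
  unfold meanEntry
  exact ContinuousAt.div (by fun_prop) (by fun_prop) (by positivity)

theorem continuousAt_entropy (o : Orientation) {s : ℝ} (hs : 0 < s) :
    ContinuousAt (entropy o) s :=
  (continuousAt_id.mul (continuousAt_meanEntry o hs)).add
    (hasDerivAt_log_partitionSum o hs).continuousAt

/-- The logarithm of the partition sum is convex, hence lies above its tangents. -/
theorem log_partitionSum_ge (o : Orientation) {a b : ℝ} (ha : 0 < a) (hb : 0 < b) :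
    Real.log (partitionSum o a) - meanEntry o a * (b - a) ≤ Real.log (partitionSum o b) := by
  have hc : ∀ {x y : ℝ}, 0 < x → ContinuousOn (fun s => Real.log (partitionSum o s))
      (Set.Icc x y) := fun hx z hz =>
    (hasDerivAt_log_partitionSum o (hx.trans_le hz.1)).continuousAt.continuousWithinAt
  rcases lt_trichotomy a b with h | rfl | h
  · obtain ⟨c, hc1, hc2⟩ := exists_hasDerivAt_eq_slope _ (fun s => -meanEntry o s) h (hc ha)
      fun x hx => hasDerivAt_log_partitionSum o (ha.trans hx.1)
    have h1 := strictAntiOn_meanEntry o (Set.mem_Ioi.mpr ha) (Set.mem_Ioi.mpr (ha.trans hc1.1)) hc1.1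
    have h2 : 0 < b - a := by linarith
    rw [eq_div_iff h2.ne'] at hc2
    nlinarith
  · simp
  · obtain ⟨c, hc1, hc2⟩ := exists_hasDerivAt_eq_slope _ (fun s => -meanEntry o s) h (hc hb)
      fun x hx => hasDerivAt_log_partitionSum o (hb.trans hx.1)
    have h1 := strictAntiOn_meanEntry o (Set.mem_Ioi.mpr (hb.trans hc1.1)) (Set.mem_Ioi.mpr ha) hc1.2
    have h2 : 0 < a - b := by linarith
    rw [eq_div_iff h2.ne'] at hc2
    nlinarith

/-- The entropy has derivative `s * meanEntry' s`; the tangent bound for the logarithm of the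
partition sum replaces the second derivative. -/
theorem strictAntiOn_entropy (o : Orientation) : StrictAntiOn (entropy o) (Set.Ioi 0) := by
  intro a ha b hb hab
  have h1 := strictAntiOn_meanEntry o ha hb hab
  have h2 := log_partitionSum_ge o (Set.mem_Ioi.mp hb) (Set.mem_Ioi.mp ha)
  have ha' : 0 < a := ha
  unfold entropy
  nlinarith

/-- The entropy takes every positive value: it is continuous, tends to `0` as `s → ∞`, and is at
least the logarithm of the partition sum, which is large for small `s`. -/
theorem exists_entropy_eq (o : Orientation) {h : ℝ} (hh : 0 < h) :
    ∃ s : ℝ, 0 < s ∧ entropy o s = h := by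
  obtain ⟨a, ha, hah⟩ : ∃ a : ℝ, 0 < a ∧ h ≤ entropy o a := by
    have h1 := exp_neg_lt_one hh
    have h0 := Real.exp_pos (-h)
    refine ⟨-Real.log (1 - Real.exp (-h)), ?_, ?_⟩
    · rw [neg_pos]; exact Real.log_neg (by linarith) (by linarith)
    · set a := -Real.log (1 - Real.exp (-h)) with ha
      have ha0 : 0 < a := by rw [ha, neg_pos]; exact Real.log_neg (by linarith) (by linarith)
      have he : Real.exp (-a) = 1 - Real.exp (-h) := by
        rw [ha, neg_neg, Real.exp_log (by linarith)]
      have h2 : Real.exp h ≤ partitionSum o a := by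
        have hs : (1 : ℝ) ≤ numSides o := by exact_mod_cast one_le_numSides o
        unfold partitionSum
        rw [he, sub_sub_cancel, le_div_iff₀ h0, ← Real.exp_add, add_neg_cancel, Real.exp_zero]
        nlinarith
      have h3 : h ≤ Real.log (partitionSum o a) := by
        rw [Real.le_log_iff_exp_le (partitionSum_pos o ha0)]; exact h2
      have h4 := mul_pos ha0 (meanEntry_pos o ha0)
      unfold entropy; linarith
  obtain ⟨b, hb, hbh⟩ : ∃ b : ℝ, 0 < b ∧ entropy o b ≤ h := by
    have he : Tendsto (fun s : ℝ => Real.exp (-s)) atTop (𝓝 0) := Real.tendsto_exp_neg_atTop_nhds_zero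
    have hn : Tendsto (fun s : ℝ => 1 + ((numSides o : ℝ) - 1) * Real.exp (-s)) atTop (𝓝 1) := by
      simpa using (he.const_mul ((numSides o : ℝ) - 1)).const_add 1
    have hd : Tendsto (fun s : ℝ => 1 - Real.exp (-s)) atTop (𝓝 1) := by
      simpa using he.const_sub 1
    have hse : Tendsto (fun s : ℝ => s * Real.exp (-s)) atTop (𝓝 0) := by
      simpa using Real.tendsto_pow_mul_exp_neg_atTop_nhds_zero 1
    have h1 : Tendsto (fun s => Real.log (partitionSum o s)) atTop (𝓝 0) := by
      have := (hn.div hd one_ne_zero).log (by norm_num)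
      unfold partitionSum
      simpa using this
    have h2 : Tendsto (fun s => s * meanEntry o s) atTop (𝓝 0) := by
      have := (hse.const_mul (numSides o : ℝ)).div (hd.mul hn) (by norm_num)
      rw [mul_zero, zero_div] at this
      refine this.congr fun s => ?_
      simp only [meanEntry, Pi.div_apply]; ring
    have h3 : Tendsto (entropy o) atTop (𝓝 0) := by
      have := h2.add h1
      rw [add_zero] at this
      exact this
    obtain ⟨b, hb1, hb2⟩ := ((h3.eventually (gt_mem_nhds hh)).and (eventually_gt_atTop 0)).exists
    exact ⟨b, hb2, hb1.le⟩
  have hcont : ContinuousOn (entropy o) (Set.Ioi 0) := fun x hx =>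
    (continuousAt_entropy o hx).continuousWithinAt
  have := (isPreconnected_Ioi (a := (0 : ℝ))).intermediate_value (Set.mem_Ioi.mpr hb)
    (Set.mem_Ioi.mpr ha) hcont
  obtain ⟨s, hs, hs2⟩ := this ⟨hbh, hah⟩
  exact ⟨s, hs, hs2⟩

/-! ### Generators proportional to the logarithm of the group size: counting -/

theorem intNorm_one_le_iff {k : ℕ} {w : Fin k → ℤ} {R : ℝ} (hR : 0 ≤ R) :
    intNorm 1 w ≤ R ↔ ∑ i, |(w i : ℝ)| ≤ R := by
  rw [intNorm_le_iff le_rfl ENNReal.one_ne_top hR]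
  simp

theorem card_latticeBall_one_le (o : Orientation) {k : ℕ} {s R : ℝ} (hs : 0 < s) (hR : 0 ≤ R)
    (T : ℕ) : ((latticeBall o 1 k R T).card : ℝ) ≤ Real.exp (s * R) * partitionSum o s ^ k := by
  have h := card_residueClass_mul_le o T (latticeBall o 1 k R T)
    (fun w hw i => mem_box.mpr ⟨(mem_latticeBall.mp hw).2.1 i, fun ho => (mem_latticeBall.mp hw).1 ho i⟩)
    (F := fun y => Real.exp (-s * |(y : ℝ)|)) (fun y => (Real.exp_pos _).le)
    (c := Real.exp (-(s * R))) (A := partitionSum o s) (fun w hw => ?_) 1 (fun r => ?_) 0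
  · rw [Finset.filter_true_of_mem (fun w _ i => by simp), Real.exp_neg, ← div_eq_mul_inv,
      div_le_iff₀ (Real.exp_pos _)] at h
    linarith
  · rw [← Real.exp_sum, ← Finset.mul_sum]
    refine Real.exp_le_exp.mpr ?_
    have := (intNorm_one_le_iff hR).mp (mem_latticeBall.mp hw).2.2
    nlinarith
  · rw [Finset.filter_true_of_mem (fun w _ => by simp)]
    exact sum_box_exp_le_partitionSum o T hs

/-- A residue class modulo `g ≥ 2` misses `0` or `1`. -/
theorem sum_residueClass_exp_le (o : Orientation) {L : ℕ} (hL : 1 ≤ L) {s : ℝ} (hs : 0 < s) {g : ℕ}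
    (hg : 2 ≤ g) (r : ℤ) :
    ∑ y ∈ (box o L).filter (fun y => (g : ℤ) ∣ y - r), Real.exp (-s * |(y : ℝ)|) ≤
      ∑ y ∈ box o L, Real.exp (-s * |(y : ℝ)|) - Real.exp (-s) := by
  obtain ⟨z, hz, hzr, hzs⟩ : ∃ z ∈ box o L, ¬ (g : ℤ) ∣ z - r ∧
      Real.exp (-s) ≤ Real.exp (-s * |(z : ℝ)|) := by
    by_cases h0 : (g : ℤ) ∣ 0 - r
    · refine ⟨1, mem_box.mpr ⟨by simpa using hL, fun _ => zero_le_one⟩, fun h1 => ?_, by simp⟩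
      have h2 := dvd_sub h1 h0
      have h3 : (g : ℤ) ∣ 1 := by simpa using h2
      have := Int.le_of_dvd one_pos h3
      omega
    · exact ⟨0, mem_box.mpr ⟨by simp, fun _ => le_rfl⟩, h0, by simp [hs.le]⟩
  rw [le_sub_iff_add_le]
  refine (add_le_add_right hzs _).trans ?_
  have hnot : z ∉ (box o L).filter (fun y => (g : ℤ) ∣ y - r) := fun h =>
    hzr (Finset.mem_filter.mp h).2
  rw [add_comm, ← Finset.sum_insert (f := fun y : ℤ => Real.exp (-s * |(y : ℝ)|)) hnot]
  refine Finset.sum_le_sum_of_subset_of_nonneg ?_ fun y _ _ => (Real.exp_pos _).le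
  intro y hy
  rcases Finset.mem_insert.mp hy with rfl | h
  · exact hz
  · exact Finset.mem_of_mem_filter y h

/-- The weight of the vectors whose entries sum to at most `a₁` in absolute value, estimated by
removing both tails with changed parameters. -/
theorem pow_sum_box_le (o : Orientation) (k L : ℕ) {s a₀ a₁ t : ℝ} (hs : 0 ≤ s) (ht : 0 ≤ t)
    (ha₁ : 0 ≤ a₁) :
    (∑ y ∈ box o L, Real.exp (-s * |(y : ℝ)|)) ^ k ≤
      Real.exp (t * a₀) * (∑ y ∈ box o L, Real.exp (-(s + t) * |(y : ℝ)|)) ^ k +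
      Real.exp (-(t * a₁)) * (∑ y ∈ box o L, Real.exp (-(s - t) * |(y : ℝ)|)) ^ k +
      Real.exp (-(s * a₀)) * (latticeBall o 1 k a₁ L).card := by
  classical
  have hpow : ∀ b : ℝ, (∑ y ∈ box o L, Real.exp (-b * |(y : ℝ)|)) ^ k =
      ∑ w ∈ Fintype.piFinset fun _ : Fin k => box o L, Real.exp (-b * ∑ i, |(w i : ℝ)|) := by
    intro b
    have := Finset.prod_univ_sum (fun _ : Fin k => box o L) fun _ y => Real.exp (-b * |(y : ℝ)|)
    rw [Finset.prod_const, Finset.card_univ, Fintype.card_fin] at this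
    rw [this]
    refine Finset.sum_congr rfl fun w _ => ?_
    rw [← Real.exp_sum, Finset.mul_sum]
  have hcard : ((latticeBall o 1 k a₁ L).card : ℝ) =
      ∑ w ∈ Fintype.piFinset fun _ : Fin k => box o L, if intNorm 1 w ≤ a₁ then 1 else 0 := by
    rw [latticeBall, Finset.card_filter]
    push_cast
    refine Finset.sum_congr rfl fun w _ => ?_
    split_ifs <;> rfl
  rw [hpow, hpow, hpow, hcard, Finset.mul_sum, Finset.mul_sum, Finset.mul_sum,
    ← Finset.sum_add_distrib, ← Finset.sum_add_distrib]
  refine Finset.sum_le_sum fun w _ => ?_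
  set Φ := ∑ i, |(w i : ℝ)| with hΦ
  have hiff : intNorm 1 w ≤ a₁ ↔ Φ ≤ a₁ := intNorm_one_le_iff ha₁
  rw [← Real.exp_add, ← Real.exp_add]
  have p1 := Real.exp_pos (t * a₀ + -(s + t) * Φ)
  have p2 := Real.exp_pos (-(t * a₁) + -(s - t) * Φ)
  have p3 := Real.exp_pos (-(s * a₀))
  rcases lt_or_ge a₁ Φ with h | h
  · have : Real.exp (-s * Φ) ≤ Real.exp (-(t * a₁) + -(s - t) * Φ) :=
      Real.exp_le_exp.mpr (by nlinarith)
    split_ifs <;> linarith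
  rw [if_pos (hiff.mpr h)]
  rcases lt_or_ge Φ a₀ with h' | h'
  · have : Real.exp (-s * Φ) ≤ Real.exp (t * a₀ + -(s + t) * Φ) :=
      Real.exp_le_exp.mpr (by nlinarith)
    linarith
  · have : Real.exp (-s * Φ) ≤ Real.exp (-(s * a₀)) := Real.exp_le_exp.mpr (by nlinarith)
    linarith

/-- Beyond the radius `meanEntry o s * k`, the lattice ball has exponentially more than
`exp (entropy o s * k)` points even if the entries are bounded by a constant `L`, and its residue
classes modulo any `g ≥ 2` are exponentially smaller. -/
theorem exists_latticeSet (o : Orientation) {s : ℝ} (hs : 0 < s) {α : ℝ} (hα : meanEntry o s < α) :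
    ∃ (L : ℕ) (h θ : ℝ), entropy o s < h ∧ 0 < θ ∧ θ < 1 ∧ ∀ᶠ k : ℕ in atTop,
      ∃ B : Finset (Fin k → ℤ), (∀ w ∈ B, Admissible o w ∧ intNorm 1 w ≤ α * k) ∧
        (∀ w ∈ B, ∀ i, |w i| ≤ L) ∧ Real.exp (h * k) / 2 ≤ B.card ∧
        ∀ g : ℕ, 2 ≤ g → ∀ r : Fin k → ℤ,
          ((B.filter fun w => ∀ i, (g : ℤ) ∣ w i - r i).card : ℝ) ≤ 2 * θ ^ k * B.card := by
  -- a smaller parameter, whose mean is still less than `α`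
  obtain ⟨u, hu0, hus, huα⟩ : ∃ u : ℝ, 0 < u ∧ u < s ∧ meanEntry o u < α := by
    have h1 := ((continuousAt_meanEntry o hs).eventually (gt_mem_nhds hα)).filter_mono
      (nhdsWithin_le_nhds (s := Set.Iio s))
    have h2 : ∀ᶠ u in 𝓝[<] s, 0 < u := (lt_mem_nhds hs).filter_mono nhdsWithin_le_nhds
    obtain ⟨u, ⟨h3, h4⟩, h5⟩ := ((h1.and h2).and self_mem_nhdsWithin).exists
    exact ⟨u, h4, h5, h3⟩
  have hent : entropy o s < entropy o u := strictAntiOn_entropy o hu0 hs hus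
  set μ := meanEntry o u with hμ
  have hμ0 : 0 < μ := meanEntry_pos o hu0
  set Z := partitionSum o u with hZ
  have hZ0 : 0 < Z := partitionSum_pos o hu0
  have hZ1 : 1 ≤ Z := one_le_partitionSum o hu0
  have hq0 := Real.exp_pos (-u)
  have hq1 := exp_neg_lt_one hu0
  have hqZ : Real.exp (-u) / Z < 1 := by rw [div_lt_one hZ0]; linarith
  set c := -Real.log (1 - Real.exp (-u) / Z) with hc
  have hc0 : 0 < c := by
    have : 0 < Real.exp (-u) / Z := by positivity
    rw [hc, neg_pos]; exact Real.log_neg (by linarith) (by linarith)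
  -- the half-width of the window around the mean
  obtain ⟨κ, hκ0, hκ1, hκ2, hκ3, hκ4⟩ : ∃ κ : ℝ, 0 < κ ∧ κ < μ ∧ μ + κ ≤ α ∧ 4 * u * κ < c ∧
      u * κ < (entropy o u - entropy o s) / 2 := by
    have hd : 0 < (entropy o u - entropy o s) / 2 := by linarith
    have hm : 0 < min (min (μ / 2) (α - μ)) (min (c / (8 * u)) ((entropy o u - entropy o s) / 2 /
        (2 * u))) := lt_min (lt_min (by positivity) (by linarith)) (lt_min (by positivity)
          (by positivity))
    refine ⟨_, hm, ?_, ?_, ?_, ?_⟩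
    · exact lt_of_le_of_lt ((min_le_left _ _).trans (min_le_left _ _)) (by linarith)
    · have := (min_le_left (min (μ / 2) (α - μ)) (min (c / (8 * u))
        ((entropy o u - entropy o s) / 2 / (2 * u)))).trans (min_le_right _ _)
      linarith
    · have := (min_le_right (min (μ / 2) (α - μ)) (min (c / (8 * u))
        ((entropy o u - entropy o s) / 2 / (2 * u)))).trans (min_le_left _ _)
      rw [le_div_iff₀ (by positivity)] at this
      linarith
    · have := (min_le_right (min (μ / 2) (α - μ)) (min (c / (8 * u))
        ((entropy o u - entropy o s) / 2 / (2 * u)))).trans (min_le_right _ _)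
      rw [le_div_iff₀ (by positivity)] at this
      linarith
  -- a change of parameter for which both tails are exponentially small
  obtain ⟨t, ht0, htu, ht1, ht2⟩ : ∃ t : ℝ, 0 < t ∧ t < u ∧ μ - κ < meanEntry o (u + t) ∧
      meanEntry o (u - t) < μ + κ := by
    have hcont := continuousAt_meanEntry o hu0
    have a1 : Tendsto (fun t : ℝ => meanEntry o (u + t)) (𝓝[>] 0) (𝓝 μ) := by
      refine hcont.tendsto.comp ?_
      have : Tendsto (fun t : ℝ => u + t) (𝓝 0) (𝓝 (u + 0)) :=
        tendsto_const_nhds.add tendsto_id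
      rw [add_zero] at this
      exact this.mono_left nhdsWithin_le_nhds
    have a2 : Tendsto (fun t : ℝ => meanEntry o (u - t)) (𝓝[>] 0) (𝓝 μ) := by
      refine hcont.tendsto.comp ?_
      have : Tendsto (fun t : ℝ => u - t) (𝓝 0) (𝓝 (u - 0)) :=
        tendsto_const_nhds.sub tendsto_id
      rw [sub_zero] at this
      exact this.mono_left nhdsWithin_le_nhds
    have a3 : ∀ᶠ t in 𝓝[>] (0 : ℝ), t < u := (gt_mem_nhds hu0).filter_mono nhdsWithin_le_nhds
    obtain ⟨t, ⟨⟨b1, b2⟩, b3⟩, b4⟩ := (((a1.eventually (lt_mem_nhds (by linarith :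
      μ - κ < μ))).and (a2.eventually (gt_mem_nhds (by linarith : μ < μ + κ)))).and a3).and
        self_mem_nhdsWithin |>.exists
    exact ⟨t, b4, b3, b1, b2⟩
  have htail1 : Real.exp (t * (μ - κ)) * partitionSum o (u + t) < Z := by
    have h1 := log_partitionSum_ge o (show 0 < u + t by linarith) hu0
    have hp := partitionSum_pos o (show 0 < u + t by linarith)
    rw [← Real.log_lt_log_iff (by positivity) hZ0, Real.log_mul (Real.exp_pos _).ne' hp.ne',
      Real.log_exp]
    nlinarith
  have htail2 : Real.exp (-(t * (μ + κ))) * partitionSum o (u - t) < Z := by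
    have h1 := log_partitionSum_ge o (show 0 < u - t by linarith) hu0
    have hp := partitionSum_pos o (show 0 < u - t by linarith)
    rw [← Real.log_lt_log_iff (by positivity) hZ0, Real.log_mul (Real.exp_pos _).ne' hp.ne',
      Real.log_exp]
    nlinarith
  set ρ := max (Real.exp (t * (μ - κ)) * partitionSum o (u + t))
    (Real.exp (-(t * (μ + κ))) * partitionSum o (u - t)) with hρ
  have hρZ : ρ < Z := max_lt htail1 htail2
  have hρ0 : 0 < ρ := lt_max_of_lt_left
    (mul_pos (Real.exp_pos _) (partitionSum_pos o (show 0 < u + t by linarith)))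
  set h := (entropy o u + entropy o s) / 2 with hh
  -- a cutoff `L` that does not affect the exponential rates
  have hexpZ : Real.exp (h - u * (μ - κ)) < Z := by
    rw [← Real.lt_log_iff_exp_lt hZ0]
    have : entropy o u = u * μ + Real.log Z := rfl
    rw [hh]; linarith
  obtain ⟨L, ⟨hL1, hL2⟩, hL3⟩ := (((tendsto_sum_box_exp o hu0).eventually (lt_mem_nhds hρZ)).and
    ((tendsto_sum_box_exp o hu0).eventually (lt_mem_nhds hexpZ))).and
      (eventually_ge_atTop 1) |>.exists
  set ZL := ∑ y ∈ box o L, Real.exp (-u * |(y : ℝ)|) with hZL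
  have hZL0 : 0 < ZL := hρ0.trans hL1
  have hZLZ : ZL ≤ Z := sum_box_exp_le_partitionSum o L hu0
  refine ⟨L, h, (1 - Real.exp (-u) / Z) * Real.exp (2 * u * κ), by linarith,
    mul_pos (by linarith) (Real.exp_pos _), ?_, ?_⟩
  · have : 1 - Real.exp (-u) / Z = Real.exp (-c) := by rw [hc, neg_neg, Real.exp_log (by linarith)]
    rw [this, ← Real.exp_add, Real.exp_lt_one_iff]
    nlinarith
  have hratio : Tendsto (fun k : ℕ => (ρ / ZL) ^ k) atTop (𝓝 0) :=
    tendsto_pow_atTop_nhds_zero_of_lt_one (by positivity) (by rw [div_lt_one hZL0]; exact hL1)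
  filter_upwards [hratio.eventually (gt_mem_nhds (show (0 : ℝ) < 1 / 4 by norm_num))] with k hk
  rw [div_pow, div_lt_iff₀ (by positivity)] at hk
  have hκμ : 0 ≤ (μ + κ) * k := by positivity
  set B := latticeBall o 1 k ((μ + κ) * k) L with hB
  have hsum := pow_sum_box_le o k L (s := u) (a₀ := (μ - κ) * k) (a₁ := (μ + κ) * k) (t := t)
    hu0.le ht0.le hκμ
  rw [← hZL, ← hB] at hsum
  have e1 : Real.exp (t * ((μ - κ) * k)) *
      (∑ y ∈ box o L, Real.exp (-(u + t) * |(y : ℝ)|)) ^ k ≤ ρ ^ k := by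
    have a1 := sum_box_exp_le_partitionSum o L (show 0 < u + t by linarith)
    have a2 : Real.exp (t * ((μ - κ) * k)) = Real.exp (t * (μ - κ)) ^ k := by
      rw [← Real.exp_nat_mul]; congr 1; ring
    rw [a2, ← mul_pow]
    have a3 : 0 ≤ ∑ y ∈ box o L, Real.exp (-(u + t) * |(y : ℝ)|) :=
      Finset.sum_nonneg fun y _ => (Real.exp_pos _).le
    exact pow_le_pow_left₀ (by positivity) ((by gcongr : _ ≤ _ * _).trans (le_max_left _ _)) k
  have e2 : Real.exp (-(t * ((μ + κ) * k))) *
      (∑ y ∈ box o L, Real.exp (-(u - t) * |(y : ℝ)|)) ^ k ≤ ρ ^ k := by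
    have a1 := sum_box_exp_le_partitionSum o L (show 0 < u - t by linarith)
    have a2 : Real.exp (-(t * ((μ + κ) * k))) = Real.exp (-(t * (μ + κ))) ^ k := by
      rw [← Real.exp_nat_mul]; congr 1; ring
    rw [a2, ← mul_pow]
    have a3 : 0 ≤ ∑ y ∈ box o L, Real.exp (-(u - t) * |(y : ℝ)|) :=
      Finset.sum_nonneg fun y _ => (Real.exp_pos _).le
    exact pow_le_pow_left₀ (by positivity) ((by gcongr : _ ≤ _ * _).trans (le_max_right _ _)) k
  have hBZ : ZL ^ k / 2 ≤ Real.exp (-(u * ((μ - κ) * k))) * B.card := by linarith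
  refine ⟨B, fun w hw => ⟨(mem_latticeBall.mp hw).1, (mem_latticeBall.mp hw).2.2.trans ?_⟩,
    fun w hw => (mem_latticeBall.mp hw).2.1, ?_, fun g hg r => ?_⟩
  · gcongr
  · have a1 : Real.exp (h - u * (μ - κ)) ^ k ≤ ZL ^ k :=
      pow_le_pow_left₀ (Real.exp_pos _).le hL2.le k
    have a2 : Real.exp (h - u * (μ - κ)) ^ k =
        Real.exp (-(u * ((μ - κ) * k))) * Real.exp (h * k) := by
      rw [← Real.exp_nat_mul, ← Real.exp_add]; congr 1; ring
    rw [a2] at a1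
    have a3 : Real.exp (-(u * ((μ - κ) * k))) * (Real.exp (h * k) / 2) ≤
      Real.exp (-(u * ((μ - κ) * k))) * B.card := by linarith
    exact le_of_mul_le_mul_left a3 (Real.exp_pos _)
  · have hcos := card_residueClass_mul_le o L B
      (fun w hw i => mem_box.mpr ⟨(mem_latticeBall.mp hw).2.1 i,
        fun ho => (mem_latticeBall.mp hw).1 ho i⟩)
      (F := fun y => Real.exp (-u * |(y : ℝ)|)) (fun y => (Real.exp_pos _).le)
      (c := Real.exp (-(u * ((μ + κ) * k)))) (A := ZL - Real.exp (-u)) (fun w hw => by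
        rw [← Real.exp_sum, ← Finset.mul_sum]
        refine Real.exp_le_exp.mpr ?_
        have := (intNorm_one_le_iff hκμ).mp (mem_latticeBall.mp hw).2.2
        nlinarith) g (fun r => sum_residueClass_exp_le o hL3 hu0 hg r) r
    have a1 : (ZL - Real.exp (-u)) ^ k ≤ (1 - Real.exp (-u) / Z) ^ k * ZL ^ k := by
      rw [← mul_pow]
      refine pow_le_pow_left₀ ?_ ?_ k
      · exact (Finset.sum_nonneg fun y _ => (Real.exp_pos _).le).trans
          (sum_residueClass_exp_le o hL3 hu0 hg 0)
      · have : Real.exp (-u) / Z * ZL ≤ Real.exp (-u) := by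
          rw [div_mul_eq_mul_div, div_le_iff₀ hZ0]; gcongr
        linarith
    have a2 : (0 : ℝ) ≤ (1 - Real.exp (-u) / Z) ^ k := pow_nonneg (by linarith) k
    have a3 : ((B.filter fun w => ∀ i, (g : ℤ) ∣ w i - r i).card : ℝ) *
        Real.exp (-(u * ((μ + κ) * k))) ≤
        (1 - Real.exp (-u) / Z) ^ k * (2 * (Real.exp (-(u * ((μ - κ) * k))) * B.card)) :=
      hcos.trans (a1.trans (by gcongr; linarith))
    have a4 : Real.exp (-(u * ((μ - κ) * k))) =
        Real.exp (2 * u * κ) ^ k * Real.exp (-(u * ((μ + κ) * k))) := by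
      rw [← Real.exp_nat_mul, ← Real.exp_add]; congr 1; ring
    rw [a4] at a3
    refine le_of_mul_le_mul_right (a3.trans (le_of_eq ?_)) (Real.exp_pos (-(u * ((μ + κ) * k))))
    rw [mul_pow]; ring

/-! ### Generators proportional to the logarithm of the group size: concentration -/

/-- The radius `α * k` is correct up to a relative error `ε`, as witnessed by bounds that involve a
group only through its size `n` and its dimension: the smaller lattice ball has at most `ε * n`
points, and the larger one contains a set `B` for which the second moment is at most `1 + ε`. -/
def IsApproxRadius (o : Orientation) (α : ℝ) (k n : ℕ) (ε : ℝ) : Prop :=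
  ((latticeBall o 1 k (α * k * (1 - ε)) ⌊α * k * (1 - ε)⌋₊).card : ℝ) ≤ ε * n ∧
    ∃ (B : Finset (Fin k → ℤ)) (T : ℕ) (D : ℝ), B.Nonempty ∧
      (∀ w ∈ B, Admissible o w ∧ intNorm 1 w ≤ α * k * (1 + ε)) ∧ (∀ w ∈ B, ∀ i, |w i| ≤ T) ∧
      (∀ g ∈ Finset.Icc 2 (2 * T), ∀ r : Fin k → ℤ,
        ((B.filter fun w => ∀ i, (g : ℤ) ∣ w i - r i).card : ℝ) ≤ D) ∧
      ∀ d : ℕ, (d : ℝ) ≤ 1 / 2 * Real.log n / Real.log (Real.log n) →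
        (n : ℝ) / B.card + ∑ g ∈ Finset.Icc 2 (2 * T), (g : ℝ) ^ d * (D / B.card) ≤ ε

/-- The dimensions that are allowed are of smaller order than the number of generators. -/
theorem tendsto_dim_bound_div {k n : ℕ → ℕ} {lam : ℝ} (hlam : 0 < lam)
    (hn : Tendsto n atTop atTop)
    (hkn : Tendsto (fun N => (k N : ℝ) / Real.log (n N)) atTop (𝓝 lam)) :
    Tendsto (fun N => 1 / 2 * Real.log (n N) / Real.log (Real.log (n N)) / k N) atTop (𝓝 0) := by
  have h1 : Tendsto (fun N => Real.log (Real.log (n N))) atTop atTop :=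
    Real.tendsto_log_atTop.comp (Real.tendsto_log_atTop.comp (tendsto_natCast_atTop_atTop.comp hn))
  have h2 := ((hkn.inv₀ hlam.ne').const_mul (1 / 2)).div_atTop h1
  refine h2.congr fun N => ?_
  rw [inv_div]; ring

/-- If the entropy at `s` equals `lim (log n) / k`, the lattice ball of radius `α * k` has size
`n ^ (1 + o(1))`, and a relative change of the radius by `ε` changes it by an exponential factor. As
the entries of the vectors are bounded and `d = o(k)`, that factor absorbs all of the `g ^ d`. -/
theorem eventually_isApproxRadius (o : Orientation) {s lam : ℝ} (hs : 0 < s) (hlam : 0 < lam)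
    (hent : entropy o s = 1 / lam) {k n : ℕ → ℕ} (hn : Tendsto n atTop atTop)
    (hk : Tendsto k atTop atTop)
    (hkn : Tendsto (fun N => (k N : ℝ) / Real.log (n N)) atTop (𝓝 lam)) {ε : ℝ} (hε0 : 0 < ε)
    (hε1 : ε < 1) :
    ∀ᶠ N in atTop, IsApproxRadius o (meanEntry o s) (k N) (n N) ε := by
  set α := meanEntry o s with hα
  have hα0 : 0 < α := meanEntry_pos o hs
  have hkR : Tendsto (fun N => (k N : ℝ)) atTop atTop := tendsto_natCast_atTop_atTop.comp hk
  have hlog : Tendsto (fun N => Real.log (n N) / k N) atTop (𝓝 (1 / lam)) := by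
    rw [one_div]
    exact (hkn.inv₀ hlam.ne').congr fun N => inv_div _ _
  have hdecay : ∀ c : ℝ, 0 < c → Tendsto (fun N => Real.exp (-(c * k N))) atTop (𝓝 0) := fun c hc =>
    Real.tendsto_exp_atBot.comp (tendsto_neg_atTop_atBot.comp (hkR.const_mul_atTop hc))
  obtain ⟨L, h, θ, hh, hθ0, hθ1, hB⟩ := exists_latticeSet o hs
    (show meanEntry o s < α * (1 + ε) by rw [← hα]; nlinarith)
  rw [hent] at hh
  set c := -Real.log θ with hc
  have hc0 : 0 < c := by rw [hc, neg_pos]; exact Real.log_neg hθ0 hθ1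
  have hθc : ∀ m : ℕ, θ ^ m = Real.exp (-(c * m)) := by
    intro m
    rw [hc, neg_mul, neg_neg, mul_comm, Real.exp_nat_mul, Real.exp_log hθ0]
  -- `M` bounds every modulus `g ≤ 2 * L` that can occur
  set M : ℝ := 2 * L + 1 with hM
  have hM1 : 1 ≤ M := by rw [hM]; have : (0 : ℝ) ≤ L := by positivity
                         linarith
  have hlM : 0 ≤ Real.log M := Real.log_nonneg hM1
  have hγ : 0 < c / (2 * (Real.log M + 1)) := by positivity
  have hsmall : Tendsto (fun N => 2 * Real.exp (-((h - 1 / lam) / 2 * k N)) +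
      M * (2 * Real.exp (-(c / 2 * k N)))) atTop (𝓝 0) := by
    have := ((hdecay _ (show 0 < (h - 1 / lam) / 2 by linarith)).const_mul 2).add
      (((hdecay _ (show 0 < c / 2 by linarith)).const_mul 2).const_mul M)
    simpa using this
  have hsα : 0 < s * α * ε / 2 := by positivity
  filter_upwards [hk.eventually_ge_atTop 1, hn.eventually_ge_atTop 1, hk.eventually hB,
    hlog.eventually (lt_mem_nhds (show 1 / lam - s * α * ε / 2 < 1 / lam by linarith)),
    hlog.eventually (gt_mem_nhds (show 1 / lam < 1 / lam + (h - 1 / lam) / 2 by linarith)),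
    (hdecay _ hsα).eventually (gt_mem_nhds hε0),
    (tendsto_dim_bound_div hlam hn hkn).eventually (gt_mem_nhds hγ),
    hsmall.eventually (gt_mem_nhds hε0)] with N hk1 hn1 hB hlog1 hlog2 hdec hdim hsmall
  have hk0 : (0 : ℝ) < k N := by exact_mod_cast hk1
  have hn0 : (0 : ℝ) < n N := by exact_mod_cast hn1
  rw [lt_div_iff₀ hk0] at hlog1
  rw [div_lt_iff₀ hk0] at hlog2 hdim
  constructor
  · have h1 := card_latticeBall_one_le o (k := k N) hs (R := α * k N * (1 - ε))
      (mul_nonneg (by positivity) (by linarith)) ⌊α * k N * (1 - ε)⌋₊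
    refine h1.trans ?_
    have h2 : Real.exp (s * (α * k N * (1 - ε))) * partitionSum o s ^ k N =
        Real.exp (k N * (1 / lam) - s * α * ε * k N) := by
      rw [← hent, ← Real.exp_log (partitionSum_pos o hs), ← Real.exp_nat_mul, ← Real.exp_add]
      congr 1
      unfold entropy
      rw [← hα]; ring
    rw [h2]
    calc Real.exp (k N * (1 / lam) - s * α * ε * k N)
        ≤ Real.exp (-(s * α * ε / 2 * k N) + Real.log (n N)) :=
          Real.exp_le_exp.mpr (by linarith)
      _ = Real.exp (-(s * α * ε / 2 * k N)) * n N := by rw [Real.exp_add, Real.exp_log hn0]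
      _ ≤ ε * n N := by gcongr
  · obtain ⟨B, hB1, hB2, hB3, hB4⟩ := hB
    have hB0 : (0 : ℝ) < B.card := lt_of_lt_of_le (by positivity) hB3
    refine ⟨B, L, 2 * θ ^ k N * B.card, Finset.card_pos.mp (by exact_mod_cast hB0),
      fun w hw => ⟨(hB1 w hw).1, (hB1 w hw).2.trans (le_of_eq (by ring))⟩, hB2, fun g hg r =>
        hB4 g (Finset.mem_Icc.mp hg).1 r, fun d hd => ?_⟩
    refine le_trans (add_le_add ?_ ?_) hsmall.le
    · rw [div_le_iff₀ hB0]
      calc (n N : ℝ) = Real.exp (Real.log (n N)) := (Real.exp_log hn0).symm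
        _ ≤ Real.exp (-((h - 1 / lam) / 2 * k N) + h * k N) :=
            Real.exp_le_exp.mpr (by linarith)
        _ = 2 * Real.exp (-((h - 1 / lam) / 2 * k N)) * (Real.exp (h * k N) / 2) := by
            rw [Real.exp_add]; ring
        _ ≤ _ := by gcongr
    · have hterm : ∀ g ∈ Finset.Icc 2 (2 * L),
          (g : ℝ) ^ d * (2 * θ ^ k N * B.card / B.card) ≤ 2 * Real.exp (-(c / 2 * k N)) := by
        intro g hg
        have hgM : (g : ℝ) ≤ M := by
          have : (g : ℝ) ≤ 2 * L := by exact_mod_cast (Finset.mem_Icc.mp hg).2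
          linarith
        rw [mul_div_cancel_right₀ _ hB0.ne', hθc, mul_left_comm]
        refine mul_le_mul_of_nonneg_left ?_ (by norm_num)
        have h1 : (g : ℝ) ^ d ≤ Real.exp (d * Real.log M) := by
          rw [Real.exp_nat_mul, Real.exp_log (by linarith)]
          gcongr
        have h2 : d * Real.log M ≤ c / 2 * k N := by
          have h3 : (d : ℝ) ≤ c / (2 * (Real.log M + 1)) * k N := hd.trans hdim.le
          calc d * Real.log M ≤ c / (2 * (Real.log M + 1)) * k N * (Real.log M + 1) := by
                gcongr; linarith
            _ = c / 2 * k N := by field_simp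
        calc (g : ℝ) ^ d * Real.exp (-(c * k N))
            ≤ Real.exp (d * Real.log M) * Real.exp (-(c * k N)) := by gcongr
          _ ≤ _ := by rw [← Real.exp_add]; exact Real.exp_le_exp.mpr (by linarith)
      refine (Finset.sum_le_card_nsmul _ _ _ hterm).trans ?_
      rw [nsmul_eq_mul]
      refine mul_le_mul_of_nonneg_right ?_ (by positivity)
      rw [Nat.card_Icc]
      have : ((2 * L + 1 - 2 : ℕ) : ℝ) ≤ ((2 * L + 1 : ℕ) : ℝ) := by
        exact_mod_cast Nat.sub_le _ _
      rw [hM]; push_cast at this ⊢; linarith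

/-- A property that holds eventually for each fixed index holds eventually along a slowly growing
index. -/
theorem exists_tendsto_of_forall_eventually {P : ℕ → ℕ → Prop}
    (h : ∀ m, ∀ᶠ N in atTop, P N m) :
    ∃ m : ℕ → ℕ, Tendsto m atTop atTop ∧ ∀ᶠ N in atTop, P N (m N) := by
  choose N₀ hN₀ using fun m => (h m).exists_forall_of_atTop
  refine ⟨fun N => Nat.findGreatest (fun m => N₀ m ≤ N) N, ?_, ?_⟩
  · refine tendsto_atTop.mpr fun M => ?_
    filter_upwards [eventually_ge_atTop (max M (N₀ M))] with N hN
    exact Nat.le_findGreatest ((le_max_left _ _).trans hN) ((le_max_right _ _).trans hN)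
  · filter_upwards [eventually_ge_atTop (N₀ 0)] with N hN
    exact hN₀ _ N (Nat.findGreatest_spec (P := fun m => N₀ m ≤ N) (Nat.zero_le _) hN)

theorem IsApproxRadius.le_typicalDist {o : Orientation} {α : ℝ} {k n : ℕ} {ε β : ℝ}
    (h : IsApproxRadius o α k n ε) (hα : 0 < α) (hε : ε < 1) (hεβ : ε < β) (hn : 0 < n)
    {G : Type*} [AddCommGroup G] [Finite G] (hG : Nat.card G = n) (Z : Fin k → G) :
    ENNReal.ofReal (α * k * (1 - ε)) ≤ typicalDist o 1 β Z := by
  have hR : 0 ≤ α * k * (1 - ε) := mul_nonneg (by positivity) (by linarith)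
  refine TypicalDistance.le_typicalDist o le_rfl Z _
    (fun w ha hw => mem_latticeBall.mpr ⟨ha, fun i => ?_, hw⟩) (lt_of_le_of_lt h.1 ?_)
  · exact (mem_box.mp (mem_box_of_intNorm_le le_rfl hR ha hw i)).1
  · rw [hG]
    have : (0 : ℝ) < n := by exact_mod_cast hn
    gcongr

theorem IsApproxRadius.one_sub_le_uniformProb {o : Orientation} {α : ℝ} {k n : ℕ} {ε β : ℝ}
    (h : IsApproxRadius o α k n ε) (hα : 0 < α) (hε : 0 ≤ ε) (hβ0 : 0 < β) (hβ1 : β < 1)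
    {G : Type*} [AddCommGroup G] [Finite G] (hG : Nat.card G = n)
    (hd : (dimension G : ℝ) ≤ 1 / 2 * Real.log n / Real.log (Real.log n)) :
    1 - ε / (1 / β - 1) ≤ uniformProb fun Z : Fin k → G =>
      typicalDist o 1 β Z ≤ (α * k * (1 + ε)).toNNReal := by
  obtain ⟨-, B, T, D, hne, hB, hT, hD, hsum⟩ := h
  have hR : 0 ≤ α * k * (1 + ε) := by positivity
  have hβ' : 0 < 1 / β - 1 := by rw [sub_pos, lt_div_iff₀ hβ0]; linarith
  refine le_trans ?_ (TypicalDistance.one_sub_le_uniformProb o 1 hβ0 hβ1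
    (α * k * (1 + ε)).toNNReal B hne
    (fun w hw => by rw [Real.coe_toNNReal _ hR]; exact hB w hw) T hT (fun _ => D) hD)
  rw [hG]
  exact sub_le_sub_left (div_le_div_of_nonneg_right (hsum _ hd) hβ'.le) _

/-! ### The constants -/

theorem radius_undirected_one (k n : ℕ) :
    radius Orientation.undirected 1 k n =
      (k : ℝ) * (n : ℝ) ^ (1 / (k : ℝ)) / (2 * Real.exp 1) := by
  simp [radius, normConst, one_add_one_eq_two]

theorem radius_directed (p : ℝ≥0∞) (k n : ℕ) :
    radius Orientation.directed p k n = 2 * radius Orientation.undirected p k n := by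
  simp only [radius, normConst]
  rw [div_div_eq_mul_div]
  ring

end TypicalDistance

theorem mainTheorem2 :
    -- the regime `k ≪ log n`
    (∀ p : ℝ≥0∞, 1 ≤ p → ∃ K : ℝ, 0 < K ∧
      ∀ k n : ℕ → ℕ, TypicalDistance.HypothesisOne k n p →
        Tendsto (fun N => (k N : ℝ) / Real.log (n N)) atTop (𝓝 0) →
        -- the error term vanishes
        Tendsto (fun N => TypicalDistance.errorTerm K (k N) (n N)) atTop (𝓝 0) ∧
        -- concentration of the typical distance
        (∀ (G : ℕ → Type*) [∀ N, AddCommGroup (G N)] [∀ N, Finite (G N)],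
          (∀ N, Nat.card (G N) = n N) →
          TypicalDistance.HypothesisTwo k n (fun N => TypicalDistance.dimension (G N))
            (fun N => TypicalDistance.minSideLength (G N)) p →
          ∀ (o : TypicalDistance.Orientation) (β : ℝ), 0 < β → β < 1 →
            TypicalDistance.ConcentratesWhp o p β k G
              (fun N => TypicalDistance.radius o p (k N) (n N))
              (fun N => TypicalDistance.errorTerm K (k N) (n N))) ∧
        -- deterministic lower bound for all Abelian groups and all generators
        (∀ (o : TypicalDistance.Orientation) (β : ℝ), 0 < β → β < 1 →
          ∀ᶠ N in atTop, ∀ (G : Type*) [AddCommGroup G] [Finite G], Nat.card G = n N →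
            ∀ Z : Fin (k N) → G,
              ENNReal.ofReal (TypicalDistance.radius o p (k N) (n N) *
                  (1 - TypicalDistance.errorTerm K (k N) (n N))) ≤
                TypicalDistance.typicalDist o p β Z)) ∧
    -- the regime `k ∼ lam * log n`, with `p = 1`
    (∀ lam : ℝ, 0 < lam → ∃ α : TypicalDistance.Orientation → ℝ, (∀ o, 0 < α o) ∧
      ∀ k n : ℕ → ℕ, TypicalDistance.HypothesisOne k n 1 →
        Tendsto (fun N => (k N : ℝ) / Real.log (n N)) atTop (𝓝 lam) →
        ∃ ξ : ℕ → ℝ, Tendsto ξ atTop (𝓝 0) ∧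
        -- concentration of the typical distance
        (∀ (G : ℕ → Type*) [∀ N, AddCommGroup (G N)] [∀ N, Finite (G N)],
          (∀ N, Nat.card (G N) = n N) →
          TypicalDistance.HypothesisTwo k n (fun N => TypicalDistance.dimension (G N))
            (fun N => TypicalDistance.minSideLength (G N)) 1 →
          ∀ (o : TypicalDistance.Orientation) (β : ℝ), 0 < β → β < 1 →
            TypicalDistance.ConcentratesWhp o 1 β k G (fun N => α o * (k N : ℝ)) ξ) ∧
        -- deterministic lower bound for all Abelian groups and all generators
        (∀ (o : TypicalDistance.Orientation) (β : ℝ), 0 < β → β < 1 →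
          ∀ᶠ N in atTop, ∀ (G : Type*) [AddCommGroup G] [Finite G], Nat.card G = n N →
            ∀ Z : Fin (k N) → G,
              ENNReal.ofReal (α o * (k N : ℝ) * (1 - ξ N)) ≤
                TypicalDistance.typicalDist o 1 β Z)) ∧
    -- explicit values of the predicted typical distance
    (∀ k n : ℕ,
      TypicalDistance.radius TypicalDistance.Orientation.undirected 1 k n =
        (k : ℝ) * (n : ℝ) ^ (1 / (k : ℝ)) / (2 * Real.exp 1)) ∧
    (∀ (p : ℝ≥0∞) (k n : ℕ), 1 ≤ p →
      TypicalDistance.radius TypicalDistance.Orientation.directed p k n =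
        2 * TypicalDistance.radius TypicalDistance.Orientation.undirected p k n) := by
  refine ⟨fun p hp => ⟨1, one_pos, fun k n hyp hkn => ?_⟩, fun lam hlam => ?_,
    TypicalDistance.radius_undirected_one, fun p k n _ => TypicalDistance.radius_directed p k n⟩
  · obtain ⟨hn, hk, -⟩ := hyp
    refine ⟨TypicalDistance.tendsto_errorTerm hn hk hkn, ?_, fun o β hβ0 _ =>
      TypicalDistance.eventually_le_typicalDist hp hn hk hkn o hβ0⟩
    intro G _ _ hG hyp2 o β hβ0 hβ1
    refine TypicalDistance.concentratesWhp_radius hp hn hk hkn G hG ?_ o hβ0 hβ1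
    rcases hyp2.2 with h | ⟨⟨lam, hlam, h⟩, -⟩
    · exact h.2
    · exact absurd (tendsto_nhds_unique hkn h) hlam.ne
  · choose s hs hent using fun o => TypicalDistance.exists_entropy_eq o (one_div_pos.mpr hlam)
    refine ⟨fun o => TypicalDistance.meanEntry o (s o),
      fun o => TypicalDistance.meanEntry_pos o (hs o), fun k n hyp hkn => ?_⟩
    obtain ⟨hn, hk, -⟩ := hyp
    -- the relative errors `1 / (m + 2)`, which the diagonal argument lets tend to `0`
    have hε : ∀ m : ℕ, (0 : ℝ) < 1 / ((m : ℝ) + 2) ∧ 1 / ((m : ℝ) + 2) < 1 := fun m =>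
      ⟨by positivity, by rw [div_lt_one (by positivity)]; linarith [m.cast_nonneg (α := ℝ)]⟩
    have hev : ∀ m : ℕ, ∀ᶠ N in atTop, ∀ o, TypicalDistance.IsApproxRadius o
        (TypicalDistance.meanEntry o (s o)) (k N) (n N) (1 / ((m : ℝ) + 2)) := by
      intro m
      have h := fun o => TypicalDistance.eventually_isApproxRadius o (hs o) hlam (hent o) hn hk hkn
        (hε m).1 (hε m).2
      filter_upwards [h TypicalDistance.Orientation.undirected,
        h TypicalDistance.Orientation.directed] with N h1 h2 o
      cases o
      exacts [h1, h2]
    obtain ⟨m, hm, hP⟩ := TypicalDistance.exists_tendsto_of_forall_eventually hev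
    have hξ : Tendsto (fun N => 1 / ((m N : ℝ) + 2)) atTop (𝓝 0) :=
      (tendsto_atTop_add_const_right _ _ (tendsto_natCast_atTop_atTop.comp hm)).const_div_atTop 1
    refine ⟨_, hξ, ?_, fun o β hβ0 _ => ?_⟩
    · intro G _ _ hG hyp2 o β hβ0 hβ1
      have hd := hyp2.2.resolve_left fun h => hlam.ne' (tendsto_nhds_unique hkn h.1)
      have hα := TypicalDistance.meanEntry_pos o (hs o)
      have herr := hξ.div_const (1 / β - 1)
      rw [zero_div] at herr
      refine TypicalDistance.concentratesWhp_of_bounds ?_ (Eventually.of_forall fun N => (hε _).1.le)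
        ?_ herr ?_
      · filter_upwards [hk.eventually_ge_atTop 1] with N hk1
        have : (0 : ℝ) < k N := by exact_mod_cast hk1
        positivity
      · filter_upwards [hP, hξ.eventually (gt_mem_nhds hβ0), hn.eventually_ge_atTop 1]
          with N hP hβN hn1 Z
        exact (hP o).le_typicalDist hα (hε _).2 hβN hn1 (hG N) Z
      · filter_upwards [hP] with N hP
        exact (hP o).one_sub_le_uniformProb hα (hε _).1.le hβ0 hβ1 (hG N) (hd.2.2 N)
    · filter_upwards [hP, hξ.eventually (gt_mem_nhds hβ0), hn.eventually_ge_atTop 1]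
        with N hP hβN hn1 G _ _ hG Z
      exact (hP o).le_typicalDist (TypicalDistance.meanEntry_pos o (hs o)) (hε _).2 hβN hn1 hG Z
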